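/- Let $d>2$ and $T>0$. **Hamiltonian.** Let $H\in C^\infty(\mathbb R^d\times\mathbb R^d)$ be such that $p\mapsto H(x,p)$ is strictly convex for every $x$, $H\ge 0$, and $\lim_{|p|\to\infty}H(x,p)/|p|=+\infty$ for every $x$. Put $L(x,v)=\sup_p\,(-p\cdot v-H(x,p))$ and assume $L(\cdot,0)\in L^1(\mathbb R^d)\cap L^\infty(\mathbb R^d)$ and $L(x,0)\ge 0$. Assume further that there are constants $k,K>0$ such that for all $x,p\in\mathbb R^d$ and all symmetric matrices $M$ $$D_pH\cdot p-H\ge kH-K,\quad |D^2_{xp}H|^2\le KH,\quad |D^2_{pp}H\,M|^2\le K\operatorname{Tr}(D^2_{pp}H\,M\,M),$$ $$|D_pH|^2\le K+KH,\quad |D_xH|\le K+KH .$$ **Coupling and data.** Let $g:\mathbb R\to\mathbb R$ be non-decreasing with $g(0)=0$, and suppose that for some $\alpha>0$ and $K>0$ one has $g(z)\le Kz$ for $0\le z\le 1$ and $g(z)\le Kz^\alpha$ for $z>1$. Suppose also that $g=G'$ for a convex function $G:\mathbb R\to\mathbb R$ with $C_1z^{\alpha+1}\le G(z)\le C_2z^{\alpha+1}$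 for $z>1$ and some $C_1,C_2>0$. Let $u_T,m_0:\mathbb R^d\to\mathbb R$ be smooth and integrable, with $m_0\ge0$ compactly supported and $\int_{\mathbb R^d} m_0\,dx=1$. **Solutions.** A solution of $$\mu_t-\operatorname{div}(D_pH(x,Du)\,\mu)=\Delta \mu \ \text{ in } \mathbb R^d\times(\tau,T),\qquad \mu(\cdot,\tau)=\mu_0,$$ is a function $\mu$, smooth on $\mathbb R^d\times(\tau,T]$ and integrable on that strip, which satisfies the equation pointwise and for which $\|\mu(\cdot,t)-\mu_0\|_{L^1(\mathbb R^d)}\to0$ as $t\downarrow\tau$. A solution of the mean-field game $$-u_t+H(x,Du)=\Delta u+g(m),\qquad m_t-\operatorname{div}(D_pH(x,Du)\,m)=\Delta m,\qquad u(\cdot,T)=u_T,\quad m(\cdot,0)=m_0,$$ is a pair $(u,m)$ of functions, smooth on $\mathbb R^d\times[0,T]$, such that $u$ and $Du$ are bounded there (no bound being prescribed), the first equation holds pointwise in $\mathbb R^d\times(0,T)$, and $m$ solves the second equation in the above sense with $\tau=0$. **Statement.** Let $c>2$ and $a\ge \dfrac{cd}{c-2}$. Define $a',c',\tilde s$ by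 $\frac1a+\frac1{a'}=1$, $\frac1c+\frac1{c'}=1$, $\frac1c+\frac1{\tilde s}=\frac12$. Let $1<p'<\infty$ and $R>0$. Then there is a constant $C\ge 0$, depending only on $d,T,H,u_T,a,c,p',R$, such that the following holds for every such $\alpha,g,m_0$, every solution $(u,m)$ of the mean-field game, every $\tau\in[0,T)$, every $\phi\ge0$ supported in $\{|x|\le R\}$ with $\|\phi\|_{L^{p'}(\mathbb R^d)}=1$, every solution $\zeta$ of $$\zeta_t-\operatorname{div}(D_pH(x,Du)\,\zeta)=\Delta\zeta \ \text{ in }\mathbb R^d\times(\tau,T),\qquad \zeta(\cdot,\tau)=\phi,$$ and every unit vector $\xi\in\mathbb R^d$: $$\Big|\int_{\mathbb R^d}u_\xi(x,\tau)\phi(x)\,dx\Big|\le C+C\|g\|\,(1+\|\zeta\|)+C\|g\|^{\frac{3\tilde s+2}{2\tilde s}}\Big(1+\|\zeta\|^{\frac{2+\tilde s}{2\tilde s}}\Big).$$ Here $u_\xi=\xi\cdot Du$, $\|g\|=\|g(m)\|_{L^c(0,T;L^a(\mathbb R^d))}$ and $\|\zeta\|=\|\zeta\|_{L^{c'}(\tau,T;L^{a'}(\mathbb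 R^d))}$. The norms may be infinite; the right-hand side is read in $[0,\infty]$ with $0\cdot\infty=0$. -/

import Mathlib

open MeasureTheory Set Filter Topology
open scoped NNReal ENNReal ContDiff Gradient InnerProductSpace Laplacian

noncomputable section

namespace MFG

/-- The Euclidean space `ℝᵈ`. -/
abbrev Space (d : ℕ) := EuclideanSpace ℝ (Fin d)

variable {d : ℕ}

/-- The mixed norm `‖f‖_{Lᶜ(s,t;Lᵃ(ℝᵈ))}`, with values in `[0,∞]`. -/
def mixedNorm (c a s t : ℝ) (f : ℝ → Space d → ℝ) : ℝ≥0∞ :=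
  (∫⁻ r in Ioo s t, (eLpNorm (f r) (ENNReal.ofReal a) volume) ^ c) ^ (1 / c)

/-- The divergence of a vector field. -/
def divergence (F : Space d → Space d) (x : Space d) : ℝ :=
  ∑ i : Fin d, (fderiv ℝ F x (EuclideanSpace.single i 1)) i

/-- `D_p H(x,p)`. -/
def gradP (H : Space d → Space d → ℝ) (x p : Space d) : Space d := ∇ (H x) p

/-- `D_x H(x,p)`. -/
def gradX (H : Space d → Space d → ℝ) (x p : Space d) : Space d := ∇ (fun y => H y p) x

/-- `D²_{pp} H(x,p)`, as a linear map. -/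
def hessPP (H : Space d → Space d → ℝ) (x p : Space d) : Space d →L[ℝ] Space d :=
  fderiv ℝ (fun q => gradP H x q) p

/-- `D²_{xp} H(x,p)`, as a linear map. -/
def hessXP (H : Space d → Space d → ℝ) (x p : Space d) : Space d →L[ℝ] Space d :=
  fderiv ℝ (fun y => gradP H y p) x

/-- The Lagrangian `L(x,v) = sup_p (-p·v - H(x,p))`. -/
def lagrangian (H : Space d → Space d → ℝ) (x v : Space d) : ℝ :=
  ⨆ p : Space d, (-(inner ℝ p v) - H x p)

/-- The standing assumptions on the Hamiltonian. -/
structure HamiltonianAssumptions (H : Space d → Space d → ℝ) : Prop where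
  smooth : ContDiff ℝ ∞ (fun z : Space d × Space d => H z.1 z.2)
  strictConvex : ∀ x, StrictConvexOn ℝ univ (H x)
  nonneg : ∀ x p, 0 ≤ H x p
  coercive : ∀ x, Tendsto (fun p => H x p / ‖p‖) (cocompact (Space d)) atTop
  lagrangian_integrable : Integrable (fun x => lagrangian H x 0)
  lagrangian_bounded : MemLp (fun x => lagrangian H x 0) ∞
  lagrangian_nonneg : ∀ x, 0 ≤ lagrangian H x 0
  gradP_lower : ∃ c > 0, ∃ C > 0, ∀ x p,
    c * H x p - C ≤ inner ℝ (gradP H x p) p - H x p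
  hessXP_bound : ∃ C > 0, ∀ x p, ‖hessXP H x p‖ ^ 2 ≤ C * H x p
  hessPP_bound : ∃ C > 0, ∀ x p, ∀ M : Space d →L[ℝ] Space d,
    (M : Space d →ₗ[ℝ] Space d).IsSymmetric →
      ‖(hessPP H x p).comp M‖ ^ 2 ≤
        C * LinearMap.trace ℝ (Space d)
          (((hessPP H x p).comp (M.comp M) : Space d →L[ℝ] Space d) :
            Space d →ₗ[ℝ] Space d)
  gradP_bound : ∃ C > 0, ∀ x p, ‖gradP H x p‖ ^ 2 ≤ C + C * H x p
  gradX_bound : ∃ C > 0, ∀ x p, ‖gradX H x p‖ ≤ C + C * H x p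

/-- The assumptions on the terminal value `u_T`. -/
structure TerminalDatum (uT : Space d → ℝ) : Prop where
  smooth : ContDiff ℝ ∞ uT
  integrable : Integrable uT

/-- The assumptions on the initial density `m₀`. -/
structure InitialDatum (m0 : Space d → ℝ) : Prop where
  smooth : ContDiff ℝ ∞ m0
  integrable : Integrable m0
  nonneg : ∀ x, 0 ≤ m0 x
  compactSupport : HasCompactSupport m0
  mass : ∫ x, m0 x = 1

/-- The assumptions on the coupling `g`, with growth exponent `α`. -/
structure CouplingAssumptions (α : ℝ) (g : ℝ → ℝ) : Prop where
  alpha_pos : 0 < α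
  mono : Monotone g
  zero : g 0 = 0
  growth : ∃ C > 0, (∀ z, 0 ≤ z → z ≤ 1 → g z ≤ C * z) ∧ ∀ z, 1 < z → g z ≤ C * z ^ α
  primitive : ∃ G : ℝ → ℝ, ConvexOn ℝ univ G ∧ (∀ z, HasDerivAt G (g z) z) ∧
    ∃ C₁ > 0, ∃ C₂ > 0, ∀ z, 1 < z →
      C₁ * z ^ (α + 1) ≤ G z ∧ G z ≤ C₂ * z ^ (α + 1)

/-- `μ` is a smooth solution on `ℝᵈ × (τ,T]`, integrable over that strip, of
`μ_t - div (D_pH(x,Du) μ) = Δμ`, with initial value `φ` at time `τ` attained in `L¹`. -/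
structure IsFokkerPlanckSolution (H : Space d → Space d → ℝ) (u : ℝ → Space d → ℝ)
    (τ T : ℝ) (φ : Space d → ℝ) (μ : ℝ → Space d → ℝ) : Prop where
  smooth : ContDiffOn ℝ ∞ (fun z : ℝ × Space d => μ z.1 z.2) (Ioc τ T ×ˢ univ)
  integrable : IntegrableOn (fun z : ℝ × Space d => μ z.1 z.2) (Ioc τ T ×ˢ univ)
  equation : ∀ t ∈ Ioo τ T, ∀ x,
    deriv (fun r => μ r x) t -
      divergence (fun y => μ t y • gradP H y (∇ (u t) y)) x = Δ (μ t) x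
  initial : Tendsto (fun t => eLpNorm (μ t - φ) 1 volume) (𝓝[>] τ) (𝓝 0)

/-- `(u,m)` is a classical solution on `ℝᵈ × [0,T]` of the mean-field game
`-u_t + H(x,Du) = Δu + g(m)`, `m_t - div (D_pH(x,Du) m) = Δm`, `u(·,T) = u_T`, `m(·,0) = m₀`:
`u` and `m` are smooth up to the end times, `u` and `Du` are bounded and `m` is integrable. -/
structure IsMFGSolution (H : Space d → Space d → ℝ) (g : ℝ → ℝ) (T : ℝ)
    (uT m0 : Space d → ℝ) (u m : ℝ → Space d → ℝ) : Prop where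
  smooth_u : ContDiffOn ℝ ∞ (fun z : ℝ × Space d => u z.1 z.2) (Icc 0 T ×ˢ univ)
  smooth_m : ContDiffOn ℝ ∞ (fun z : ℝ × Space d => m z.1 z.2) (Icc 0 T ×ˢ univ)
  bounded : ∃ K : ℝ, ∀ t ∈ Icc 0 T, ∀ x, |u t x| ≤ K ∧ ‖∇ (u t) x‖ ≤ K
  hamiltonJacobi : ∀ t ∈ Ioo 0 T, ∀ x,
    -deriv (fun r => u r x) t + H x (∇ (u t) x) = Δ (u t) x + g (m t x)
  fokkerPlanck : IsFokkerPlanckSolution H u 0 T m0 m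
  terminal : u T = uT
  initial : m 0 = m0

end MFG

end

/-!
The estimate is obtained by the adjoint method, in a form which does not need the norm of the
adjoint density: for `N` the mixed norm of the source `f = g(m)`,
`|∫ u_ξ(τ) φ| ≤ C (1 + N + N ^ (2 - 1 / c))`. Since `(3 s + 2) / (2 s) = 2 - 1 / c` and the
factors containing `‖ζ‖` are at least `1`, this implies the claim; if `N` is infinite there is
nothing to prove. All the constants depend on the data only; the bounds for `u` and `Du` which are
part of the notion of solution serve only to discard the error terms produced by spatial cutoffs.

* *Upper bound for `u`* (`exists_upper_bound`). As `H ≥ 0`, `u` is a subsolution of the backward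
  heat equation with source `f`; testing with the heat kernel gives `u ≤ C (1 + N)`, since the
  condition on `a` and `c` puts the heat kernel in the dual mixed space.
* *Energy estimate* (`HamiltonJacobiSystem.integral_energy_le`). Testing the equation of the adjoint
  density `ζ` with `u` and using `D_pH · p - H ≥ k H - K` bounds `∬ H(x,Du) ζ` and `∬ f ζ` by
  `C (1 + N)`. Here `ζ` is nonnegative and its mass does not increase (`DriftDiffusion.nonneg`,
  `DriftDiffusion.mass_le`), by the equations satisfied by convex functions of `ζ`.
* *Fisher information* (`exists_fisher_bound`). As `|D_pH|² ≤ K + K H`, the drift of the equation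
  for `ζ` has kinetic energy at most `C (1 + N)`. The entropy `∫ ζ log ζ`, which is bounded below
  by means of the moments `∫ ζ log (1 + |x|²)`, then bounds `∬ |Dζ|² / ζ` by `C (1 + N)`.
* *Interpolation* (`exists_lintegral_mul_gradient_le`). By the Gagliardo-Nirenberg-Sobolev
  inequality for `√ζ` and Hölder's inequality, `∬ f |Dζ| ≤ C N (1 + ∬ |Dζ|² / ζ) ^ (1 - 1 / c)`.
* *Gradient estimate* (`HamiltonJacobiSystem.abs_integral_le`, `exists_gradient_bound`). Testing
  the equation of `ζ` with `∂ⱼu` and moving the derivative in `∂ⱼf` to `ζ` expresses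
  `∫ ∂ⱼu(τ) φ` by the terminal values, by `∬ D_xH ζ`, which the energy controls, and by
  `∬ f ∂ⱼζ`.
-/

noncomputable section

namespace MFG

variable {d : ℕ}

/-! ### Calculus in space-time -/

/-- The open space-time slab `(s,t) × ℝᵈ`. -/
def slab (s t : ℝ) : Set (ℝ × Space d) := Ioo s t ×ˢ univ

/-- The time derivative of a function on space-time. -/
def dt (F : ℝ × Space d → ℝ) (z : ℝ × Space d) : ℝ := fderiv ℝ F z (1, 0)

/-- The `i`-th spatial partial derivative of a function on space-time. -/
def dx (i : Fin d) (F : ℝ × Space d → ℝ) (z : ℝ × Space d) : ℝ :=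
  fderiv ℝ F z (0, EuclideanSpace.single i 1)

theorem isOpen_slab (s t : ℝ) : IsOpen (slab s t : Set (ℝ × Space d)) :=
  isOpen_Ioo.prod isOpen_univ

theorem mem_slab {s t : ℝ} {z : ℝ × Space d} : z ∈ slab s t ↔ s < z.1 ∧ z.1 < t := by
  simp [slab]

theorem slab_subset {s t s' t' : ℝ} (hs : s' ≤ s) (ht : t ≤ t') :
    (slab s t : Set (ℝ × Space d)) ⊆ slab s' t' :=
  prod_mono (Ioo_subset_Ioo hs ht) le_rfl

theorem measurableSet_slab (s t : ℝ) : MeasurableSet (slab s t : Set (ℝ × Space d)) :=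
  (isOpen_slab s t).measurableSet

section calculus

variable {O : Set (ℝ × Space d)} {F G : ℝ × Space d → ℝ} {z : ℝ × Space d}

theorem contDiffOn_dx (hO : IsOpen O) (hF : ContDiffOn ℝ ∞ F O) (i : Fin d) :
    ContDiffOn ℝ ∞ (dx i F) O :=
  (hF.fderiv_of_isOpen hO (by simp)).clm_apply contDiffOn_const

theorem contDiffOn_dt (hO : IsOpen O) (hF : ContDiffOn ℝ ∞ F O) : ContDiffOn ℝ ∞ (dt F) O :=
  (hF.fderiv_of_isOpen hO (by simp)).clm_apply contDiffOn_const

theorem differentiableAt_of_contDiffOn (hO : IsOpen O) (hF : ContDiffOn ℝ ∞ F O) (hz : z ∈ O) :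
    DifferentiableAt ℝ F z :=
  (hF.contDiffAt (hO.mem_nhds hz)).differentiableAt (by simp)

theorem dx_mul (hF : DifferentiableAt ℝ F z) (hG : DifferentiableAt ℝ G z) (i : Fin d) :
    dx i (fun w => F w * G w) z = dx i F z * G z + F z * dx i G z := by
  simp only [dx, fderiv_fun_mul hF hG]
  simp; ring

theorem dt_mul (hF : DifferentiableAt ℝ F z) (hG : DifferentiableAt ℝ G z) :
    dt (fun w => F w * G w) z = dt F z * G z + F z * dt G z := by
  simp only [dt, fderiv_fun_mul hF hG]
  simp; ring

theorem dx_add (hF : DifferentiableAt ℝ F z) (hG : DifferentiableAt ℝ G z) (i : Fin d) :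
    dx i (fun w => F w + G w) z = dx i F z + dx i G z := by
  simp [dx, fderiv_fun_add hF hG]

theorem dx_sub (hF : DifferentiableAt ℝ F z) (hG : DifferentiableAt ℝ G z) (i : Fin d) :
    dx i (fun w => F w - G w) z = dx i F z - dx i G z := by
  simp [dx, fderiv_fun_sub hF hG]

theorem dx_const_mul (hF : DifferentiableAt ℝ F z) (c : ℝ) (i : Fin d) :
    dx i (fun w => c * F w) z = c * dx i F z := by
  simp [dx, fderiv_const_mul hF c]

theorem dx_comp {β : ℝ → ℝ} (hβ : DifferentiableAt ℝ β (F z)) (hF : DifferentiableAt ℝ F z)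
    (i : Fin d) : dx i (fun w => β (F w)) z = deriv β (F z) * dx i F z := by
  have h : HasFDerivAt (fun w => β (F w)) (deriv β (F z) • fderiv ℝ F z) z :=
    hβ.hasDerivAt.comp_hasFDerivAt z hF.hasFDerivAt
  simp [dx, h.fderiv]

theorem dt_comp {β : ℝ → ℝ} (hβ : DifferentiableAt ℝ β (F z)) (hF : DifferentiableAt ℝ F z) :
    dt (fun w => β (F w)) z = deriv β (F z) * dt F z := by
  have h : HasFDerivAt (fun w => β (F w)) (deriv β (F z) • fderiv ℝ F z) z :=
    hβ.hasDerivAt.comp_hasFDerivAt z hF.hasFDerivAt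
  simp [dt, h.fderiv]

theorem dx_congr (hO : IsOpen O) (h : ∀ w ∈ O, F w = G w) (hz : z ∈ O) (i : Fin d) :
    dx i F z = dx i G z := by
  have : F =ᶠ[𝓝 z] G := by filter_upwards [hO.mem_nhds hz] with w hw using h w hw
  simp only [dx, this.fderiv_eq]

theorem dx_snd {χ : Space d → ℝ} (hχ : ContDiff ℝ ∞ χ) (i : Fin d) (z : ℝ × Space d) :
    dx i (fun w => χ w.2) z = fderiv ℝ χ z.2 (EuclideanSpace.single i 1) := by
  have h : HasFDerivAt (fun w : ℝ × Space d => χ w.2)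
      ((fderiv ℝ χ z.2).comp (ContinuousLinearMap.snd ℝ ℝ (Space d))) z :=
    (hχ.differentiable (by simp) z.2).hasFDerivAt.comp z hasFDerivAt_snd
  simp [dx, h.fderiv]

theorem dt_snd {χ : Space d → ℝ} (hχ : ContDiff ℝ ∞ χ) (z : ℝ × Space d) :
    dt (fun w => χ w.2) z = 0 := by
  have h : HasFDerivAt (fun w : ℝ × Space d => χ w.2)
      ((fderiv ℝ χ z.2).comp (ContinuousLinearMap.snd ℝ ℝ (Space d))) z :=
    (hχ.differentiable (by simp) z.2).hasFDerivAt.comp z hasFDerivAt_snd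
  simp [dt, h.fderiv]

theorem fderiv_fderiv_comm (hO : IsOpen O) (hF : ContDiffOn ℝ ∞ F O) (hz : z ∈ O)
    (v w : ℝ × Space d) :
    fderiv ℝ (fun y => fderiv ℝ F y v) z w = fderiv ℝ (fun y => fderiv ℝ F y w) z v := by
  have hd : DifferentiableAt ℝ (fderiv ℝ F) z :=
    ((hF.fderiv_of_isOpen (m := ∞) hO (by simp)).contDiffAt (hO.mem_nhds hz)).differentiableAt
      (by simp)
  have h : IsSymmSndFDerivAt ℝ F z :=
    (hF.contDiffAt (hO.mem_nhds hz)).isSymmSndFDerivAt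
      (by rw [minSmoothness_of_isRCLikeNormedField]
          exact WithTop.coe_le_coe.2 (le_top : (2 : ℕ∞) ≤ ⊤))
  rw [fderiv_clm_apply hd (by simp), fderiv_clm_apply hd (by simp)]
  simpa using h.eq w v

theorem dx_dx_comm (hO : IsOpen O) (hF : ContDiffOn ℝ ∞ F O) (hz : z ∈ O) (i j : Fin d) :
    dx i (dx j F) z = dx j (dx i F) z :=
  fderiv_fderiv_comm hO hF hz _ _

theorem dx_dt_comm (hO : IsOpen O) (hF : ContDiffOn ℝ ∞ F O) (hz : z ∈ O) (i : Fin d) :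
    dx i (dt F) z = dt (dx i F) z :=
  fderiv_fderiv_comm hO hF hz _ _

theorem hasDerivAt_time {t : ℝ} {x : Space d} (hF : DifferentiableAt ℝ F (t, x)) :
    HasDerivAt (fun r => F (r, x)) (dt F (t, x)) t := by
  have h := hF.hasFDerivAt.comp_hasDerivAt t
    ((hasDerivAt_id t).prodMk (hasDerivAt_const t x))
  simpa [dt, Function.comp_def] using h

theorem hasFDerivAt_slice {t : ℝ} {x : Space d} (hF : DifferentiableAt ℝ F (t, x)) :
    HasFDerivAt (fun y => F (t, y))
      ((fderiv ℝ F (t, x)).comp (ContinuousLinearMap.inr ℝ ℝ (Space d))) x :=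
  hF.hasFDerivAt.comp x (hasFDerivAt_prodMk_right t x)

theorem fderiv_slice {t : ℝ} {x : Space d} (hF : DifferentiableAt ℝ F (t, x)) (i : Fin d) :
    fderiv ℝ (fun y => F (t, y)) x (EuclideanSpace.single i 1) = dx i F (t, x) := by
  rw [(hasFDerivAt_slice hF).fderiv]; simp [dx]

end calculus

section divergence

variable {τ T : ℝ}

theorem fderiv_eq_zero_of_forall_notMem {F : ℝ × Space d → ℝ} {K : Set (Space d)}
    (hK : IsCompact K) (h0 : ∀ z ∈ slab τ T, z.2 ∉ K → F z = 0) {z : ℝ × Space d}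
    (hz : z ∈ slab τ T) (hzK : z.2 ∉ K) : fderiv ℝ F z = 0 := by
  have : F =ᶠ[𝓝 z] fun _ => 0 := by
    have h1 : ∀ᶠ w : ℝ × Space d in 𝓝 z, w.2 ∉ K :=
      continuous_snd.continuousAt.eventually (hK.isClosed.isOpen_compl.mem_nhds hzK)
    filter_upwards [(isOpen_slab τ T).mem_nhds hz, h1] with w hw hwK using h0 w hw hwK
  rw [this.fderiv_eq]; simp

theorem integrableOn_slab_of_notMem_eq_zero {F : ℝ × Space d → ℝ} {K : Set (Space d)}
    (hF : ContinuousOn F (slab τ T)) (hK : IsCompact K)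
    (h0 : ∀ z ∈ slab τ T, z.2 ∉ K → F z = 0) {s t : ℝ} (hs : τ < s) (ht : t < T) :
    IntegrableOn F (slab s t) := by
  have hsub : Icc s t ×ˢ K ⊆ slab τ T :=
    prod_mono (fun r hr => ⟨hs.trans_le hr.1, hr.2.trans_lt ht⟩) (subset_univ _)
  have h1 : IntegrableOn F (Icc s t ×ˢ K) :=
    (hF.mono hsub).integrableOn_compact (isCompact_Icc.prod hK)
  have h2 : IntegrableOn F (Icc s t ×ˢ univ) := by
    refine h1.of_forall_sdiff_eq_zero (measurableSet_Icc.prod MeasurableSet.univ) ?_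
    rintro ⟨r, x⟩ ⟨hx, hx'⟩
    refine h0 _ ?_ ?_
    · simp only [mem_prod, mem_Icc, mem_univ, and_true] at hx
      exact mem_slab.2 ⟨hs.trans_le hx.1, hx.2.trans_lt ht⟩
    · intro hK; exact hx' ⟨hx.1, hK⟩
  exact h2.mono_set (prod_mono Ioo_subset_Icc_self le_rfl)

theorem setIntegral_slab {F : ℝ × Space d → ℝ} {s t : ℝ} (hF : IntegrableOn F (slab s t)) :
    ∫ z in slab s t, F z = ∫ r in Ioo s t, ∫ x, F (r, x) := by
  have := setIntegral_prod (μ := (volume : Measure ℝ)) (ν := (volume : Measure (Space d))) F hF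
  simpa [slab, Measure.volume_eq_prod] using this

theorem setIntegral_slab_symm {F : ℝ × Space d → ℝ} {s t : ℝ} (hF : IntegrableOn F (slab s t)) :
    ∫ z in slab s t, F z = ∫ x, ∫ r in Ioo s t, F (r, x) := by
  have h : (volume.restrict (slab s t) : Measure (ℝ × Space d)) =
      (volume.restrict (Ioo s t)).prod volume := by
    rw [slab, Measure.volume_eq_prod, ← Measure.prod_restrict, Measure.restrict_univ]
  rw [IntegrableOn, h] at hF
  rw [h, integral_prod_symm F hF]

theorem continuous_slice {F : ℝ × Space d → ℝ} (hF : ContinuousOn F (slab τ T)) {t : ℝ}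
    (ht : t ∈ Ioo τ T) : Continuous fun x => F (t, x) := by
  refine hF.comp_continuous (by fun_prop) fun x => mem_slab.2 ht

theorem integrable_slice_of_notMem_eq_zero {F : ℝ × Space d → ℝ} {K : Set (Space d)}
    (hF : ContinuousOn F (slab τ T)) (hK : IsCompact K)
    (h0 : ∀ z ∈ slab τ T, z.2 ∉ K → F z = 0) {t : ℝ} (ht : t ∈ Ioo τ T) :
    Integrable fun x => F (t, x) :=
  (continuous_slice hF ht).integrable_of_hasCompactSupport
    (HasCompactSupport.intro hK fun x hx => h0 (t, x) (mem_slab.2 ht) hx)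

theorem integral_dx_slice_eq_zero {V : ℝ × Space d → ℝ} {K : Set (Space d)} (hK : IsCompact K)
    (hV : ContDiffOn ℝ ∞ V (slab τ T)) (hVK : ∀ z ∈ slab τ T, z.2 ∉ K → V z = 0)
    (i : Fin d) {t : ℝ} (ht : t ∈ Ioo τ T) : ∫ x, dx i V (t, x) = 0 := by
  have hd : ∀ x, DifferentiableAt ℝ V (t, x) := fun x =>
    differentiableAt_of_contDiffOn (isOpen_slab τ T) hV (mem_slab.2 ht)
  have h1 := integrable_slice_of_notMem_eq_zero hV.continuousOn hK hVK ht
  have h2 := integrable_slice_of_notMem_eq_zero (F := dx i V)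
    (contDiffOn_dx (isOpen_slab τ T) hV i).continuousOn hK
    (fun z hz hzK => by simp [dx, fderiv_eq_zero_of_forall_notMem hK hVK hz hzK]) ht
  have := integral_mul_fderiv_eq_neg_fderiv_mul_of_integrable (μ := (volume : Measure (Space d)))
    (f := fun _ => (1 : ℝ)) (g := fun x => V (t, x)) (v := EuclideanSpace.single i 1)
    (by simp) (by simpa [fderiv_slice (hd _)] using h2) (by simpa using h1)
    (fun x _ => by fun_prop) (fun x _ => (hasFDerivAt_slice (hd x)).differentiableAt)
  simpa [fderiv_slice (hd _)] using this

/-- The divergence theorem on a slab: the increment of the integral of `F` over the time slices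
is the integral of `∂ₜF - div V`, for any field `V` of spatially compact support. -/
theorem integral_slice_sub_integral_slice {F : ℝ × Space d → ℝ} {V : Fin d → ℝ × Space d → ℝ}
    {K : Set (Space d)} (hK : IsCompact K) (hF : ContDiffOn ℝ ∞ F (slab τ T))
    (hV : ∀ i, ContDiffOn ℝ ∞ (V i) (slab τ T)) (hFK : ∀ z ∈ slab τ T, z.2 ∉ K → F z = 0)
    (hVK : ∀ i, ∀ z ∈ slab τ T, z.2 ∉ K → V i z = 0) {s t : ℝ} (hs : τ < s) (hst : s ≤ t)
    (ht : t < T) :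
    (∫ x, F (t, x)) - ∫ x, F (s, x) = ∫ z in slab s t, (dt F z - ∑ i, dx i (V i) z) := by
  have hO := isOpen_slab (d := d) τ T
  have hsT : s ∈ Ioo τ T := ⟨hs, hst.trans_lt ht⟩
  have htT : t ∈ Ioo τ T := ⟨hs.trans_le hst, ht⟩
  have hdt : IntegrableOn (dt F) (slab s t) :=
    integrableOn_slab_of_notMem_eq_zero (contDiffOn_dt hO hF).continuousOn hK
      (fun z hz hzK => by simp [dt, fderiv_eq_zero_of_forall_notMem hK hFK hz hzK]) hs ht
  have hdx : ∀ i, IntegrableOn (dx i (V i)) (slab s t) := fun i =>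
    integrableOn_slab_of_notMem_eq_zero (contDiffOn_dx hO (hV i) i).continuousOn hK
      (fun z hz hzK => by simp [dx, fderiv_eq_zero_of_forall_notMem hK (hVK i) hz hzK]) hs ht
  have h0 : ∀ i, ∫ z in slab s t, dx i (V i) z = 0 := fun i => by
    rw [setIntegral_slab (hdx i)]
    refine setIntegral_eq_zero_of_forall_eq_zero fun r hr => ?_
    exact integral_dx_slice_eq_zero hK (hV i) (hVK i) i ⟨hs.trans hr.1, hr.2.trans ht⟩
  rw [integral_sub hdt (integrable_finsetSum _ fun i _ => hdx i),
    integral_finsetSum _ fun i _ => hdx i, Finset.sum_eq_zero fun i _ => h0 i, sub_zero,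
    setIntegral_slab_symm hdt]
  refine (integral_sub (integrable_slice_of_notMem_eq_zero hF.continuousOn hK hFK htT)
    (integrable_slice_of_notMem_eq_zero hF.continuousOn hK hFK hsT)).symm.trans ?_
  refine integral_congr_ae (Eventually.of_forall fun x => ?_)
  have hd : ∀ r ∈ uIcc s t, HasDerivAt (fun r => F (r, x)) (dt F (r, x)) r := fun r hr => by
    rw [uIcc_of_le hst] at hr
    exact hasDerivAt_time (differentiableAt_of_contDiffOn hO hF
      (mem_slab.2 ⟨hs.trans_le hr.1, hr.2.trans_lt ht⟩))
  have hc : ContinuousOn (fun r => dt F (r, x)) (uIcc s t) := by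
    refine (contDiffOn_dt hO hF).continuousOn.comp (by fun_prop) fun r hr => ?_
    rw [uIcc_of_le hst] at hr
    exact mem_slab.2 ⟨hs.trans_le hr.1, hr.2.trans_lt ht⟩
  have := intervalIntegral.integral_eq_sub_of_hasDerivAt hd hc.intervalIntegrable
  rw [intervalIntegral.integral_of_le hst, integral_Ioc_eq_integral_Ioo] at this
  exact this.symm

end divergence

end MFG

end

noncomputable section

namespace MFG

variable {d : ℕ}

/-! ### Drift-diffusion equations -/

/-- The `i`-th partial derivative of a function on space. -/
def pd (i : Fin d) (χ : Space d → ℝ) (x : Space d) : ℝ :=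
  fderiv ℝ χ x (EuclideanSpace.single i 1)

/-- `ζ` is a smooth, integrable solution of `ζ_t = div (b ζ) + Δ ζ` on the open slab
`(τ,T) × ℝᵈ`, for a smooth and bounded vector field `b`. -/
structure DriftDiffusion (b : Fin d → ℝ × Space d → ℝ) (ζ : ℝ × Space d → ℝ) (τ T : ℝ) :
    Prop where
  smooth_drift : ∀ i, ContDiffOn ℝ ∞ (b i) (slab τ T)
  smooth : ContDiffOn ℝ ∞ ζ (slab τ T)
  equation : ∀ z ∈ slab τ T, dt ζ z = ∑ i, dx i (fun w => b i w * ζ w + dx i ζ w) z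
  integrable : IntegrableOn ζ (slab τ T)
  bounded : ∃ B : ℝ, ∀ z ∈ slab τ T, ∀ i, |b i z| ≤ B

/-- `ζ` attains the value `φ` at the initial time `τ`, in `L¹`. -/
def HasInitialValue (ζ : ℝ × Space d → ℝ) (τ : ℝ) (φ : Space d → ℝ) : Prop :=
  Tendsto (fun t => eLpNorm (fun x => ζ (t, x) - φ x) 1 volume) (𝓝[>] τ) (𝓝 0)

/-- A nonnegative test function in space whose first derivatives and unmixed second derivatives
are bounded by `κ`. -/
structure TestFunction (χ : Space d → ℝ) (κ : ℝ) : Prop where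
  smooth : ContDiff ℝ ∞ χ
  compact : HasCompactSupport χ
  nonneg : ∀ x, 0 ≤ χ x
  first : ∀ i x, |pd i χ x| ≤ κ
  second : ∀ i x, |pd i (pd i χ) x| ≤ κ

theorem contDiff_pd {χ : Space d → ℝ} (hχ : ContDiff ℝ ∞ χ) (i : Fin d) :
    ContDiff ℝ ∞ (pd i χ) :=
  (hχ.fderiv_right (m := ∞) (by simp)).clm_apply contDiff_const

theorem dx_snd_eq_pd {χ : Space d → ℝ} (hχ : ContDiff ℝ ∞ χ) (i : Fin d) :
    dx i (fun w => χ w.2) = fun w : ℝ × Space d => pd i χ w.2 :=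
  funext fun z => dx_snd hχ i z

theorem pd_eq_zero_of_notMem {χ : Space d → ℝ} (i : Fin d) {x : Space d} (hx : x ∉ tsupport χ) :
    pd i χ x = 0 := by
  have : fderiv ℝ χ x = 0 := by
    by_contra h
    exact hx (support_fderiv_subset ℝ h)
  simp [pd, this]

theorem tsupport_pd_subset {χ : Space d → ℝ} (i : Fin d) : tsupport (pd i χ) ⊆ tsupport χ :=
  closure_minimal (fun x hx => by
    by_contra h
    exact hx (pd_eq_zero_of_notMem i h)) (isClosed_tsupport χ)

theorem TestFunction.bound_nonneg {χ : Space d → ℝ} {κ : ℝ} (hχ : TestFunction χ κ)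
    (i : Fin d) : 0 ≤ κ :=
  (abs_nonneg _).trans (hχ.first i 0)

theorem contDiffOn_snd {χ : Space d → ℝ} (hχ : ContDiff ℝ ∞ χ) (O : Set (ℝ × Space d)) :
    ContDiffOn ℝ ∞ (fun w : ℝ × Space d => χ w.2) O :=
  (hχ.comp contDiff_snd).contDiffOn

section renormalisation

variable {τ T : ℝ} {b : Fin d → ℝ × Space d → ℝ} {ζ : ℝ × Space d → ℝ} {φ : Space d → ℝ}

theorem DriftDiffusion.smooth_flux (h : DriftDiffusion b ζ τ T) (i : Fin d) :
    ContDiffOn ℝ ∞ (fun w => b i w * ζ w + dx i ζ w) (slab τ T) :=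
  ((h.smooth_drift i).mul h.smooth).add (contDiffOn_dx (isOpen_slab τ T) h.smooth i)

theorem contDiffOn_comp_of_contDiffAt {β : ℝ → ℝ} {O : Set (ℝ × Space d)}
    (hζ : ContDiffOn ℝ ∞ ζ O) (hβ : ∀ z ∈ O, ContDiffAt ℝ ∞ β (ζ z)) :
    ContDiffOn ℝ ∞ (fun w => β (ζ w)) O := fun z hz =>
  (hβ z hz).comp_contDiffWithinAt z (hζ z hz)

theorem contDiffAt_deriv {β : ℝ → ℝ} {y : ℝ} (hβ : ContDiffAt ℝ ∞ β y) :
    ContDiffAt ℝ ∞ (deriv β) y := by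
  have := (hβ.fderiv_right (m := ∞) (by simp)).clm_apply (contDiffAt_const (c := (1 : ℝ)))
  exact this

/-- The equation satisfied by `β(ζ)`, tested against a function `χ` of the space variable. -/
theorem DriftDiffusion.renormalized_identity (h : DriftDiffusion b ζ τ T) {β : ℝ → ℝ}
    (hβ : ∀ z ∈ slab τ T, ContDiffAt ℝ ∞ β (ζ z)) {χ : Space d → ℝ} (hχ : ContDiff ℝ ∞ χ)
    (hχc : HasCompactSupport χ) {s t : ℝ} (hs : τ < s) (hst : s ≤ t) (ht : t < T) :
    (∫ x, β (ζ (t, x)) * χ x) - ∫ x, β (ζ (s, x)) * χ x =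
      ∫ z in slab s t, ∑ i, (-(b i z * ζ z + dx i ζ z) * dx i ζ z * deriv (deriv β) (ζ z) * χ z.2
        - deriv β (ζ z) * ζ z * b i z * pd i χ z.2 + β (ζ z) * pd i (pd i χ) z.2) := by
  have hO := isOpen_slab (d := d) τ T
  have hB := contDiffOn_comp_of_contDiffAt h.smooth hβ
  have hB' := contDiffOn_comp_of_contDiffAt h.smooth fun z hz => contDiffAt_deriv (hβ z hz)
  have hX := contDiffOn_snd hχ (slab τ T)
  have hX' : ∀ i, ContDiffOn ℝ ∞ (fun w : ℝ × Space d => pd i χ w.2) (slab τ T) :=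
    fun i => contDiffOn_snd (contDiff_pd hχ i) _
  have key := integral_slice_sub_integral_slice (F := fun w => β (ζ w) * χ w.2)
    (V := fun i w => (deriv β (ζ w) * (b i w * ζ w + dx i ζ w)) * χ w.2
      - β (ζ w) * pd i χ w.2) (K := tsupport χ) hχc (hB.mul hX)
    (fun i => ((hB'.mul (h.smooth_flux i)).mul hX).sub (hB.mul (hX' i)))
    (fun z _ hz => by simp [image_eq_zero_of_notMem_tsupport hz])
    (fun i z _ hz => by
      simp [image_eq_zero_of_notMem_tsupport hz, pd_eq_zero_of_notMem i hz]) hs hst ht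
  rw [key]
  refine setIntegral_congr_fun (measurableSet_slab s t) fun z hz => ?_
  have hz' : z ∈ slab τ T := slab_subset hs.le ht.le hz
  have dB := differentiableAt_of_contDiffOn hO hB hz'
  have dB' := differentiableAt_of_contDiffOn hO hB' hz'
  have dX := differentiableAt_of_contDiffOn hO hX hz'
  have dX' := fun i => differentiableAt_of_contDiffOn hO (hX' i) hz'
  have dV := fun i => differentiableAt_of_contDiffOn hO (h.smooth_flux i) hz'
  have dζ := differentiableAt_of_contDiffOn hO h.smooth hz'
  have eβ := (hβ z hz').differentiableAt (by simp)
  have eβ' := (contDiffAt_deriv (hβ z hz')).differentiableAt (by simp)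
  rw [dt_mul dB dX, dt_comp eβ dζ, dt_snd hχ, h.equation z hz', Finset.mul_sum, Finset.sum_mul,
    mul_zero, add_zero, ← Finset.sum_sub_distrib]
  refine Finset.sum_congr rfl fun i _ => ?_
  rw [dx_sub ((dB'.fun_mul (dV i)).fun_mul dX) (dB.fun_mul (dX' i)), dx_mul (dB'.fun_mul (dV i)) dX,
    dx_mul dB' (dV i), dx_mul dB (dX' i), dx_comp eβ' dζ, dx_comp eβ dζ, dx_snd_eq_pd hχ,
    dx_snd_eq_pd (contDiff_pd hχ i)]
  ring

/-- The equation for `ζ` tested against a smooth function `w` and a cutoff `χ`. The parameter `σ`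
adds a multiple of the vanishing integral of `div (w ζ Dχ)`; `σ = 1` removes the derivatives of
`ζ`, and `σ = -1` those of `w`, from the terms with `Dχ`. -/
theorem DriftDiffusion.duality_identity (h : DriftDiffusion b ζ τ T) {w : ℝ × Space d → ℝ}
    (hw : ContDiffOn ℝ ∞ w (slab τ T)) (σ : ℝ) {χ : Space d → ℝ} (hχ : ContDiff ℝ ∞ χ)
    (hχc : HasCompactSupport χ) {s t : ℝ} (hs : τ < s) (hst : s ≤ t) (ht : t < T) :
    (∫ x, w (t, x) * ζ (t, x) * χ x) - ∫ x, w (s, x) * ζ (s, x) * χ x =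
      ∫ z in slab s t, (ζ z * χ z.2 * (dt w z + ∑ i, (dx i (dx i w) z - b i z * dx i w z))
        + ∑ i, (-w z * ζ z * b i z * pd i χ z.2 + (σ - 1) * w z * dx i ζ z * pd i χ z.2
          + (σ + 1) * ζ z * dx i w z * pd i χ z.2 + σ * w z * ζ z * pd i (pd i χ) z.2)) := by
  have hO := isOpen_slab (d := d) τ T
  have hX := contDiffOn_snd hχ (slab τ T)
  have hX' : ∀ i, ContDiffOn ℝ ∞ (fun w : ℝ × Space d => pd i χ w.2) (slab τ T) :=
    fun i => contDiffOn_snd (contDiff_pd hχ i) _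
  have hwζ := hw.mul h.smooth
  have hwX := hw.mul hX
  have hζX := h.smooth.mul hX
  have hw' := fun i => contDiffOn_dx hO hw i
  have key := integral_slice_sub_integral_slice (F := fun y => w y * ζ y * χ y.2)
    (V := fun i y => (w y * χ y.2) * (b i y * ζ y + dx i ζ y) - (ζ y * χ y.2) * dx i w y
      - σ * ((w y * ζ y) * pd i χ y.2)) (K := tsupport χ) hχc (hwζ.mul hX)
    (fun i => ((hwX.mul (h.smooth_flux i)).sub (hζX.mul (hw' i))).sub
      (contDiffOn_const.mul (hwζ.mul (hX' i))))
    (fun z _ hz => by simp [image_eq_zero_of_notMem_tsupport hz])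
    (fun i z _ hz => by
      simp [image_eq_zero_of_notMem_tsupport hz, pd_eq_zero_of_notMem i hz]) hs hst ht
  rw [key]
  refine setIntegral_congr_fun (measurableSet_slab s t) fun z hz => ?_
  have hz' : z ∈ slab τ T := slab_subset hs.le ht.le hz
  have dX := differentiableAt_of_contDiffOn hO hX hz'
  have dX' := fun i => differentiableAt_of_contDiffOn hO (hX' i) hz'
  have dV := fun i => differentiableAt_of_contDiffOn hO (h.smooth_flux i) hz'
  have dζ := differentiableAt_of_contDiffOn hO h.smooth hz'
  have dw := differentiableAt_of_contDiffOn hO hw hz'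
  have dw' := fun i => differentiableAt_of_contDiffOn hO (hw' i) hz'
  rw [dt_mul (dw.fun_mul dζ) dX, dt_mul dw dζ, dt_snd hχ, h.equation z hz']
  have e : ∀ i, dx i (fun y => (w y * χ y.2) * (b i y * ζ y + dx i ζ y) - (ζ y * χ y.2) * dx i w y
      - σ * ((w y * ζ y) * pd i χ y.2)) z
      = w z * χ z.2 * dx i (fun y => b i y * ζ y + dx i ζ y) z
        - (ζ z * χ z.2 * (dx i (dx i w) z - b i z * dx i w z)
        + (-w z * ζ z * b i z * pd i χ z.2 + (σ - 1) * w z * dx i ζ z * pd i χ z.2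
          + (σ + 1) * ζ z * dx i w z * pd i χ z.2 + σ * w z * ζ z * pd i (pd i χ) z.2)) := by
    intro i
    rw [dx_sub (((dw.fun_mul dX).fun_mul (dV i)).fun_sub ((dζ.fun_mul dX).fun_mul (dw' i)))
        (((dw.fun_mul dζ).fun_mul (dX' i)).const_mul σ),
      dx_sub ((dw.fun_mul dX).fun_mul (dV i)) ((dζ.fun_mul dX).fun_mul (dw' i)),
      dx_mul (dw.fun_mul dX) (dV i), dx_mul (dζ.fun_mul dX) (dw' i),
      dx_const_mul ((dw.fun_mul dζ).fun_mul (dX' i)), dx_mul (dw.fun_mul dζ) (dX' i),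
      dx_mul dw dX, dx_mul dζ dX, dx_mul dw dζ, dx_snd_eq_pd hχ, dx_snd_eq_pd (contDiff_pd hχ i)]
    ring
  rw [Finset.sum_congr rfl fun i _ => e i, Finset.sum_sub_distrib, Finset.sum_add_distrib,
    ← Finset.mul_sum, ← Finset.mul_sum]
  ring

/-- Integrals of quantities which depend on `ζ(t)` in a Lipschitz way converge as `t ↓ τ`. -/
theorem HasInitialValue.tendsto_integral (h0 : HasInitialValue ζ τ φ) {G : ℝ → Space d → ℝ}
    {G₀ : Space d → ℝ} {M : ℝ} (hM : 0 ≤ M)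
    (hG : ∀ᶠ t in 𝓝[>] τ, Integrable (G t)) (hG₀ : Integrable G₀)
    (hle : ∀ᶠ t in 𝓝[>] τ, ∀ x, |G t x - G₀ x| ≤ M * |ζ (t, x) - φ x|) :
    Tendsto (fun t => ∫ x, G t x) (𝓝[>] τ) (𝓝 (∫ x, G₀ x)) := by
  rw [tendsto_iff_edist_tendsto_0]
  have hlim : Tendsto (fun t => ENNReal.ofReal M * eLpNorm (fun x => ζ (t, x) - φ x) 1 volume)
      (𝓝[>] τ) (𝓝 0) := by
    simpa using ENNReal.Tendsto.const_mul h0 (Or.inr ENNReal.ofReal_ne_top)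
  refine tendsto_of_tendsto_of_tendsto_of_le_of_le' tendsto_const_nhds hlim
    (Eventually.of_forall fun _ => zero_le) ?_
  filter_upwards [hG, hle] with t h1 h2
  rw [edist_eq_enorm_sub, ← integral_sub h1 hG₀, eLpNorm_one_eq_lintegral_enorm,
    ← lintegral_const_mul' _ _ ENNReal.ofReal_ne_top]
  refine (enorm_integral_le_lintegral_enorm _).trans (lintegral_mono fun x => ?_)
  rw [← ofReal_norm, ← ofReal_norm, ← ENNReal.ofReal_mul hM]
  exact ENNReal.ofReal_le_ofReal (h2 x)

theorem DriftDiffusion.integrableOn_weight (h : DriftDiffusion b ζ τ T) (i : Fin d) :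
    IntegrableOn (fun z => |ζ z| * (1 + |b i z|)) (slab τ T) := by
  obtain ⟨B, hB⟩ := h.bounded
  have hm := measurableSet_slab (d := d) τ T
  refine (h.integrable.norm.mul_const (1 + B)).mono'
    ((h.smooth.continuousOn.abs.mul
      (continuousOn_const.add (h.smooth_drift i).continuousOn.abs)).aestronglyMeasurable hm) ?_
  filter_upwards [ae_restrict_mem hm] with z hz
  rw [Real.norm_of_nonneg (by positivity)]
  exact mul_le_mul_of_nonneg_left (by linarith [hB z hz i]) (abs_nonneg _)

/-- The entropy inequality for a convex function `β` of linear growth with `β'' (y) y² = O(|y|)`: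
the dissipation `∬ β''(ζ)|Dζ|² χ` is controlled by the initial value, the drift, and an error
due to the derivatives of the cutoff. -/
theorem DriftDiffusion.renormalized_inequality (h : DriftDiffusion b ζ τ T) (hφ : Integrable φ)
    (h0 : HasInitialValue ζ τ φ) {S : Set ℝ} (hS : Convex ℝ S) (h0S : 0 ∈ S)
    (hζS : ∀ z ∈ slab τ T, ζ z ∈ S) (hφS : ∀ x, φ x ∈ S) {β : ℝ → ℝ} {L C : ℝ}
    (hβm : Measurable β) (hβ : ∀ y ∈ S, ContDiffAt ℝ ∞ β y) (hβ0' : β 0 = 0)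
    (hβ' : ∀ y ∈ S, |deriv β y| ≤ L)
    (hconv : ∀ y ∈ S, 0 ≤ deriv (deriv β) y)
    (hβ'' : ∀ y ∈ S, deriv (deriv β) y * y ^ 2 ≤ C * |y|)
    {χ : Space d → ℝ} {κ : ℝ} (hχ : TestFunction χ κ) {s₀ t : ℝ} (hs₀ : τ < s₀) (hst : s₀ ≤ t)
    (ht : t < T) :
    (∫ x, β (ζ (t, x)) * χ x)
      + 1 / 2 * ∫ z in slab s₀ t, ∑ i, deriv (deriv β) (ζ z) * dx i ζ z ^ 2 * χ z.2 ≤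
      (∫ x, β (φ x) * χ x)
      + 1 / 2 * (∫ z in slab τ T, ∑ i, deriv (deriv β) (ζ z) * ζ z ^ 2 * b i z ^ 2 * χ z.2)
      + L * κ * ∫ z in slab τ T, ∑ i, |ζ z| * (1 + |b i z|) := by
  have hO := isOpen_slab (d := d) τ T
  have hm := measurableSet_slab (d := d) τ T
  obtain ⟨B, hB⟩ := h.bounded
  obtain ⟨M, hM⟩ := hχ.compact.exists_bound_of_continuous hχ.smooth.continuous
  have hM0 : 0 ≤ M := (norm_nonneg _).trans (hM 0)
  have hL0 : 0 ≤ L := (abs_nonneg _).trans (hβ' _ (hφS 0))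
  have hL : ∀ y ∈ S, ∀ y' ∈ S, |β y - β y'| ≤ L * |y - y'| := fun y hy y' hy' =>
    hS.norm_image_sub_le_of_norm_deriv_le
      (fun r hr => (hβ r hr).differentiableAt (by simp)) hβ' hy' hy
  have hβ0 : ∀ y ∈ S, |β y| ≤ L * |y| := fun y hy => by simpa [hβ0'] using hL y hy 0 h0S
  have hχM : ∀ x, χ x ≤ M := fun x => (le_abs_self _).trans (hM x)
  have cζ := h.smooth.continuousOn
  have cb := fun i => (h.smooth_drift i).continuousOn
  have cχ : ContinuousOn (fun z : ℝ × Space d => χ z.2) (slab τ T) :=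
    (hχ.smooth.continuous.comp continuous_snd).continuousOn
  have hB2 : ContinuousOn (fun z => deriv (deriv β) (ζ z)) (slab τ T) :=
    (contDiffOn_comp_of_contDiffAt h.smooth fun z hz =>
      contDiffAt_deriv (contDiffAt_deriv (hβ _ (hζS z hz)))).continuousOn
  have hB0 : ContinuousOn (fun z => β (ζ z)) (slab τ T) :=
    (contDiffOn_comp_of_contDiffAt h.smooth fun z hz => hβ _ (hζS z hz)).continuousOn
  -- integrability of the drift term
  have iE : ∀ i, IntegrableOn
      (fun z => deriv (deriv β) (ζ z) * ζ z ^ 2 * b i z ^ 2 * χ z.2) (slab τ T) := by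
    intro i
    refine (h.integrable.norm.const_mul (|C| * B ^ 2 * M)).mono'
      ((((hB2.mul (cζ.pow 2)).mul ((cb i).pow 2)).mul cχ).aestronglyMeasurable hm) ?_
    filter_upwards [ae_restrict_mem hm] with z hz
    have h1 := hconv _ (hζS z hz)
    have h2 : deriv (deriv β) (ζ z) * ζ z ^ 2 ≤ |C| * |ζ z| :=
      (hβ'' _ (hζS z hz)).trans (by gcongr; exact le_abs_self C)
    have h3 : b i z ^ 2 ≤ B ^ 2 := by
      rw [← sq_abs]; exact pow_le_pow_left₀ (abs_nonneg _) (hB z hz i) 2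
    have h4 := hχ.nonneg z.2
    rw [Real.norm_of_nonneg (by positivity), Real.norm_eq_abs]
    calc deriv (deriv β) (ζ z) * ζ z ^ 2 * b i z ^ 2 * χ z.2
        ≤ (|C| * |ζ z|) * B ^ 2 * M := by
          gcongr
          exact hχM _
      _ = |C| * B ^ 2 * M * |ζ z| := by ring
  have iW := fun i => h.integrableOn_weight i
  have iW' : IntegrableOn (fun z => ∑ i, |ζ z| * (1 + |b i z|)) (slab τ T) :=
    integrable_finsetSum _ fun i _ => iW i
  have iE' : IntegrableOn
      (fun z => ∑ i, deriv (deriv β) (ζ z) * ζ z ^ 2 * b i z ^ 2 * χ z.2) (slab τ T) :=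
    integrable_finsetSum _ fun i _ => iE i
  -- the inequality with an arbitrary positive starting time
  have step : ∀ s ∈ Ioc τ s₀, (∫ x, β (ζ (t, x)) * χ x)
      + 1 / 2 * ∫ z in slab s₀ t, ∑ i, deriv (deriv β) (ζ z) * dx i ζ z ^ 2 * χ z.2 ≤
      (∫ x, β (ζ (s, x)) * χ x)
      + (1 / 2 * (∫ z in slab τ T, ∑ i, deriv (deriv β) (ζ z) * ζ z ^ 2 * b i z ^ 2 * χ z.2)
      + L * κ * ∫ z in slab τ T, ∑ i, |ζ z| * (1 + |b i z|)) := by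
    intro s hs
    have hsub : (slab s t : Set (ℝ × Space d)) ⊆ slab τ T := slab_subset hs.1.le ht.le
    have id := h.renormalized_identity (β := β) (fun z hz => hβ _ (hζS z hz)) hχ.smooth
      hχ.compact hs.1 (hs.2.trans hst) ht
    have cD : ContinuousOn (fun z => ∑ i, deriv (deriv β) (ζ z) * dx i ζ z ^ 2 * χ z.2)
        (slab τ T) := continuousOn_finsetSum _ fun i _ =>
      (hB2.mul ((contDiffOn_dx hO h.smooth i).continuousOn.pow 2)).mul cχ
    have iD : IntegrableOn (fun z => ∑ i, deriv (deriv β) (ζ z) * dx i ζ z ^ 2 * χ z.2)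
        (slab s t) :=
      integrableOn_slab_of_notMem_eq_zero cD hχ.compact
        (fun z _ hz => by simp [image_eq_zero_of_notMem_tsupport hz]) hs.1 ht
    have pD : ∀ z ∈ slab τ T, 0 ≤ ∑ i, deriv (deriv β) (ζ z) * dx i ζ z ^ 2 * χ z.2 :=
      fun z hz => Finset.sum_nonneg fun i _ =>
        mul_nonneg (mul_nonneg (hconv _ (hζS z hz)) (sq_nonneg _)) (hχ.nonneg _)
    have pE : ∀ z ∈ slab τ T, 0 ≤ ∑ i, deriv (deriv β) (ζ z) * ζ z ^ 2 * b i z ^ 2 * χ z.2 :=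
      fun z hz => Finset.sum_nonneg fun i _ => mul_nonneg (mul_nonneg (mul_nonneg
        (hconv _ (hζS z hz)) (sq_nonneg _)) (sq_nonneg _)) (hχ.nonneg _)
    have pW : ∀ z : ℝ × Space d, 0 ≤ L * κ * ∑ i, |ζ z| * (1 + |b i z|) := fun z => by
      rw [Finset.mul_sum]
      exact Finset.sum_nonneg fun i _ =>
        mul_nonneg (mul_nonneg hL0 (hχ.bound_nonneg i)) (by positivity)
    have i1 := (iE'.mono_set hsub).const_mul (1 / 2)
    have i2 := (iW'.mono_set hsub).const_mul (L * κ)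
    have le1 : (∫ x, β (ζ (t, x)) * χ x) - ∫ x, β (ζ (s, x)) * χ x ≤
        ∫ z in slab s t, ((1 / 2 * ∑ i, deriv (deriv β) (ζ z) * ζ z ^ 2 * b i z ^ 2 * χ z.2)
          + L * κ * ∑ i, |ζ z| * (1 + |b i z|)
          - 1 / 2 * ∑ i, deriv (deriv β) (ζ z) * dx i ζ z ^ 2 * χ z.2) := by
      rw [id]
      refine setIntegral_mono_on ?_ ((i1.add i2).sub (iD.const_mul _)) (measurableSet_slab s t) ?_
      · refine integrableOn_slab_of_notMem_eq_zero (τ := τ) (T := T) (K := tsupport χ) ?_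
          hχ.compact ?_ hs.1 ht
        · refine continuousOn_finsetSum _ fun i _ => ContinuousOn.add (ContinuousOn.sub ?_ ?_) ?_
          · exact ((((((cb i).mul cζ).add (contDiffOn_dx hO h.smooth i).continuousOn).neg.mul
              (contDiffOn_dx hO h.smooth i).continuousOn).mul hB2).mul cχ)
          · exact (((contDiffOn_comp_of_contDiffAt h.smooth fun z hz =>
              contDiffAt_deriv (hβ _ (hζS z hz))).continuousOn.mul cζ).mul (cb i)).mul
                ((contDiff_pd hχ.smooth i).continuous.comp continuous_snd).continuousOn
          · exact hB0.mul ((contDiff_pd (contDiff_pd hχ.smooth i) i).continuous.comp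
              continuous_snd).continuousOn
        · intro z _ hz
          have hz2 : ∀ i, z.2 ∉ tsupport (pd i χ) := fun i h => hz (tsupport_pd_subset i h)
          simp [image_eq_zero_of_notMem_tsupport hz, pd_eq_zero_of_notMem _ hz,
            pd_eq_zero_of_notMem _ (hz2 _)]
      · intro z hz
        rw [Finset.mul_sum, Finset.mul_sum, Finset.mul_sum, ← Finset.sum_add_distrib,
          ← Finset.sum_sub_distrib]
        refine Finset.sum_le_sum fun i _ => ?_
        have hzS := hζS z (hsub hz)
        have h1 : 0 ≤ deriv (deriv β) (ζ z) * χ z.2 * (b i z * ζ z + dx i ζ z) ^ 2 :=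
          mul_nonneg (mul_nonneg (hconv _ hzS) (hχ.nonneg _)) (sq_nonneg _)
        have h2 : -(deriv β (ζ z) * ζ z * b i z * pd i χ z.2) ≤ L * κ * (|ζ z| * |b i z|) := by
          refine (neg_le_abs _).trans ?_
          rw [abs_mul, abs_mul, abs_mul]
          calc _ ≤ L * |ζ z| * |b i z| * κ := by
                gcongr
                · exact hβ' _ hzS
                · exact hχ.first i _
            _ = _ := by ring
        have h3 : β (ζ z) * pd i (pd i χ) z.2 ≤ L * κ * |ζ z| := by
          refine (le_abs_self _).trans ?_
          rw [abs_mul]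
          calc _ ≤ (L * |ζ z|) * κ := by
                gcongr
                · exact hβ0 _ hzS
                · exact hχ.second i _
            _ = _ := by ring
        linarith
    rw [integral_sub (i1.fun_add i2) (iD.const_mul _), integral_add i1 i2, integral_const_mul,
      integral_const_mul, integral_const_mul] at le1
    have le2 := setIntegral_mono_set iD ((ae_restrict_mem (measurableSet_slab s t)).mono
      fun z hz => pD z (hsub hz)) (slab_subset (d := d) hs.2 le_rfl).eventuallyLE
    have le3 := setIntegral_mono_set iE' ((ae_restrict_mem hm).mono
      fun z hz => pE z hz) hsub.eventuallyLE
    have le4 := setIntegral_mono_set (iW'.const_mul (L * κ)) (ae_of_all _ pW) hsub.eventuallyLE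
    rw [integral_const_mul, integral_const_mul] at le4
    linarith
  have hlim : Tendsto (fun s => ∫ x, β (ζ (s, x)) * χ x) (𝓝[>] τ) (𝓝 (∫ x, β (φ x) * χ x)) := by
    refine h0.tendsto_integral (M := L * M) (by positivity) ?_ ?_ ?_
    · filter_upwards [Ioo_mem_nhdsGT (hs₀.trans_le (hst.trans ht.le))] with s hs
      exact integrable_slice_of_notMem_eq_zero (F := fun z => β (ζ z) * χ z.2) (hB0.mul cχ)
        hχ.compact (fun z _ hz => by simp [image_eq_zero_of_notMem_tsupport hz]) hs
    · refine (hφ.norm.const_mul (L * M)).mono' ((hβm.comp_aemeasurable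
        hφ.aestronglyMeasurable.aemeasurable).aestronglyMeasurable.mul
          hχ.smooth.continuous.aestronglyMeasurable) (ae_of_all _ fun x => ?_)
      rw [Real.norm_eq_abs, abs_mul, Real.norm_eq_abs]
      calc _ ≤ (L * |φ x|) * M := by
            gcongr
            · exact hβ0 _ (hφS x)
            · exact hM x
        _ = _ := by ring
    · filter_upwards [Ioo_mem_nhdsGT (hs₀.trans_le (hst.trans ht.le))] with s hs x
      rw [← sub_mul, abs_mul]
      calc _ ≤ (L * |ζ (s, x) - φ x|) * M := by
            gcongr
            · exact hL _ (hζS (s, x) (mem_slab.2 hs)) _ (hφS x)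
            · exact hM x
        _ = _ := by ring
  have := ge_of_tendsto (hlim.add_const _) ((eventually_iff_exists_mem.2
    ⟨Ioc τ s₀, Ioc_mem_nhdsGT hs₀, step⟩))
  linarith

end renormalisation

end MFG

end

noncomputable section

namespace MFG

variable {d : ℕ}

/-! ### Cutoffs and weights -/

theorem pd_comp_smul {η : Space d → ℝ} (hη : ContDiff ℝ ∞ η) (c : ℝ) (i : Fin d) :
    pd i (fun x => η (c • x)) = fun x => c * pd i η (c • x) := by
  funext x
  have h : HasFDerivAt (fun x : Space d => c • x) (c • ContinuousLinearMap.id ℝ (Space d)) x :=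
    (hasFDerivAt_id x).const_smul c
  have h' := ((hη.differentiable (by simp) (c • x)).hasFDerivAt).comp x h
  have e : fderiv ℝ (fun x => η (c • x)) x = _ := h'.fderiv
  simp [pd, e]

theorem pd_mul {f g : Space d → ℝ} (hf : ContDiff ℝ ∞ f) (hg : ContDiff ℝ ∞ g) (i : Fin d)
    (x : Space d) : pd i (fun y => f y * g y) x = pd i f x * g x + f x * pd i g x := by
  simp only [pd, fderiv_fun_mul (hf.differentiable (by simp) x) (hg.differentiable (by simp) x)]
  simp; ring

theorem pd_add {f g : Space d → ℝ} (hf : ContDiff ℝ ∞ f) (hg : ContDiff ℝ ∞ g) (i : Fin d)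
    (x : Space d) : pd i (fun y => f y + g y) x = pd i f x + pd i g x := by
  simp [pd, fderiv_fun_add (hf.differentiable (by simp) x) (hg.differentiable (by simp) x)]

theorem pd_const_mul {g : Space d → ℝ} (hg : ContDiff ℝ ∞ g) (c : ℝ) (i : Fin d) (x : Space d) :
    pd i (fun y => c * g y) x = c * pd i g x := by
  simp [pd, fderiv_const_mul (hg.differentiable (by simp) x) c]

theorem exists_bound_pd {η : Space d → ℝ} (hη : ContDiff ℝ ∞ η) (hc : HasCompactSupport η) :
    ∃ C : ℝ, 0 ≤ C ∧ (∀ i x, |pd i η x| ≤ C) ∧ ∀ i x, |pd i (pd i η) x| ≤ C := by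
  have h1 : ∀ i : Fin d, ∃ C, ∀ x, ‖pd i η x‖ ≤ C := fun i =>
    HasCompactSupport.exists_bound_of_continuous
      (hc.mono' ((subset_tsupport _).trans (tsupport_pd_subset i))) (contDiff_pd hη i).continuous
  have h2 : ∀ i : Fin d, ∃ C, ∀ x, ‖pd i (pd i η) x‖ ≤ C := fun i =>
    HasCompactSupport.exists_bound_of_continuous
      (hc.mono' ((subset_tsupport _).trans
        ((tsupport_pd_subset i).trans (tsupport_pd_subset i))))
      (contDiff_pd (contDiff_pd hη i) i).continuous
  choose A hA using h1
  choose B hB using h2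
  refine ⟨∑ i, (|A i| + |B i|), Finset.sum_nonneg fun i _ => by positivity, fun i x => ?_,
    fun i x => ?_⟩
  · refine (hA i x).trans (le_trans ?_ (Finset.single_le_sum (f := fun i => |A i| + |B i|)
      (fun i _ => by positivity) (Finset.mem_univ i)))
    linarith [le_abs_self (A i), abs_nonneg (B i)]
  · refine (hB i x).trans (le_trans ?_ (Finset.single_le_sum (f := fun i => |A i| + |B i|)
      (fun i _ => by positivity) (Finset.mem_univ i)))
    linarith [le_abs_self (B i), abs_nonneg (A i)]

/-- The standard bump function which is `1` on the unit ball. -/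
def bump : ContDiffBump (0 : Space d) := ⟨1, 2, one_pos, one_lt_two⟩

/-- A cutoff which is `1` on the ball of radius `n + 1`. -/
def cutoff (n : ℕ) (x : Space d) : ℝ := bump ((1 / ((n : ℝ) + 1)) • x)

theorem contDiff_cutoff (n : ℕ) : ContDiff ℝ ∞ (cutoff n : Space d → ℝ) :=
  bump.contDiff.comp (contDiff_const_smul _)

theorem cutoff_nonneg (n : ℕ) (x : Space d) : 0 ≤ cutoff n x := bump.nonneg

theorem cutoff_le_one (n : ℕ) (x : Space d) : cutoff n x ≤ 1 := bump.le_one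

theorem cutoff_eq_one {n : ℕ} {x : Space d} (hx : ‖x‖ ≤ n + 1) : cutoff n x = 1 := by
  refine bump.one_of_mem_closedBall ?_
  have hn : (0 : ℝ) < n + 1 := by positivity
  rw [mem_closedBall_zero_iff, norm_smul, Real.norm_of_nonneg (by positivity), one_div,
    inv_mul_le_iff₀ hn]
  simpa [bump] using hx

theorem norm_le_of_mem_tsupport_cutoff {n : ℕ} {x : Space d} (hx : x ∈ tsupport (cutoff n)) :
    ‖x‖ ≤ 2 * (n + 1) := by
  have hn : (0 : ℝ) < n + 1 := by positivity
  have : tsupport (cutoff n : Space d → ℝ) ⊆ {x | ‖x‖ ≤ 2 * (n + 1)} := by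
    refine closure_minimal (fun y hy => ?_) (isClosed_le continuous_norm continuous_const)
    have : (1 / ((n : ℝ) + 1)) • y ∈ Metric.ball (0 : Space d) 2 := by
      rw [← show bump.rOut = (2 : ℝ) from rfl, ← (bump (d := d)).support_eq]; exact hy
    rw [mem_ball_zero_iff, norm_smul, Real.norm_of_nonneg (by positivity), one_div,
      inv_mul_lt_iff₀ hn] at this
    simp only [mem_ofPred_eq]; linarith
  exact this hx

theorem hasCompactSupport_cutoff (n : ℕ) : HasCompactSupport (cutoff n : Space d → ℝ) :=
  (isCompact_closedBall (0 : Space d) (2 * (n + 1))).of_isClosed_subset (isClosed_tsupport _)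
    fun x hx => by simpa using norm_le_of_mem_tsupport_cutoff hx

theorem eventually_cutoff_eq_one (x : Space d) : ∀ᶠ n : ℕ in atTop, cutoff n x = 1 := by
  filter_upwards [eventually_ge_atTop ⌈‖x‖⌉₊] with n hn
  refine cutoff_eq_one ((Nat.le_ceil _).trans ?_)
  have : (⌈‖x‖⌉₊ : ℝ) ≤ n := by exact_mod_cast hn
  linarith

theorem tendsto_cutoff (x : Space d) : Tendsto (fun n => cutoff n x) atTop (𝓝 1) :=
  tendsto_const_nhds.congr' ((eventually_cutoff_eq_one x).mono fun _ h => h.symm)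

/-- The derivatives of the cutoffs decay like `1 / n`, so that the errors due to the truncation
vanish in the limit. -/
theorem exists_testFunction_cutoff (d : ℕ) :
    ∃ C : ℝ, 0 ≤ C ∧ ∀ n : ℕ, TestFunction (cutoff n : Space d → ℝ) (C / (n + 1)) := by
  obtain ⟨C, hC0, h1, h2⟩ := exists_bound_pd (d := d) bump.contDiff bump.hasCompactSupport
  refine ⟨C, hC0, fun n => ?_⟩
  have hn : (0 : ℝ) < n + 1 := by positivity
  have hn1 : 1 / ((n : ℝ) + 1) ≤ 1 := by
    rw [div_le_one hn]; linarith [(Nat.cast_nonneg n : (0 : ℝ) ≤ n)]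
  have e1 : ∀ i, pd i (cutoff n) = fun x : Space d =>
      1 / ((n : ℝ) + 1) * pd i bump ((1 / ((n : ℝ) + 1)) • x) :=
    fun i => pd_comp_smul bump.contDiff _ i
  refine ⟨contDiff_cutoff n, hasCompactSupport_cutoff n, cutoff_nonneg n, fun i x => ?_,
    fun i x => ?_⟩
  · rw [e1, abs_mul, abs_of_nonneg (by positivity), div_mul_eq_mul_div, one_mul]
    exact div_le_div_of_nonneg_right (h1 i _) hn.le
  · have hs : ContDiff ℝ ∞ fun x : Space d => pd i bump ((1 / ((n : ℝ) + 1)) • x) :=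
      (contDiff_pd bump.contDiff i).comp (contDiff_const_smul _)
    rw [e1, pd_const_mul hs, pd_comp_smul (contDiff_pd bump.contDiff i), abs_mul, abs_mul,
      abs_of_nonneg (by positivity : 0 ≤ 1 / ((n : ℝ) + 1))]
    calc 1 / ((n : ℝ) + 1) * (1 / ((n : ℝ) + 1) * |pd i (pd i bump) ((1 / ((n : ℝ) + 1)) • x)|)
        ≤ 1 / ((n : ℝ) + 1) * (1 * C) := by
          gcongr
          exact h2 i _
      _ = C / (n + 1) := by ring

/-- The weight `log (1 + |x|²)`, by which the spreading of the mass is measured. -/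
def weight (x : Space d) : ℝ := Real.log (1 + ‖x‖ ^ 2)

theorem contDiff_weight : ContDiff ℝ ∞ (weight : Space d → ℝ) :=
  (contDiff_const.add (contDiff_norm_sq ℝ)).log fun x => by positivity

theorem weight_nonneg (x : Space d) : 0 ≤ weight x :=
  Real.log_nonneg (by linarith [sq_nonneg ‖x‖])

theorem weight_le (x : Space d) : weight x ≤ 2 * ‖x‖ := by
  have h : weight x ≤ Real.log ((1 + ‖x‖) ^ 2) :=
    Real.log_le_log (by positivity) (by nlinarith [norm_nonneg x])
  rw [Real.log_pow] at h
  have := Real.log_le_sub_one_of_pos (by positivity : 0 < 1 + ‖x‖)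
  push_cast at h; linarith

theorem pd_coord (i : Fin d) (x : Space d) : pd i (fun y : Space d => y i) x = 1 := by
  have h : HasFDerivAt (fun y : Space d => y i) (EuclideanSpace.proj i : Space d →L[ℝ] ℝ) x :=
    (EuclideanSpace.proj i : Space d →L[ℝ] ℝ).hasFDerivAt
  simp [pd, h.fderiv]

theorem contDiff_coord (i : Fin d) : ContDiff ℝ ∞ (fun y : Space d => y i) :=
  (EuclideanSpace.proj i : Space d →L[ℝ] ℝ).contDiff

theorem pd_norm_sq (i : Fin d) (x : Space d) : pd i (fun y : Space d => ‖y‖ ^ 2) x = 2 * x i := by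
  have h := (hasStrictFDerivAt_norm_sq x).hasFDerivAt
  simp [pd, h.fderiv, EuclideanSpace.inner_single_right]

theorem pd_real_comp {f : ℝ → ℝ} {f' : ℝ} {g : Space d → ℝ} {x : Space d}
    (hf : HasDerivAt f f' (g x)) (hg : DifferentiableAt ℝ g x) (i : Fin d) :
    pd i (fun y => f (g y)) x = f' * pd i g x := by
  have h : HasFDerivAt (fun y => f (g y)) (f' • fderiv ℝ g x) x :=
    hf.comp_hasFDerivAt x hg.hasFDerivAt
  simp [pd, h.fderiv]

theorem pd_weight (i : Fin d) :
    pd i weight = fun x : Space d => (2 * x i) * (1 + ‖x‖ ^ 2)⁻¹ := by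
  funext x
  have hx : 1 + ‖x‖ ^ 2 ≠ 0 := by positivity
  have h : HasDerivAt (fun r => Real.log (1 + r)) (1 + ‖x‖ ^ 2)⁻¹ (‖x‖ ^ 2) := by
    simpa using ((hasDerivAt_id (‖x‖ ^ 2)).const_add 1).log hx
  rw [← pd_norm_sq, mul_comm]
  exact pd_real_comp (g := fun y => ‖y‖ ^ 2) h
    ((contDiff_norm_sq ℝ (n := 1)).differentiable (by simp) x) i

theorem sq_coord_le (x : Space d) (i : Fin d) : x i ^ 2 ≤ ‖x‖ ^ 2 := by
  rw [← sq_abs]; exact pow_le_pow_left₀ (abs_nonneg _) (PiLp.norm_apply_le x i) 2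

theorem abs_pd_weight_le (i : Fin d) (x : Space d) : |pd i weight x| ≤ 1 := by
  rw [pd_weight, abs_mul, abs_inv, abs_of_pos (by positivity : 0 < 1 + ‖x‖ ^ 2),
    ← div_eq_mul_inv, div_le_one (by positivity), abs_mul, abs_two]
  nlinarith [sq_coord_le x i, sq_abs (x i), sq_nonneg (|x i| - 1)]

theorem abs_pd_pd_weight_le (i : Fin d) (x : Space d) : |pd i (pd i weight) x| ≤ 6 := by
  have hx : 0 < 1 + ‖x‖ ^ 2 := by positivity
  have h : HasDerivAt (fun r : ℝ => (1 + r)⁻¹) (-1 / (1 + ‖x‖ ^ 2) ^ 2) (‖x‖ ^ 2) := by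
    simpa using ((hasDerivAt_id (‖x‖ ^ 2)).const_add 1).fun_inv hx.ne'
  have hs : ContDiff ℝ ∞ fun x : Space d => (1 + ‖x‖ ^ 2)⁻¹ :=
    (contDiff_const.add (contDiff_norm_sq ℝ)).inv fun x => by positivity
  rw [pd_weight, pd_mul (contDiff_const.mul (contDiff_coord i)) hs,
    pd_const_mul (contDiff_coord i), pd_coord,
    pd_real_comp (g := fun y => ‖y‖ ^ 2) h
      ((contDiff_norm_sq ℝ (n := 1)).differentiable (by simp) x), pd_norm_sq]
  have h1 : (1 + ‖x‖ ^ 2)⁻¹ ≤ 1 := inv_le_one_of_one_le₀ (by linarith [sq_nonneg ‖x‖])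
  have h2 : x i ^ 2 / (1 + ‖x‖ ^ 2) ^ 2 ≤ 1 := by
    rw [div_le_one (by positivity)]
    nlinarith [sq_coord_le x i, sq_nonneg ‖x‖, sq_nonneg (‖x‖ ^ 2)]
  have h3 : 0 ≤ x i ^ 2 / (1 + ‖x‖ ^ 2) ^ 2 := by positivity
  have h4 : 0 ≤ (1 + ‖x‖ ^ 2)⁻¹ := by positivity
  rw [show 2 * 1 * (1 + ‖x‖ ^ 2)⁻¹ + 2 * x i * (-1 / (1 + ‖x‖ ^ 2) ^ 2 * (2 * x i))
    = 2 * (1 + ‖x‖ ^ 2)⁻¹ - 4 * (x i ^ 2 / (1 + ‖x‖ ^ 2) ^ 2) by ring, abs_le]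
  constructor <;> linarith

/-- The truncated weights are test functions with uniform bounds: the derivatives of the cutoff
decay like `1 / n`, and the weight is at most of order `n` on its support. -/
theorem exists_testFunction_weight_mul_cutoff (d : ℕ) :
    ∃ C : ℝ, 0 ≤ C ∧ ∀ n : ℕ, TestFunction (fun x : Space d => weight x * cutoff n x) C := by
  obtain ⟨C, hC0, hC⟩ := exists_testFunction_cutoff d
  refine ⟨6 + 6 * C, by positivity, fun n => ?_⟩
  have hn : (0 : ℝ) < n + 1 := by positivity
  have hψ := contDiff_weight (d := d)
  have hχ := contDiff_cutoff (d := d) n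
  have hCn : C / (n + 1) ≤ C :=
    div_le_self hC0 (by linarith [(Nat.cast_nonneg n : (0 : ℝ) ≤ n)])
  -- on the support of the cutoff the weight is of the order of `n`
  have hw : ∀ (f : Space d → ℝ) (x : Space d), |f x| ≤ C / (n + 1) →
      (x ∉ tsupport (cutoff n) → f x = 0) → |weight x * f x| ≤ 4 * C := by
    intro f x hf hf0
    by_cases hx : x ∈ tsupport (cutoff n)
    · rw [abs_mul, abs_of_nonneg (weight_nonneg x)]
      calc weight x * |f x| ≤ (4 * (n + 1)) * (C / (n + 1)) := by
            gcongr
            linarith [weight_le x, norm_le_of_mem_tsupport_cutoff hx]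
        _ = 4 * C := by field_simp
    · rw [hf0 hx]; simpa using hC0
  have hχ1 : ∀ x : Space d, |cutoff n x| ≤ 1 := fun x => by
    rw [abs_of_nonneg (cutoff_nonneg n x)]; exact cutoff_le_one n x
  have e : ∀ i, pd i (fun x : Space d => weight x * cutoff n x) =
      fun x => pd i weight x * cutoff n x + weight x * pd i (cutoff n) x :=
    fun i => funext fun x => pd_mul hψ hχ i x
  refine ⟨hψ.mul hχ, (hasCompactSupport_cutoff n).mul_left, fun x =>
    mul_nonneg (weight_nonneg x) (cutoff_nonneg n x), fun i x => ?_, fun i x => ?_⟩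
  · rw [e]
    refine (abs_add_le _ _).trans ?_
    have h1 : |pd i weight x * cutoff n x| ≤ 1 * 1 := by
      rw [abs_mul]
      exact mul_le_mul (abs_pd_weight_le i x) (hχ1 x) (abs_nonneg _) zero_le_one
    have h2 := hw (pd i (cutoff n)) x ((hC n).first i x) fun hx => pd_eq_zero_of_notMem i hx
    linarith
  · have e2 : pd i (pd i (fun x : Space d => weight x * cutoff n x)) x =
        pd i (pd i weight) x * cutoff n x + 2 * (pd i weight x * pd i (cutoff n) x)
          + weight x * pd i (pd i (cutoff n)) x := by
      have h1 := (contDiff_pd hψ i).mul hχ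
      have h2 := hψ.mul (contDiff_pd hχ i)
      rw [e, pd_add h1 h2, pd_mul (contDiff_pd hψ i) hχ, pd_mul hψ (contDiff_pd hχ i)]
      ring
    rw [e2]
    refine (abs_add_three _ _ _).trans ?_
    have h1 : |pd i (pd i weight) x * cutoff n x| ≤ 6 * 1 := by
      rw [abs_mul]
      exact mul_le_mul (abs_pd_pd_weight_le i x) (hχ1 x) (abs_nonneg _) (by norm_num)
    have h2 : |2 * (pd i weight x * pd i (cutoff n) x)| ≤ 2 * (1 * C) := by
      rw [abs_mul, abs_mul, abs_two]
      gcongr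
      · exact abs_pd_weight_le i x
      · exact ((hC n).first i x).trans hCn
    have h3 := hw (pd i (pd i (cutoff n))) x ((hC n).second i x) fun hx =>
      pd_eq_zero_of_notMem i fun h => hx (tsupport_pd_subset i h)
    linarith

theorem integrable_exp_neg_weight (d : ℕ) :
    Integrable fun x : Space d => Real.exp (-(((d : ℝ) + 1) / 2 * weight x)) := by
  have h := integrable_rpow_neg_one_add_norm_sq (E := Space d) (μ := volume) (r := (d : ℝ) + 1)
    (by simp)
  refine h.congr (ae_of_all _ fun x => ?_)
  simp only
  rw [Real.rpow_def_of_pos (by positivity), weight]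
  congr 1; ring

end MFG

end

noncomputable section

namespace MFG

variable {d : ℕ}

/-! ### Positivity, mass and moments -/

/-- Fatou's lemma, as a criterion of integrability. -/
theorem integrable_and_integral_le_of_tendsto {α : Type*} [MeasurableSpace α] {μ : Measure α}
    {F : ℕ → α → ℝ} {G : α → ℝ} {a : ℕ → ℝ} {A : ℝ} (hF : ∀ n, Integrable (F n) μ)
    (hF0 : ∀ n, 0 ≤ᵐ[μ] F n) (hlim : ∀ᵐ x ∂μ, Tendsto (fun n => F n x) atTop (𝓝 (G x)))
    (ha : ∀ n, ∫ x, F n x ∂μ ≤ a n) (hA : Tendsto a atTop (𝓝 A)) :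
    Integrable G μ ∧ ∫ x, G x ∂μ ≤ A := by
  have hGm : AEStronglyMeasurable G μ :=
    aestronglyMeasurable_of_tendsto_ae atTop (fun n => (hF n).aestronglyMeasurable) hlim
  have hG0 : 0 ≤ᵐ[μ] G := by
    filter_upwards [hlim, ae_all_iff.2 hF0] with x hx h0
    exact ge_of_tendsto' hx h0
  have hA0 : 0 ≤ A := ge_of_tendsto' hA fun n => (integral_nonneg_of_ae (hF0 n)).trans (ha n)
  have key : ∫⁻ x, ENNReal.ofReal (G x) ∂μ ≤ ENNReal.ofReal A := by
    calc ∫⁻ x, ENNReal.ofReal (G x) ∂μ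
        = ∫⁻ x, liminf (fun n => ENNReal.ofReal (F n x)) atTop ∂μ := by
          refine lintegral_congr_ae ?_
          filter_upwards [hlim] with x hx
          exact ((ENNReal.continuous_ofReal.tendsto _).comp hx).liminf_eq.symm
      _ ≤ liminf (fun n => ∫⁻ x, ENNReal.ofReal (F n x) ∂μ) atTop :=
          lintegral_liminf_le' fun n => (hF n).aestronglyMeasurable.aemeasurable.ennreal_ofReal
      _ ≤ liminf (fun n => ENNReal.ofReal (a n)) atTop := by
          refine liminf_le_liminf (Eventually.of_forall fun n => ?_)
          rw [← ofReal_integral_eq_lintegral_ofReal (hF n) (hF0 n)]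
          exact ENNReal.ofReal_le_ofReal (ha n)
      _ = ENNReal.ofReal A := ((ENNReal.continuous_ofReal.tendsto _).comp hA).liminf_eq
  have hGi : Integrable G μ :=
    ⟨hGm, (hasFiniteIntegral_iff_ofReal hG0).2 (key.trans_lt ENNReal.ofReal_lt_top)⟩
  refine ⟨hGi, ?_⟩
  rw [← ofReal_integral_eq_lintegral_ofReal hGi hG0] at key
  exact (ENNReal.ofReal_le_ofReal_iff hA0).1 key

theorem tendsto_const_div_succ (C : ℝ) :
    Tendsto (fun n : ℕ => C / ((n : ℝ) + 1)) atTop (𝓝 0) := by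
  simpa [Function.comp_def] using
    (tendsto_const_div_atTop_nhds_zero_nat C).comp (tendsto_add_atTop_nat 1)

/-- A smooth convex approximation of twice the negative part. -/
def negApprox (ε y : ℝ) : ℝ := √(y ^ 2 + ε ^ 2) - y - ε

section negApprox

variable {ε : ℝ}

theorem contDiff_negApprox (hε : 0 < ε) : ContDiff ℝ ∞ (negApprox ε) := by
  have : ContDiff ℝ ∞ fun y : ℝ => √(y ^ 2 + ε ^ 2) :=
    (by fun_prop : ContDiff ℝ ∞ fun y : ℝ => y ^ 2 + ε ^ 2).sqrt fun y => by positivity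
  exact (this.sub contDiff_id).sub contDiff_const

theorem hasDerivAt_sqrt_sq_add (hε : 0 < ε) (y : ℝ) :
    HasDerivAt (fun y => √(y ^ 2 + ε ^ 2)) (y / √(y ^ 2 + ε ^ 2)) y := by
  have h : HasDerivAt (fun y : ℝ => y ^ 2 + ε ^ 2) (2 * y) y := by
    simpa using (hasDerivAt_pow 2 y).add_const (ε ^ 2)
  convert h.sqrt (by positivity) using 1
  field_simp

theorem deriv_negApprox (hε : 0 < ε) :
    deriv (negApprox ε) = fun y => y / √(y ^ 2 + ε ^ 2) - 1 :=
  funext fun y => (((hasDerivAt_sqrt_sq_add hε y).sub (hasDerivAt_id y)).sub_const ε).deriv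

theorem deriv_deriv_negApprox (hε : 0 < ε) (y : ℝ) :
    deriv (deriv (negApprox ε)) y = ε ^ 2 / √(y ^ 2 + ε ^ 2) ^ 3 := by
  have hr : 0 < √(y ^ 2 + ε ^ 2) := Real.sqrt_pos.2 (by positivity)
  have hr2 : √(y ^ 2 + ε ^ 2) ^ 2 = y ^ 2 + ε ^ 2 := Real.sq_sqrt (by positivity)
  rw [deriv_negApprox hε,
    (((hasDerivAt_id' y).fun_div (hasDerivAt_sqrt_sq_add hε y) hr.ne').sub_const 1).deriv]
  field_simp
  rw [hr2]; ring

theorem abs_le_sqrt_sq_add (ε y : ℝ) : |y| ≤ √(y ^ 2 + ε ^ 2) :=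
  Real.abs_le_sqrt (by linarith [sq_nonneg ε])

theorem abs_deriv_negApprox_le (hε : 0 < ε) (y : ℝ) : |deriv (negApprox ε) y| ≤ 2 := by
  have hr : 0 < √(y ^ 2 + ε ^ 2) := Real.sqrt_pos.2 (by positivity)
  have h : |y / √(y ^ 2 + ε ^ 2)| ≤ 1 := by
    rw [abs_div, abs_of_pos hr, div_le_one hr]; exact abs_le_sqrt_sq_add ε y
  rw [deriv_negApprox hε]
  have := abs_le.1 h
  exact abs_le.2 ⟨by linarith, by linarith⟩

theorem deriv_deriv_negApprox_mul_sq_le (hε : 0 < ε) (y : ℝ) :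
    deriv (deriv (negApprox ε)) y * y ^ 2 ≤ |y| ∧
      deriv (deriv (negApprox ε)) y * y ^ 2 ≤ ε := by
  have hr : 0 < √(y ^ 2 + ε ^ 2) := Real.sqrt_pos.2 (by positivity)
  have h1 := abs_le_sqrt_sq_add ε y
  have h2 : ε ≤ √(y ^ 2 + ε ^ 2) := Real.le_sqrt_of_sq_le (by linarith [sq_nonneg y])
  rw [deriv_deriv_negApprox hε, div_mul_eq_mul_div, div_le_iff₀ (by positivity),
    div_le_iff₀ (by positivity), ← sq_abs y]
  constructor
  · calc ε ^ 2 * |y| ^ 2 = |y| * (ε ^ 2 * |y|) := by ring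
      _ ≤ |y| * (√(y ^ 2 + ε ^ 2) ^ 2 * √(y ^ 2 + ε ^ 2)) := by gcongr
      _ = |y| * √(|y| ^ 2 + ε ^ 2) ^ 3 := by rw [sq_abs]; ring
  · calc ε ^ 2 * |y| ^ 2 = ε * (ε * |y| ^ 2) := by ring
      _ ≤ ε * (√(y ^ 2 + ε ^ 2) * √(y ^ 2 + ε ^ 2) ^ 2) := by gcongr
      _ = ε * √(|y| ^ 2 + ε ^ 2) ^ 3 := by rw [sq_abs]; ring

theorem negApprox_nonpos (hε : 0 < ε) {y : ℝ} (hy : 0 ≤ y) : negApprox ε y ≤ 0 := by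
  have : √(y ^ 2 + ε ^ 2) ≤ y + ε := Real.sqrt_le_iff.2 ⟨by positivity, by nlinarith⟩
  simp only [negApprox]; linarith

theorem le_negApprox (ε y : ℝ) : 2 * max (-y) 0 - ε ≤ negApprox ε y := by
  have h := abs_le_sqrt_sq_add ε y
  simp only [negApprox]
  rcases le_total y 0 with hy | hy
  · rw [max_eq_left (by linarith)]; rw [abs_of_nonpos hy] at h; linarith
  · rw [max_eq_right (by linarith)]; rw [abs_of_nonneg hy] at h; linarith

end negApprox

variable {τ T : ℝ} {b : Fin d → ℝ × Space d → ℝ} {ζ : ℝ × Space d → ℝ} {φ : Space d → ℝ}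

/-- Solutions with nonnegative initial values are nonnegative: by the entropy inequality for
approximations `β` of the negative part, the integral of the negative part stays zero. The drift
term disappears in the limit since `β''(y) y²` tends to zero boundedly. -/
theorem DriftDiffusion.nonneg (h : DriftDiffusion b ζ τ T) (hφ : Integrable φ)
    (h0 : HasInitialValue ζ τ φ) (hφ0 : ∀ x, 0 ≤ φ x) : ∀ z ∈ slab τ T, 0 ≤ ζ z := by
  rintro ⟨t, x⟩ hz
  obtain ⟨ht1, ht2⟩ := mem_slab.1 hz
  obtain ⟨C, hC0, hC⟩ := exists_testFunction_cutoff d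
  obtain ⟨B, hB⟩ := h.bounded
  have hm := measurableSet_slab (d := d) τ T
  set W := ∫ z in slab τ T, ∑ i, |ζ z| * (1 + |b i z|) with hW
  have cζt : Continuous fun x => ζ (t, x) := continuous_slice h.smooth.continuousOn ⟨ht1, ht2⟩
  have cN : Continuous fun x => max (-ζ (t, x)) 0 := cζt.neg.max continuous_const
  have iN : ∀ n, Integrable fun x => max (-ζ (t, x)) 0 * cutoff n x := fun n =>
    (cN.mul (contDiff_cutoff n).continuous).integrable_of_hasCompactSupport
      (hasCompactSupport_cutoff n).mul_left
  have iχ : ∀ n, Integrable (cutoff n : Space d → ℝ) := fun n =>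
    (contDiff_cutoff n).continuous.integrable_of_hasCompactSupport (hasCompactSupport_cutoff n)
  -- for a fixed cutoff, let the regularization of the negative part tend to zero
  have main : ∀ n : ℕ, ∫ x, max (-ζ (t, x)) 0 * cutoff n x ≤ (C * W) / (n + 1) := by
    intro n
    set ε : ℕ → ℝ := fun k => 1 / ((k : ℝ) + 1) with hεdef
    have hε : ∀ k, 0 < ε k := fun k => by positivity
    have hε0 : Tendsto ε atTop (𝓝 0) := tendsto_const_div_succ 1
    set D : ℕ → ℝ := fun k => ∫ z in slab τ T,
      ∑ i, deriv (deriv (negApprox (ε k))) (ζ z) * ζ z ^ 2 * b i z ^ 2 * cutoff n z.2 with hD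
    have hD0 : Tendsto D atTop (𝓝 0) := by
      rw [show (0 : ℝ) = ∫ z in (slab τ T : Set (ℝ × Space d)), (0 : ℝ) by simp]
      have cc : ∀ k, ContinuousOn (fun z => ∑ i, deriv (deriv (negApprox (ε k))) (ζ z) * ζ z ^ 2
          * b i z ^ 2 * cutoff n z.2) (slab τ T) := fun k =>
        continuousOn_finsetSum _ fun i _ => (((contDiffOn_comp_of_contDiffAt h.smooth fun z _ =>
          contDiffAt_deriv (contDiffAt_deriv
            (contDiff_negApprox (hε k)).contDiffAt)).continuousOn.mul
          (h.smooth.continuousOn.pow 2)).mul ((h.smooth_drift i).continuousOn.pow 2)).mul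
          ((contDiff_cutoff n).continuous.comp continuous_snd).continuousOn
      have nn : ∀ k y, 0 ≤ deriv (deriv (negApprox (ε k))) y := fun k y => by
        rw [deriv_deriv_negApprox (hε k)]; positivity
      have hb2 : ∀ z ∈ slab τ T, ∀ i, b i z ^ 2 ≤ B ^ 2 := fun z hz i => by
        rw [← sq_abs]; exact pow_le_pow_left₀ (abs_nonneg _) (hB z hz i) 2
      refine tendsto_integral_of_dominated_convergence (fun z => ∑ _i : Fin d, |ζ z| * B ^ 2)
        (fun k => (cc k).aestronglyMeasurable hm)
        (integrable_finsetSum _ fun i _ => h.integrable.norm.mul_const _) (fun k => ?_) ?_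
      · filter_upwards [ae_restrict_mem hm] with z hz
        refine (norm_sum_le _ _).trans (Finset.sum_le_sum fun i _ => ?_)
        have := (deriv_deriv_negApprox_mul_sq_le (hε k) (ζ z)).1
        have h3 := nn k (ζ z)
        have h4 := cutoff_nonneg n z.2
        rw [Real.norm_of_nonneg (by positivity)]
        exact (mul_le_mul (mul_le_mul this (hb2 z hz i) (sq_nonneg _) (abs_nonneg _))
          (cutoff_le_one n _) h4 (by positivity)).trans_eq (mul_one _)
      · filter_upwards [ae_restrict_mem hm] with z hz
        have hlim : Tendsto (fun k => ∑ _i : Fin d, ε k * B ^ 2) atTop (𝓝 0) := by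
          simpa only [zero_mul, Finset.sum_const_zero] using
            tendsto_finsetSum (Finset.univ : Finset (Fin d)) fun i _ => hε0.mul_const (B ^ 2)
        refine squeeze_zero (fun k => Finset.sum_nonneg fun i _ => ?_) (fun k =>
          Finset.sum_le_sum fun i _ => ?_) hlim
        · have h3 := nn k (ζ z)
          have h4 := cutoff_nonneg n z.2
          positivity
        · have := (deriv_deriv_negApprox_mul_sq_le (hε k) (ζ z)).2
          have h3 := nn k (ζ z)
          have h4 := cutoff_nonneg n z.2
          exact (mul_le_mul (mul_le_mul this (hb2 z hz i) (sq_nonneg _) (hε k).le)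
            (cutoff_le_one n _) h4 (mul_nonneg (hε k).le (sq_nonneg B))).trans_eq (mul_one _)
    have hk : ∀ k, 2 * ∫ x, max (-ζ (t, x)) 0 * cutoff n x ≤
        ε k * (∫ x : Space d, cutoff n x) + 1 / 2 * D k + 2 * (C / (n + 1)) * W := by
      intro k
      have hs := contDiff_negApprox (hε k)
      have := h.renormalized_inequality hφ h0 convex_univ (mem_univ 0) (fun _ _ => mem_univ _)
        (fun _ => mem_univ _) (β := negApprox (ε k)) (L := 2) (C := 1)
        hs.continuous.measurable (fun y _ => hs.contDiffAt)
        (by simp [negApprox, abs_of_pos (hε k), Real.sqrt_sq_eq_abs])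
        (fun y _ => abs_deriv_negApprox_le (hε k) y)
        (fun y _ => by rw [deriv_deriv_negApprox (hε k)]; positivity)
        (fun y _ => by simpa using (deriv_deriv_negApprox_mul_sq_le (hε k) y).1)
        (hC n) (s₀ := (τ + t) / 2) (t := t) (by linarith) (by linarith) ht2
      have e1 : 0 ≤ ∫ z in slab ((τ + t) / 2) t,
          ∑ i, deriv (deriv (negApprox (ε k))) (ζ z) * dx i ζ z ^ 2 * cutoff n z.2 := by
        refine integral_nonneg fun z => Finset.sum_nonneg fun i _ => ?_
        rw [deriv_deriv_negApprox (hε k)]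
        have := cutoff_nonneg n z.2
        positivity
      have e2 : ∫ x, negApprox (ε k) (φ x) * cutoff n x ≤ 0 := integral_nonpos fun x =>
        mul_nonpos_of_nonpos_of_nonneg (negApprox_nonpos (hε k) (hφ0 x)) (cutoff_nonneg n x)
      have e3 : 2 * (∫ x, max (-ζ (t, x)) 0 * cutoff n x) - ε k * (∫ x : Space d, cutoff n x) ≤
          ∫ x, negApprox (ε k) (ζ (t, x)) * cutoff n x := by
        rw [← integral_const_mul, ← integral_const_mul,
          ← integral_sub ((iN n).const_mul 2) ((iχ n).const_mul _)]
        refine integral_mono (((iN n).const_mul 2).sub ((iχ n).const_mul _))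
          (((hs.continuous.comp cζt).mul (contDiff_cutoff n).continuous
            ).integrable_of_hasCompactSupport (hasCompactSupport_cutoff n).mul_left) fun x => ?_
        have := mul_le_mul_of_nonneg_right (le_negApprox (ε k) (ζ (t, x))) (cutoff_nonneg n x)
        simp only
        linarith
      simp only [hD]
      linarith
    have hlim := ((hε0.mul_const (∫ x : Space d, cutoff n x)).add
      (hD0.const_mul (1 / 2))).add_const (2 * (C / (n + 1)) * W)
    have := ge_of_tendsto' hlim hk
    rw [mul_div_right_comm]
    linarith
  have fin := integrable_and_integral_le_of_tendsto (G := fun x => max (-ζ (t, x)) 0)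
    (fun n => iN n) (fun n => ae_of_all _ fun x => mul_nonneg (le_max_right _ _) (cutoff_nonneg n x))
    (ae_of_all _ fun x => by simpa using (tendsto_cutoff x).const_mul (max (-ζ (t, x)) 0))
    main (tendsto_const_div_succ _)
  have hzero : (fun x => max (-ζ (t, x)) 0) =ᵐ[volume] fun _ => 0 :=
    (integral_eq_zero_iff_of_nonneg (fun x => le_max_right _ _) fin.1).1
      (le_antisymm fin.2 (integral_nonneg fun x => le_max_right _ _))
  have := congrFun ((Continuous.ae_eq_iff_eq volume cN continuous_const).1 hzero) x
  have h2 := le_max_left (-ζ (t, x)) 0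
  linarith

/-- The entropy inequality with `β(y) = y`: the equation tested against a function of the space
variable. -/
theorem DriftDiffusion.integral_mul_testFunction_le (h : DriftDiffusion b ζ τ T)
    (hφ : Integrable φ) (h0 : HasInitialValue ζ τ φ) {χ : Space d → ℝ} {κ : ℝ}
    (hχ : TestFunction χ κ) {t : ℝ} (ht : t ∈ Ioo τ T) :
    ∫ x, ζ (t, x) * χ x ≤
      (∫ x, φ x * χ x) + κ * ∫ z in slab τ T, ∑ i, |ζ z| * (1 + |b i z|) := by
  have h2 : deriv (deriv fun y : ℝ => y) = fun _ => 0 := by simp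
  have := h.renormalized_inequality hφ h0 convex_univ (mem_univ 0) (fun _ _ => mem_univ _)
    (fun _ => mem_univ _) (β := fun y => y) (L := 1) (C := 0) measurable_id
    (fun y _ => contDiffAt_id) rfl (fun y _ => by simp) (fun y _ => by simp)
    (fun y _ => by simp) hχ (s₀ := (τ + t) / 2) (t := t) (by linarith [ht.1])
    (by linarith [ht.1]) ht.2
  simpa [h2] using this

/-- The mass does not increase. -/
theorem DriftDiffusion.mass_le (h : DriftDiffusion b ζ τ T) (hφ : Integrable φ)
    (h0 : HasInitialValue ζ τ φ) (hφ0 : ∀ x, 0 ≤ φ x) {t : ℝ} (ht : t ∈ Ioo τ T) :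
    Integrable (fun x => ζ (t, x)) ∧ ∫ x, ζ (t, x) ≤ ∫ x, φ x := by
  obtain ⟨C, hC0, hC⟩ := exists_testFunction_cutoff d
  have hpos := h.nonneg hφ h0 hφ0
  have cζt : Continuous fun x => ζ (t, x) := continuous_slice h.smooth.continuousOn ht
  have hlim : Tendsto (fun n : ℕ => (∫ x, φ x)
      + (C * ∫ z in slab τ T, ∑ i, |ζ z| * (1 + |b i z|)) / ((n : ℝ) + 1)) atTop
      (𝓝 (∫ x, φ x)) := by
    simpa using (tendsto_const_div_succ _).const_add (∫ x, φ x)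
  refine integrable_and_integral_le_of_tendsto (F := fun n x => ζ (t, x) * cutoff n x)
    (fun n => (cζt.mul (contDiff_cutoff n).continuous).integrable_of_hasCompactSupport
      (hasCompactSupport_cutoff n).mul_left)
    (fun n => ae_of_all _ fun x => mul_nonneg (hpos _ (mem_slab.2 ht)) (cutoff_nonneg n x))
    (ae_of_all _ fun x => by simpa using (tendsto_cutoff x).const_mul (ζ (t, x)))
    (fun n => ?_) hlim
  refine (h.integral_mul_testFunction_le hφ h0 (hC n) ht).trans ?_
  rw [mul_div_right_comm]
  refine add_le_add_left ?_ _
  refine integral_mono_of_nonneg (ae_of_all _ fun x => mul_nonneg (hφ0 x) (cutoff_nonneg n x))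
    hφ (ae_of_all _ fun x => mul_le_of_le_one_right (hφ0 x) (cutoff_le_one n x))

/-- The spreading of the mass is controlled by the drift. -/
theorem exists_moment_bound (d : ℕ) : ∃ C : ℝ, 0 ≤ C ∧
    ∀ {τ T : ℝ} {b : Fin d → ℝ × Space d → ℝ} {ζ : ℝ × Space d → ℝ} {φ : Space d → ℝ},
      DriftDiffusion b ζ τ T → Integrable φ → HasInitialValue ζ τ φ → (∀ x, 0 ≤ φ x) →
      Integrable (fun x => φ x * weight x) → ∀ t ∈ Ioo τ T,
      Integrable (fun x => ζ (t, x) * weight x) ∧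
        ∫ x, ζ (t, x) * weight x ≤ (∫ x, φ x * weight x)
          + C * ∫ z in slab τ T, ∑ i, |ζ z| * (1 + |b i z|) := by
  obtain ⟨C, hC0, hC⟩ := exists_testFunction_weight_mul_cutoff d
  refine ⟨C, hC0, fun {τ T b ζ φ} h hφ h0 hφ0 hφw t ht => ?_⟩
  have hpos := h.nonneg hφ h0 hφ0
  have cζt : Continuous fun x => ζ (t, x) := continuous_slice h.smooth.continuousOn ht
  refine integrable_and_integral_le_of_tendsto
    (F := fun n x => ζ (t, x) * (weight x * cutoff n x))
    (fun n => (cζt.mul (hC n).smooth.continuous).integrable_of_hasCompactSupport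
      (hC n).compact.mul_left)
    (fun n => ae_of_all _ fun x => mul_nonneg (hpos _ (mem_slab.2 ht)) ((hC n).nonneg x))
    (ae_of_all _ fun x => by
      simpa using ((tendsto_cutoff x).const_mul (weight x)).const_mul (ζ (t, x)))
    (fun n => ?_) tendsto_const_nhds
  refine (h.integral_mul_testFunction_le hφ h0 (hC n) ht).trans ?_
  refine add_le_add_left ?_ _
  refine integral_mono_of_nonneg (ae_of_all _ fun x => mul_nonneg (hφ0 x) ((hC n).nonneg x))
    hφw (ae_of_all _ fun x => mul_le_mul_of_nonneg_left
      (mul_le_of_le_one_right (weight_nonneg x) (cutoff_le_one n x)) (hφ0 x))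

end MFG

end

noncomputable section

namespace MFG

variable {d : ℕ}

/-! ### The entropy estimate -/

/-- A convex function of linear growth which approximates the entropy `y log y` as `N → ∞`; its
second derivative is `1 / (y + 1 / N) - 1 / (y + N)`. -/
def entropyApprox (N y : ℝ) : ℝ :=
  (y + N⁻¹) * Real.log (y + N⁻¹) - N⁻¹ * Real.log N⁻¹ - (y + N) * Real.log (1 + y / N) + y

section entropyApprox

variable {N y : ℝ}

theorem hasDerivAt_entropyApprox (hN : 1 ≤ N) (hy : -N⁻¹ < y) :
    HasDerivAt (entropyApprox N) (Real.log (y + N⁻¹) - Real.log (1 + y / N) + 1) y := by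
  have hN0 : 0 < N := by linarith
  have hNi : N⁻¹ ≤ 1 := inv_le_one_of_one_le₀ hN
  have h1 : 0 < y + N⁻¹ := by linarith
  have h2 : 0 < y + N := by linarith
  have h3 : 1 + y / N = (y + N) / N := by field_simp; ring
  have h4 : 0 < 1 + y / N := h3 ▸ div_pos h2 hN0
  have a1 : HasDerivAt (fun y : ℝ => y + N⁻¹) 1 y := (hasDerivAt_id' y).add_const _
  have a2 : HasDerivAt (fun y : ℝ => y + N) 1 y := (hasDerivAt_id' y).add_const _
  have a3 : HasDerivAt (fun y : ℝ => 1 + y / N) (1 / N) y :=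
    ((hasDerivAt_id' y).div_const N).const_add 1
  have := (((a1.fun_mul (a1.log h1.ne')).sub_const (N⁻¹ * Real.log N⁻¹)).fun_sub
    (a2.fun_mul (a3.log h4.ne'))).fun_add (hasDerivAt_id' y)
  refine this.congr_deriv ?_
  rw [mul_div_cancel₀ _ h1.ne', h3]
  field_simp
  ring

theorem deriv_deriv_entropyApprox (hN : 1 ≤ N) (hy : 0 ≤ y) :
    deriv (deriv (entropyApprox N)) y = 1 / (y + N⁻¹) - 1 / (y + N) := by
  have hN0 : 0 < N := by linarith
  have hNi : 0 < N⁻¹ := by positivity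
  have e : deriv (entropyApprox N) =ᶠ[𝓝 y]
      fun y => Real.log (y + N⁻¹) - Real.log (1 + y / N) + 1 := by
    filter_upwards [Ioi_mem_nhds (by linarith : -N⁻¹ < y)] with r hr
    exact (hasDerivAt_entropyApprox hN hr).deriv
  have h1 : 0 < y + N⁻¹ := by linarith
  have h2 : 0 < y + N := by linarith
  have h3 : 1 + y / N = (y + N) / N := by field_simp; ring
  have h4 : 0 < 1 + y / N := h3 ▸ div_pos h2 hN0
  have a1 : HasDerivAt (fun y : ℝ => y + N⁻¹) 1 y := (hasDerivAt_id' y).add_const _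
  have a3 : HasDerivAt (fun y : ℝ => 1 + y / N) (1 / N) y :=
    ((hasDerivAt_id' y).div_const N).const_add 1
  rw [e.deriv_eq, (((a1.log h1.ne').fun_sub (a3.log h4.ne')).add_const 1).deriv, h3]
  field_simp

theorem contDiffAt_entropyApprox (hN : 1 ≤ N) (hy : 0 ≤ y) :
    ContDiffAt ℝ ∞ (entropyApprox N) y := by
  have hN0 : 0 < N := by linarith
  have h1 : y + N⁻¹ ≠ 0 := by positivity
  have h2 : 1 + y / N ≠ 0 := by positivity
  unfold entropyApprox
  fun_prop (disch := assumption)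

theorem measurable_entropyApprox : Measurable (entropyApprox N) := by
  unfold entropyApprox
  fun_prop

theorem abs_log_quotient_le (hN : 1 ≤ N) (hy : 0 ≤ y) :
    |Real.log (y + N⁻¹) - Real.log (1 + y / N)| ≤ N - 1 := by
  have hN0 : 0 < N := by linarith
  have hNi : N⁻¹ ≤ 1 := inv_le_one_of_one_le₀ hN
  have hlog := Real.log_le_sub_one_of_pos hN0
  have h1 : 0 < y + N⁻¹ := by positivity
  have h2 : 0 < 1 + y / N := by positivity
  have e1 : Real.log (y + N⁻¹) ≤ Real.log (1 + y / N) + Real.log N := by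
    rw [← Real.log_mul h2.ne' hN0.ne']
    refine Real.log_le_log h1 ?_
    rw [add_mul, div_mul_cancel₀ _ hN0.ne']; linarith
  have e2 : Real.log (1 + y / N) ≤ Real.log (y + N⁻¹) + Real.log N := by
    rw [← Real.log_mul h1.ne' hN0.ne']
    refine Real.log_le_log h2 ?_
    rw [add_mul, inv_mul_cancel₀ hN0.ne']
    have : y / N ≤ y * N := by
      rw [div_eq_mul_inv]; exact mul_le_mul_of_nonneg_left (hNi.trans hN) hy
    linarith
  exact abs_le.2 ⟨by linarith, by linarith⟩

theorem abs_deriv_entropyApprox_le (hN : 1 ≤ N) (hy : 0 ≤ y) :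
    |deriv (entropyApprox N) y| ≤ N := by
  have hN0 : 0 < N := by linarith
  have hNi : 0 < N⁻¹ := by positivity
  rw [(hasDerivAt_entropyApprox hN (by linarith)).deriv]
  refine (abs_add_le _ _).trans ?_
  rw [abs_one]
  linarith [abs_log_quotient_le hN hy]

theorem entropyApprox_zero : entropyApprox N 0 = 0 := by simp [entropyApprox]

theorem mul_log_le_entropyApprox (hN : 1 ≤ N) (hy : 0 ≤ y) :
    y * (Real.log (y + N⁻¹) - Real.log (1 + y / N)) ≤ entropyApprox N y := by
  have hN0 : 0 < N := by linarith
  have h1 : N⁻¹ * Real.log N⁻¹ ≤ N⁻¹ * Real.log (y + N⁻¹) :=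
    mul_le_mul_of_nonneg_left (Real.log_le_log (by positivity) (by linarith)) (by positivity)
  have h2 : N * Real.log (1 + y / N) ≤ y := by
    have := Real.log_le_sub_one_of_pos (by positivity : 0 < 1 + y / N)
    calc _ ≤ N * (y / N) := by gcongr; linarith
      _ = y := by field_simp
  simp only [entropyApprox]
  linarith

/-- The initial value of the approximate entropy is bounded uniformly in `N`. -/
theorem entropyApprox_le (hN : 1 ≤ N) (hy : 0 ≤ y) :
    entropyApprox N y ≤ y + y * Real.log (1 + y) := by
  have hN0 : 0 < N := by linarith
  have hNi : N⁻¹ ≤ 1 := inv_le_one_of_one_le₀ hN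
  have h1 : y * Real.log (y + N⁻¹) ≤ y * Real.log (1 + y) :=
    mul_le_mul_of_nonneg_left (Real.log_le_log (by positivity) (by linarith)) hy
  have h2 : N⁻¹ * Real.log (y + N⁻¹) - N⁻¹ * Real.log N⁻¹ ≤ y := by
    have e : Real.log (y + N⁻¹) - Real.log N⁻¹ = Real.log (1 + y * N) := by
      rw [← Real.log_div (by positivity) (by positivity)]
      congr 1; field_simp; ring
    have := Real.log_le_sub_one_of_pos (by positivity : 0 < 1 + y * N)
    rw [← mul_sub, e]
    calc _ ≤ N⁻¹ * (y * N) := by gcongr; linarith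
      _ = y := by field_simp
  have h3 : y ≤ (y + N) * Real.log (1 + y / N) := by
    -- the inequality `log u ≤ u - 1` at `u = (1 + y / N)⁻¹`
    have h := Real.log_le_sub_one_of_pos (by positivity : 0 < (1 + y / N)⁻¹)
    rw [Real.log_inv] at h
    have e : (y + N) * (1 - (1 + y / N)⁻¹) = y := by
      have : y + N ≠ 0 := by positivity
      have h3 : 1 + y / N = (y + N) / N := by field_simp; ring
      rw [h3]; field_simp; ring
    calc y = (y + N) * (1 - (1 + y / N)⁻¹) := e.symm
      _ ≤ _ := by gcongr; linarith
  simp only [entropyApprox]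
  linarith

/-- Young's inequality for the entropy. -/
theorem neg_entropyApprox_le (hN : 1 ≤ N) (hy : 0 ≤ y) {k : ℝ} (hk : 0 ≤ k) :
    -entropyApprox N y ≤ k * y + Real.exp (-k) := by
  have hN0 : 0 < N := by linarith
  rcases hy.eq_or_lt with rfl | hy
  · rw [entropyApprox_zero]; simp [Real.exp_nonneg]
  have h1 := mul_log_le_entropyApprox hN hy.le
  have h2 : Real.log y - Real.log (1 + y) ≤ Real.log (y + N⁻¹) - Real.log (1 + y / N) := by
    have : Real.log (1 + y / N) ≤ Real.log (1 + y) :=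
      Real.log_le_log (by positivity) (by linarith [div_le_self hy.le hN])
    have : Real.log y ≤ Real.log (y + N⁻¹) :=
      Real.log_le_log hy (by linarith [inv_nonneg.2 hN0.le])
    linarith
  -- `log u ≤ u - 1` at `u = (1 + y) e⁻ᵏ / y`
  have h3 : Real.log (1 + y) - Real.log y - k ≤ (1 + y) / y * Real.exp (-k) - 1 := by
    have := Real.log_le_sub_one_of_pos (by positivity : 0 < (1 + y) / y * Real.exp (-k))
    rw [Real.log_mul (by positivity) (by positivity), Real.log_div (by positivity) hy.ne',
      Real.log_exp] at this
    linarith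
  have h4 := mul_le_mul_of_nonneg_left h3 hy.le
  have h5 : y * ((1 + y) / y * Real.exp (-k) - 1) = (1 + y) * Real.exp (-k) - y := by field_simp
  have h6 : y * Real.exp (-k) ≤ y * 1 :=
    mul_le_mul_of_nonneg_left (Real.exp_le_one_iff.2 (by linarith)) hy.le
  have h7 := mul_le_mul_of_nonneg_left h2 hy.le
  linarith

end entropyApprox

/-- The density `|Dζ|² / ζ` of the Fisher information; where `ζ = 0` it has the value `0`. -/
def fisher (ζ : ℝ × Space d → ℝ) (z : ℝ × Space d) : ℝ := (∑ i, dx i ζ z ^ 2) / ζ z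

theorem dx_eq_zero_of_eq_zero {τ T : ℝ} {ζ : ℝ × Space d → ℝ} (hζ : ∀ z ∈ slab τ T, 0 ≤ ζ z)
    {z : ℝ × Space d} (hz : z ∈ slab τ T) (h : ζ z = 0) (i : Fin d) : dx i ζ z = 0 := by
  have : IsLocalMin ζ z := by
    filter_upwards [(isOpen_slab τ T).mem_nhds hz] with w hw
    rw [h]; exact hζ w hw
  simp [dx, this.fderiv_eq_zero]

theorem fisher_nonneg {τ T : ℝ} {ζ : ℝ × Space d → ℝ} (hζ : ∀ z ∈ slab τ T, 0 ≤ ζ z)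
    {z : ℝ × Space d} (hz : z ∈ slab τ T) : 0 ≤ fisher ζ z :=
  div_nonneg (Finset.sum_nonneg fun _ _ => sq_nonneg _) (hζ z hz)

theorem sum_dx_sq_eq_fisher_mul {τ T : ℝ} {ζ : ℝ × Space d → ℝ} (hζ : ∀ z ∈ slab τ T, 0 ≤ ζ z)
    {z : ℝ × Space d} (hz : z ∈ slab τ T) : ∑ i, dx i ζ z ^ 2 = fisher ζ z * ζ z := by
  by_cases h : ζ z = 0
  · simp [h, dx_eq_zero_of_eq_zero hζ hz h]
  · rw [fisher, div_mul_cancel₀ _ h]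

theorem abs_dx_le_fisher_add {τ T : ℝ} {ζ : ℝ × Space d → ℝ} (hζ : ∀ z ∈ slab τ T, 0 ≤ ζ z)
    {z : ℝ × Space d} (hz : z ∈ slab τ T) (i : Fin d) : |dx i ζ z| ≤ fisher ζ z + ζ z := by
  have h1 := sum_dx_sq_eq_fisher_mul hζ hz
  have h2 : dx i ζ z ^ 2 ≤ ∑ j, dx j ζ z ^ 2 :=
    Finset.single_le_sum (f := fun j => dx j ζ z ^ 2) (fun j _ => sq_nonneg _)
      (Finset.mem_univ i)
  have h3 := fisher_nonneg hζ hz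
  have h4 := hζ z hz
  exact abs_le_of_sq_le_sq (by nlinarith) (by positivity)

/-- The Fisher information of a drift-diffusion equation is controlled by the initial entropy and
weight, and by the kinetic energy of the drift. -/
theorem exists_fisher_bound (d : ℕ) : ∃ C : ℝ, 0 ≤ C ∧
    ∀ {τ T : ℝ} {b : Fin d → ℝ × Space d → ℝ} {ζ : ℝ × Space d → ℝ} {φ : Space d → ℝ},
      τ < T → DriftDiffusion b ζ τ T → Integrable φ → HasInitialValue ζ τ φ → (∀ x, 0 ≤ φ x) →
      Integrable (fun x => φ x * weight x) → Integrable (fun x => φ x * Real.log (1 + φ x)) →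
      IntegrableOn (fisher ζ) (slab τ T) ∧
        ∫ z in slab τ T, fisher ζ z ≤ C * (1 + (∫ x, (φ x + φ x * Real.log (1 + φ x)))
          + (∫ x, φ x * weight x) + ∫ z in slab τ T, ζ z * ∑ i, (1 + b i z ^ 2)) := by
  obtain ⟨C₁, hC₁, hmoment⟩ := exists_moment_bound d
  obtain ⟨C₂, hC₂, hcut⟩ := exists_testFunction_cutoff d
  set M : ℝ := ((d : ℝ) + 1) / 2 with hM
  have hM0 : 0 ≤ M := by positivity
  -- `E` is finite, as `(1 + |x|²) ^ (-(d + 1) / 2)` is integrable; it enters the lower bound for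
  -- the entropy through Young's inequality with `k = M * weight x`
  set E : ℝ := ∫ x : Space d, Real.exp (-(M * weight x)) with hE
  have hE0 : 0 ≤ E := integral_nonneg fun x => (Real.exp_pos _).le
  refine ⟨2 * (1 + M + E + 2 * M * C₁ + 1), by positivity,
    fun {τ T b ζ φ} hT h hφ h0 hφ0 hφw hφl => ?_⟩
  have hO := isOpen_slab (d := d) τ T
  have hm := measurableSet_slab (d := d) τ T
  have hpos := h.nonneg hφ h0 hφ0
  obtain ⟨B, hB⟩ := h.bounded
  set W := ∫ z in slab τ T, ∑ i, |ζ z| * (1 + |b i z|) with hW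
  set A := ∫ z in slab τ T, ζ z * ∑ i, (1 + b i z ^ 2) with hA
  set P := ∫ x, (φ x + φ x * Real.log (1 + φ x)) with hP
  set Q := ∫ x, φ x * weight x with hQ
  have hQ0 : 0 ≤ Q := integral_nonneg fun x => mul_nonneg (hφ0 x) (weight_nonneg x)
  have hlog0 : ∀ x, 0 ≤ φ x + φ x * Real.log (1 + φ x) := fun x =>
    add_nonneg (hφ0 x) (mul_nonneg (hφ0 x) (Real.log_nonneg (by linarith [hφ0 x])))
  have hP0 : 0 ≤ P := integral_nonneg hlog0
  have hA0 : 0 ≤ A := setIntegral_nonneg hm fun z hz =>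
    mul_nonneg (hpos z hz) (Finset.sum_nonneg fun i _ => by positivity)
  have iW' : IntegrableOn (fun z => ∑ i, |ζ z| * (1 + |b i z|)) (slab τ T) :=
    integrable_finsetSum _ fun i _ => h.integrableOn_weight i
  have hb2 : ∀ z ∈ slab τ T, ∀ i, b i z ^ 2 ≤ B ^ 2 := fun z hz i => by
    rw [← sq_abs]; exact pow_le_pow_left₀ (abs_nonneg _) (hB z hz i) 2
  have iA : IntegrableOn (fun z => ζ z * ∑ i, (1 + b i z ^ 2)) (slab τ T) := by
    refine (h.integrable.norm.mul_const (∑ _i : Fin d, (1 + B ^ 2))).mono'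
      ((h.smooth.continuousOn.mul (continuousOn_finsetSum _ fun i _ => continuousOn_const.add
        ((h.smooth_drift i).continuousOn.pow 2))).aestronglyMeasurable hm) ?_
    filter_upwards [ae_restrict_mem hm] with z hz
    rw [Real.norm_of_nonneg (mul_nonneg (hpos z hz) (Finset.sum_nonneg fun i _ => by positivity)),
      Real.norm_eq_abs]
    exact mul_le_mul (le_abs_self _) (Finset.sum_le_sum fun i _ => by linarith [hb2 z hz i])
      (Finset.sum_nonneg fun i _ => by positivity) (abs_nonneg _)
  have hWA : W ≤ 2 * A := by
    rw [hW, hA, ← integral_const_mul]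
    refine setIntegral_mono_on iW' (iA.const_mul 2) hm fun z hz => ?_
    rw [Finset.mul_sum, Finset.mul_sum]
    refine Finset.sum_le_sum fun i _ => ?_
    rw [abs_of_nonneg (hpos z hz), mul_left_comm]
    refine mul_le_mul_of_nonneg_left ?_ (hpos z hz)
    nlinarith [sq_abs (b i z), sq_nonneg (|b i z| - 1)]
  -- the bound on a slab which is strictly smaller in time
  have inner : ∀ s₀ t : ℝ, τ < s₀ → s₀ ≤ t → t < T → IntegrableOn (fisher ζ) (slab s₀ t) ∧
      ∫ z in slab s₀ t, fisher ζ z ≤ 2 * (P + (M * (Q + C₁ * W) + E) + 1 / 2 * A) := by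
    intro s₀ t hs₀ hst ht
    have htT : t ∈ Ioo τ T := ⟨hs₀.trans_le hst, ht⟩
    have hsub : (slab s₀ t : Set (ℝ × Space d)) ⊆ slab τ T := slab_subset hs₀.le ht.le
    obtain ⟨iM, hMt⟩ := hmoment h hφ h0 hφ0 hφw t htT
    have cζt : Continuous fun x => ζ (t, x) := continuous_slice h.smooth.continuousOn htT
    set N : ℕ → ℝ := fun k => (k : ℝ) + 1 with hN
    have hN1 : ∀ k, 1 ≤ N k := fun k => by simp [hN]
    have hN0 : ∀ k, 0 < N k := fun k => by linarith [hN1 k]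
    -- a cutoff radius that beats the Lipschitz constant `N` of the approximate entropy
    set m : ℕ → ℕ := fun k => (k + 1) ^ 2 with hmdef
    have hm_top : Tendsto m atTop atTop :=
      tendsto_atTop_mono (fun k => by simp only [hmdef, id]; nlinarith) tendsto_id
    have cβ2 : ∀ k, ContinuousOn (fun z => deriv (deriv (entropyApprox (N k))) (ζ z))
        (slab τ T) := fun k => (contDiffOn_comp_of_contDiffAt h.smooth fun z hz =>
      contDiffAt_deriv (contDiffAt_deriv
        (contDiffAt_entropyApprox (hN1 k) (hpos z hz)))).continuousOn
    have nn2 : ∀ k y, 0 ≤ y → 0 ≤ deriv (deriv (entropyApprox (N k))) y := fun k y hy => by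
      rw [deriv_deriv_entropyApprox (hN1 k) hy, sub_nonneg]
      have : (N k)⁻¹ ≤ 1 := inv_le_one_of_one_le₀ (hN1 k)
      have := hN0 k
      exact one_div_le_one_div_of_le (by positivity) (by linarith [hN1 k])
    have sq2 : ∀ k y, 0 ≤ y → deriv (deriv (entropyApprox (N k))) y * y ^ 2 ≤ y :=
      fun k y hy => by
        have := hN0 k
        rw [deriv_deriv_entropyApprox (hN1 k) hy]
        have h1 : 1 / (y + (N k)⁻¹) * y ^ 2 ≤ y := by
          rw [one_div_mul_eq_div, div_le_iff₀ (by positivity)]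
          nlinarith [mul_nonneg hy (inv_nonneg.2 this.le)]
        have h2 : 0 ≤ 1 / (y + N k) * y ^ 2 := by positivity
        linarith
    have key := integrable_and_integral_le_of_tendsto (μ := volume.restrict (slab s₀ t))
      (F := fun k z => ∑ i, deriv (deriv (entropyApprox (N k))) (ζ z) * dx i ζ z ^ 2
        * cutoff (m k) z.2) (G := fisher ζ)
      (a := fun k => 2 * (P + (M * (Q + C₁ * W) + E) + 1 / 2 * A) + (2 * (C₂ * W)) / (k + 1))
      (A := 2 * (P + (M * (Q + C₁ * W) + E) + 1 / 2 * A)) ?_ ?_ ?_ ?_ ?_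
    · exact key
    · intro k
      exact integrableOn_slab_of_notMem_eq_zero (τ := τ) (T := T) (K := tsupport (cutoff (m k)))
        (continuousOn_finsetSum _ fun i _ => ((cβ2 k).mul
          ((contDiffOn_dx hO h.smooth i).continuousOn.pow 2)).mul
          ((contDiff_cutoff _).continuous.comp continuous_snd).continuousOn)
        (hasCompactSupport_cutoff _)
        (fun z _ hz => by simp [image_eq_zero_of_notMem_tsupport hz]) hs₀ ht
    · intro k
      filter_upwards [ae_restrict_mem (measurableSet_slab s₀ t)] with z hz
      exact Finset.sum_nonneg fun i _ => mul_nonneg (mul_nonneg (nn2 k _ (hpos z (hsub hz)))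
        (sq_nonneg _)) (cutoff_nonneg _ _)
    · filter_upwards [ae_restrict_mem (measurableSet_slab s₀ t)] with z hz
      have hz' := hsub hz
      rcases (hpos z hz').eq_or_lt with h0 | h0
      · simp [fisher, dx_eq_zero_of_eq_zero hpos hz' h0.symm]
      · have l1 : Tendsto (fun k => cutoff (m k) z.2) atTop (𝓝 1) :=
          (tendsto_cutoff z.2).comp hm_top
        have lN : Tendsto N atTop atTop :=
          tendsto_atTop_add_const_right _ _ tendsto_natCast_atTop_atTop
        have l2 : Tendsto (fun k => deriv (deriv (entropyApprox (N k))) (ζ z)) atTop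
            (𝓝 (ζ z)⁻¹) := by
          have e : ∀ k, deriv (deriv (entropyApprox (N k))) (ζ z)
              = (ζ z + (N k)⁻¹)⁻¹ - (ζ z + N k)⁻¹ := fun k => by
            rw [deriv_deriv_entropyApprox (hN1 k) h0.le, one_div, one_div]
          simp only [e]
          have a1 : Tendsto (fun k => (ζ z + (N k)⁻¹)⁻¹) atTop (𝓝 (ζ z + 0)⁻¹) :=
            ((tendsto_inv_atTop_zero.comp lN).const_add (ζ z)).inv₀ (by simpa using h0.ne')
          have a2 : Tendsto (fun k => (ζ z + N k)⁻¹) atTop (𝓝 0) :=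
            tendsto_inv_atTop_zero.comp (tendsto_atTop_add_const_left _ _ lN)
          simpa using a1.sub a2
        have := tendsto_finsetSum (Finset.univ : Finset (Fin d)) fun i _ =>
          (l2.mul_const (dx i ζ z ^ 2)).mul l1
        simpa [fisher, div_eq_inv_mul, Finset.mul_sum] using this
    · intro k
      have hχ := hcut (m k)
      have R := h.renormalized_inequality hφ h0 (convex_Ici 0) (by simp : (0 : ℝ) ∈ Ici 0)
        (fun z hz => hpos z hz) hφ0 (β := entropyApprox (N k)) (L := N k) (C := 1)
        measurable_entropyApprox (fun y hy => contDiffAt_entropyApprox (hN1 k) hy)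
        entropyApprox_zero (fun y hy => abs_deriv_entropyApprox_le (hN1 k) hy)
        (fun y hy => nn2 k y hy)
        (fun y hy => by rw [one_mul, abs_of_nonneg hy]; exact sq2 k y hy) hχ hs₀ hst ht
      have e1 : ∫ x, entropyApprox (N k) (φ x) * cutoff (m k) x ≤ P := by
        have iL : Integrable fun x => φ x + φ x * Real.log (1 + φ x) := hφ.add hφl
        by_cases hi : Integrable fun x => entropyApprox (N k) (φ x) * cutoff (m k) x
        · refine integral_mono hi iL fun x => ?_
          exact (mul_le_mul_of_nonneg_right (entropyApprox_le (hN1 k) (hφ0 x))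
            (cutoff_nonneg _ _)).trans (mul_le_of_le_one_right (hlog0 x) (cutoff_le_one _ _))
        · rw [integral_undef hi]; exact hP0
      have e2 : -∫ x, entropyApprox (N k) (ζ (t, x)) * cutoff (m k) x
          ≤ M * (Q + C₁ * W) + E := by
        have iE := integrable_exp_neg_weight d
        have cβ : Continuous fun x => entropyApprox (N k) (ζ (t, x)) :=
          continuous_slice ((contDiffOn_comp_of_contDiffAt h.smooth fun z hz =>
            contDiffAt_entropyApprox (hN1 k) (hpos z hz)).continuousOn) htT
        calc -∫ x, entropyApprox (N k) (ζ (t, x)) * cutoff (m k) x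
            = ∫ x, -(entropyApprox (N k) (ζ (t, x)) * cutoff (m k) x) := (integral_neg _).symm
          _ ≤ ∫ x, (M * (ζ (t, x) * weight x) + Real.exp (-(M * weight x))) := by
              refine integral_mono ((cβ.mul (contDiff_cutoff _).continuous
                ).integrable_of_hasCompactSupport (hasCompactSupport_cutoff _).mul_left).neg
                ((iM.const_mul M).add iE) fun x => ?_
              have hz0 := hpos (t, x) (mem_slab.2 htT)
              have hw0 := weight_nonneg x
              have a1 := mul_le_mul_of_nonneg_right (neg_entropyApprox_le (hN1 k) hz0
                (mul_nonneg hM0 hw0)) (cutoff_nonneg (m k) x)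
              have a2 : 0 ≤ M * weight x * ζ (t, x) + Real.exp (-(M * weight x)) := by positivity
              have a3 := mul_le_of_le_one_right a2 (cutoff_le_one (m k) x)
              simp only
              linarith
          _ ≤ _ := by
              rw [integral_add (iM.const_mul M) iE, integral_const_mul]
              gcongr
      have e3 : ∫ z in slab τ T, ∑ i, deriv (deriv (entropyApprox (N k))) (ζ z) * ζ z ^ 2
          * b i z ^ 2 * cutoff (m k) z.2 ≤ A := by
        refine integral_mono_of_nonneg ?_ iA ?_
        · filter_upwards [ae_restrict_mem hm] with z hz
          have a1 := nn2 k _ (hpos z hz)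
          have a2 := cutoff_nonneg (m k) z.2
          exact Finset.sum_nonneg fun i _ => by positivity
        · filter_upwards [ae_restrict_mem hm] with z hz
          rw [Finset.mul_sum]
          refine Finset.sum_le_sum fun i _ => ?_
          have a0 := hpos z hz
          have a2 := cutoff_nonneg (m k) z.2
          calc _ ≤ ζ z * b i z ^ 2 * 1 :=
                mul_le_mul (mul_le_mul_of_nonneg_right (sq2 k _ a0) (sq_nonneg _))
                  (cutoff_le_one _ _) a2 (by positivity)
            _ ≤ ζ z * (1 + b i z ^ 2) := by linarith
      have e4 : N k * (C₂ / ((m k : ℝ) + 1)) * W ≤ (C₂ * W) / (k + 1) := by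
        have hW0 : 0 ≤ W := integral_nonneg fun z => Finset.sum_nonneg fun i _ => by positivity
        have : N k * (C₂ / ((m k : ℝ) + 1)) ≤ C₂ / (k + 1) := by
          rw [← mul_div_assoc, div_le_div_iff₀ (by positivity) (by positivity)]
          simp only [hN, hmdef]; push_cast
          nlinarith
        calc _ ≤ C₂ / (k + 1) * W := by gcongr
          _ = _ := by ring
      have e5 : 2 * (C₂ * W) / ((k : ℝ) + 1) = 2 * ((C₂ * W) / (k + 1)) := by ring
      linarith
    · simpa using (tendsto_const_div_succ (2 * (C₂ * W))).const_add
        (2 * (P + (M * (Q + C₁ * W) + E) + 1 / 2 * A))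
  -- exhaust the slab
  have final := integrable_and_integral_le_of_tendsto (μ := volume.restrict (slab τ T))
    (F := fun k : ℕ => (slab (τ + (T - τ) / 2 / (k + 1)) (T - (T - τ) / 2 / (k + 1))).indicator
      (fisher ζ)) (G := fisher ζ)
    (a := fun _ => 2 * (P + (M * (Q + C₁ * W) + E) + 1 / 2 * A))
    (A := 2 * (P + (M * (Q + C₁ * W) + E) + 1 / 2 * A)) ?_ ?_ ?_ ?_ tendsto_const_nhds
  · refine ⟨final.1, final.2.trans ?_⟩
    have h1 : M * (C₁ * W) ≤ M * (C₁ * (2 * A)) := by gcongr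
    have h2 : 0 ≤ M * C₁ := by positivity
    nlinarith [mul_nonneg hM0 hP0, mul_nonneg hM0 hA0, mul_nonneg hE0 hP0, mul_nonneg hE0 hA0,
      mul_nonneg hE0 hQ0, mul_nonneg h2 hP0, mul_nonneg h2 hQ0, mul_nonneg h2 hA0]
  · intro k
    have hδ : 0 < (T - τ) / 2 / ((k : ℝ) + 1) := div_pos (by linarith) (by positivity)
    have hδ2 : (T - τ) / 2 / ((k : ℝ) + 1) ≤ (T - τ) / 2 :=
      div_le_self (by linarith) (by linarith [(Nat.cast_nonneg k : (0 : ℝ) ≤ k)])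
    exact ((inner _ _ (by linarith) (by linarith) (by linarith)).1.integrable_indicator
      (measurableSet_slab _ _)).restrict
  · intro k
    have hδ : 0 < (T - τ) / 2 / ((k : ℝ) + 1) := div_pos (by linarith) (by positivity)
    filter_upwards [ae_restrict_mem hm] with z hz
    exact indicator_nonneg (fun w hw => fisher_nonneg hpos
      (slab_subset (by linarith) (by linarith) hw)) z
  · filter_upwards [ae_restrict_mem hm] with z hz
    obtain ⟨hz1, hz2⟩ := mem_slab.1 hz
    have hlim := tendsto_const_div_succ ((T - τ) / 2)
    refine tendsto_const_nhds.congr' ?_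
    filter_upwards [hlim.eventually_lt_const (sub_pos.2 hz1),
      hlim.eventually_lt_const (sub_pos.2 hz2)] with k h1 h2
    rw [indicator_of_mem]
    exact mem_slab.2 ⟨by linarith, by linarith⟩
  · intro k
    have hδ : 0 < (T - τ) / 2 / ((k : ℝ) + 1) := div_pos (by linarith) (by positivity)
    have hδ2 : (T - τ) / 2 / ((k : ℝ) + 1) ≤ (T - τ) / 2 :=
      div_le_self (by linarith) (by linarith [(Nat.cast_nonneg k : (0 : ℝ) ≤ k)])
    rw [setIntegral_indicator (measurableSet_slab _ _),
      inter_eq_self_of_subset_right (slab_subset (by linarith) (by linarith))]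
    exact (inner _ _ (by linarith) (by linarith) (by linarith)).2

end MFG

end

noncomputable section

namespace MFG

variable {d : ℕ}

/-! ### Interpolation by the Fisher information -/

theorem gradient_apply (w : Space d → ℝ) (x : Space d) (i : Fin d) : ∇ w x i = pd i w x := by
  have h := inner_gradient_left (𝕜 := ℝ) (f := w) (x := x) (y := EuclideanSpace.single i (1 : ℝ))
  rw [EuclideanSpace.inner_single_right] at h
  simpa [pd] using h

theorem norm_fderiv_sq (w : Space d → ℝ) (x : Space d) :
    ‖fderiv ℝ w x‖ ^ 2 = ∑ i, pd i w x ^ 2 := by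
  rw [← toDual_gradient, LinearIsometryEquiv.norm_map, EuclideanSpace.real_norm_sq_eq]
  simp [gradient_apply]

/-- The regularized and truncated square root of a density is smooth, and its gradient is
controlled by the Fisher information. -/
theorem norm_fderiv_sqrt_mul_cutoff_sq_le {v χ : Space d → ℝ} {κ ε : ℝ} (hv : ContDiff ℝ ∞ v)
    (hv0 : ∀ x, 0 ≤ v x) (hε : 0 < ε) (hχ : TestFunction χ κ) (hχ1 : ∀ x, χ x ≤ 1) :
    ContDiff ℝ ∞ (fun x => (√(v x + ε) - √ε) * χ x) ∧
    ∀ x, ‖fderiv ℝ (fun x => (√(v x + ε) - √ε) * χ x) x‖ ^ 2 ≤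
      (∑ i, pd i v x ^ 2) / v x + 2 * d * κ ^ 2 * v x := by
  have hpos : ∀ x, 0 < v x + ε := fun x => by linarith [hv0 x]
  have hs : ContDiff ℝ ∞ fun x => √(v x + ε) - √ε :=
    ((hv.add contDiff_const).sqrt fun x => (hpos x).ne').sub contDiff_const
  refine ⟨hs.mul hχ.smooth, fun x => ?_⟩
  have hD : ∀ i, pd i (fun x => √(v x + ε) - √ε) x = 1 / (2 * √(v x + ε)) * pd i v x := by
    intro i
    have : HasDerivAt (fun r => √(r + ε) - √ε) (1 / (2 * √(v x + ε))) (v x) := by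
      simpa using ((((hasDerivAt_id (v x)).add_const ε).sqrt (hpos x).ne').sub_const √ε)
    exact pd_real_comp this (hv.differentiable (by simp) x) i
  have hr : 0 < √(v x + ε) := Real.sqrt_pos.2 (hpos x)
  have hr2 : √(v x + ε) ^ 2 = v x + ε := Real.sq_sqrt (hpos x).le
  have he2 : √ε ^ 2 = ε := Real.sq_sqrt hε.le
  have hle : √ε ≤ √(v x + ε) := Real.sqrt_le_sqrt (by linarith [hv0 x])
  have hsq : (√(v x + ε) - √ε) ^ 2 ≤ v x := by
    nlinarith [Real.sqrt_nonneg ε]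
  rw [norm_fderiv_sq]
  have e : ∀ i, pd i (fun x => (√(v x + ε) - √ε) * χ x) x ^ 2 ≤
      pd i v x ^ 2 / v x + 2 * κ ^ 2 * v x := by
    intro i
    rw [pd_mul hs hχ.smooth, hD]
    have a1 : (1 / (2 * √(v x + ε)) * pd i v x * χ x) ^ 2 ≤ 1 / 4 * (pd i v x ^ 2 / v x) := by
      have b1 : (1 / (2 * √(v x + ε)) * pd i v x) ^ 2 = 1 / 4 * (pd i v x ^ 2 / (v x + ε)) := by
        rw [mul_pow, div_pow, mul_pow, hr2]; field_simp; ring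
      have b2 : pd i v x ^ 2 / (v x + ε) ≤ pd i v x ^ 2 / v x := by
        rcases (hv0 x).eq_or_lt with h0 | h0
        · have : IsLocalMin v x := Eventually.of_forall fun y => h0 ▸ hv0 y
          simp [pd, this.fderiv_eq_zero]
        · exact div_le_div_of_nonneg_left (sq_nonneg _) h0 (by linarith)
      have b3 : χ x ^ 2 ≤ 1 := pow_le_one₀ (hχ.nonneg x) (hχ1 x)
      rw [mul_pow, b1]
      have b4 : 0 ≤ pd i v x ^ 2 / (v x + ε) := div_nonneg (sq_nonneg _) (hpos x).le
      nlinarith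
    have a2 : ((√(v x + ε) - √ε) * pd i χ x) ^ 2 ≤ v x * κ ^ 2 := by
      rw [mul_pow, ← sq_abs (pd i χ x)]
      exact mul_le_mul hsq (pow_le_pow_left₀ (abs_nonneg _) (hχ.first i x) 2) (sq_nonneg _)
        (hv0 x)
    have a3 : 0 ≤ pd i v x ^ 2 / v x := div_nonneg (sq_nonneg _) (hv0 x)
    nlinarith [sq_nonneg (1 / (2 * √(v x + ε)) * pd i v x * χ x
      - (√(v x + ε) - √ε) * pd i χ x)]
  refine (Finset.sum_le_sum fun i _ => e i).trans_eq ?_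
  rw [Finset.sum_add_distrib, Finset.sum_div]
  simp; ring

/-- The Sobolev inequality for the square root of a density `v`: the norm of `v` in
`L^(d/(d-2))` is bounded by its Fisher information. -/
theorem exists_sobolev_fisher (hd : 2 < d) : ∃ K : ℝ≥0, ∀ v : Space d → ℝ, ContDiff ℝ ∞ v →
    (∀ x, 0 ≤ v x) → Integrable v →
    ∫⁻ x, ENNReal.ofReal (v x) ^ ((d : ℝ) / (d - 2)) ≤
      (K * ∫⁻ x, ENNReal.ofReal ((∑ i, pd i v x ^ 2) / v x)) ^ ((d : ℝ) / (d - 2)) := by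
  have hd' : (2 : ℝ) < d := by exact_mod_cast hd
  have hd2 : (0 : ℝ) < d - 2 := by linarith
  set q : ℝ := (d : ℝ) / (d - 2) with hq
  have hq0 : 0 < q := by positivity
  -- the Sobolev inequality is applied to the functions `w n`, which approximate `√v`
  set S : ℝ≥0 := SNormLESNormFDerivOfEqConst ℝ (volume : Measure (Space d)) (2 : ℝ≥0) with hS
  obtain ⟨C, hC0, hC⟩ := exists_testFunction_cutoff d
  refine ⟨S ^ 2, fun v hv hv0 hvi => ?_⟩
  set J := ∫⁻ x, ENNReal.ofReal ((∑ i, pd i v x ^ 2) / v x) with hJ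
  set V := ∫⁻ x, ENNReal.ofReal (v x) with hV
  have hVtop : V ≠ ⊤ := hvi.lintegral_lt_top.ne
  set ε : ℕ → ℝ := fun n => 1 / ((n : ℝ) + 1) with hε
  have hε0 : ∀ n, 0 < ε n := fun n => by positivity
  set w : ℕ → Space d → ℝ := fun n x => (√(v x + ε n) - √(ε n)) * cutoff n x with hw
  set k : ℕ → ℝ := fun n => 2 * d * (C / ((n : ℝ) + 1)) ^ 2 with hk
  have hk0 : ∀ n, 0 ≤ k n := fun n => by positivity
  have hwd := fun n => norm_fderiv_sqrt_mul_cutoff_sq_le hv hv0 (hε0 n) (hC n) (cutoff_le_one n)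
  have step : ∀ n, ∫⁻ x, ‖w n x‖ₑ ^ (2 * q) ≤
      ((S : ℝ≥0∞) ^ 2 * (J + ENNReal.ofReal (k n) * V)) ^ q := by
    intro n
    obtain ⟨P, hP⟩ : ∃ P : ℝ≥0, (P : ℝ) = 2 * q := ⟨⟨2 * q, by positivity⟩, rfl⟩
    have hP0 : P ≠ 0 := fun h => by
      rw [h, NNReal.coe_zero] at hP
      linarith
    have gns := eLpNorm_le_eLpNorm_fderiv_of_eq (volume : Measure (Space d)) (u := w n)
      ((hwd n).1.of_le (by simp)) (hasCompactSupport_cutoff n).mul_left (p := 2) (p' := P)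
      (by norm_num) (by simp; omega) (by
        simp only [hP, finrank_euclideanSpace, Fintype.card_fin, NNReal.coe_inv,
          NNReal.coe_ofNat, hq]
        field_simp)
    rw [eLpNorm_nnreal_eq_lintegral hP0, eLpNorm_nnreal_eq_lintegral two_ne_zero] at gns
    have hfd : ∫⁻ x, ‖fderiv ℝ (w n) x‖ₑ ^ (2 : ℝ) ≤ J + ENNReal.ofReal (k n) * V := by
      rw [hJ, hV, ← lintegral_const_mul' _ _ ENNReal.ofReal_ne_top,
        ← lintegral_add_right' _ (hvi.aestronglyMeasurable.aemeasurable.ennreal_ofReal.const_mul _)]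
      refine lintegral_mono fun x => ?_
      rw [← ofReal_norm, ENNReal.ofReal_rpow_of_nonneg (norm_nonneg _) (by norm_num),
        ← ENNReal.ofReal_mul (hk0 n), ← ENNReal.ofReal_add
          (div_nonneg (Finset.sum_nonneg fun i _ => sq_nonneg _) (hv0 x))
          (mul_nonneg (hk0 n) (hv0 x)), Real.rpow_two]
      exact ENNReal.ofReal_le_ofReal ((hwd n).2 x)
    have e1 := ENNReal.rpow_le_rpow gns (z := 2 * q) (by positivity)
    rw [← ENNReal.rpow_mul] at e1
    have e2 : (1 / (P : ℝ)) * (2 * q) = 1 := by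
      rw [hP]; field_simp
    rw [e2, ENNReal.rpow_one, hP] at e1
    refine e1.trans ?_
    rw [ENNReal.rpow_mul, ENNReal.mul_rpow_of_nonneg _ _ (by norm_num : (0 : ℝ) ≤ 2),
      ← ENNReal.rpow_mul]
    refine ENNReal.rpow_le_rpow ?_ hq0.le
    have e3 : 1 / ((2 : ℝ≥0) : ℝ) * 2 = 1 := by norm_num
    rw [e3, ENNReal.rpow_one, ENNReal.rpow_two]
    gcongr
    exact hfd
  -- the error term vanishes in the limit, and Fatou's lemma applies to the left-hand sides
  have lim : Tendsto (fun n => ((S : ℝ≥0∞) ^ 2 * (J + ENNReal.ofReal (k n) * V)) ^ q) atTop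
      (𝓝 (((S ^ 2 : ℝ≥0) * J) ^ q)) := by
    have l1 : Tendsto k atTop (𝓝 0) := by
      simpa [hk] using ((tendsto_const_div_succ C).pow 2).const_mul (2 * (d : ℝ))
    have l2 : Tendsto (fun n => ENNReal.ofReal (k n) * V) atTop (𝓝 0) := by
      simpa using ENNReal.Tendsto.mul_const (ENNReal.tendsto_ofReal l1) (Or.inr hVtop)
    have l3 : Tendsto (fun n => J + ENNReal.ofReal (k n) * V) atTop (𝓝 J) := by
      simpa using l2.const_add J
    have l4 := ENNReal.Tendsto.const_mul (a := (S : ℝ≥0∞) ^ 2) l3 (Or.inr (by finiteness))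
    push_cast
    exact (ENNReal.continuous_rpow_const.tendsto _).comp l4
  calc ∫⁻ x, ENNReal.ofReal (v x) ^ q
      = ∫⁻ x, liminf (fun n => ‖w n x‖ₑ ^ (2 * q)) atTop := by
        refine lintegral_congr fun x => ?_
        have l1 : Tendsto (fun n => w n x) atTop (𝓝 √(v x)) := by
          have h0 : Tendsto ε atTop (𝓝 0) := tendsto_const_div_succ 1
          have h1 : Tendsto (fun n => √(v x + ε n)) atTop (𝓝 √(v x + 0)) :=
            (Real.continuous_sqrt.tendsto _).comp (h0.const_add (v x))
          have h2 : Tendsto (fun n => √(ε n)) atTop (𝓝 √0) :=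
            (Real.continuous_sqrt.tendsto _).comp h0
          simpa using (h1.sub h2).mul (tendsto_cutoff x)
        have l2 : Tendsto (fun n => ‖w n x‖ₑ ^ (2 * q)) atTop (𝓝 (‖√(v x)‖ₑ ^ (2 * q))) :=
          (ENNReal.continuous_rpow_const.tendsto _).comp l1.enorm
        rw [l2.liminf_eq, ENNReal.rpow_mul, ← ofReal_norm,
          Real.norm_of_nonneg (Real.sqrt_nonneg _), ENNReal.rpow_two,
          ← ENNReal.ofReal_pow (Real.sqrt_nonneg _), Real.sq_sqrt (hv0 x)]
    _ ≤ liminf (fun n => ∫⁻ x, ‖w n x‖ₑ ^ (2 * q)) atTop :=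
        lintegral_liminf_le fun n => ((hwd n).1.continuous.enorm.measurable.pow_const _)
    _ ≤ liminf (fun n => ((S : ℝ≥0∞) ^ 2 * (J + ENNReal.ofReal (k n) * V)) ^ q) atTop :=
        liminf_le_liminf (Eventually.of_forall step)
    _ = _ := lim.liminf_eq

/-- Hölder's inequality with four factors, in the form which interpolates the norm of a density
`v` between its mass and its norm in `L^(d/(d-2))`. -/
theorem lintegral_mul_sqrt_le {α : Type*} [MeasurableSpace α] {μ : Measure α} {f v J : α → ℝ≥0∞}
    (hf : AEMeasurable f μ) (hv : AEMeasurable v μ) (hJ : AEMeasurable J μ) {a D : ℝ}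
    (hD : 2 < D) (ha : D ≤ a) {m K : ℝ≥0∞} (hm : ∫⁻ x, v x ∂μ ≤ m)
    (hK : ∫⁻ x, v x ^ (D / (D - 2)) ∂μ ≤ (K * ∫⁻ x, J x ∂μ) ^ (D / (D - 2))) :
    ∫⁻ x, f x * (v x ^ (1 / 2 : ℝ) * J x ^ (1 / 2 : ℝ)) ∂μ ≤
      (∫⁻ x, f x ^ a ∂μ) ^ (1 / a) * (m ^ ((1 - D / a) / 2) * K ^ (D / a / 2))
        * (∫⁻ x, J x ∂μ) ^ ((1 + D / a) / 2) := by
  have ha0 : 0 < a := by linarith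
  have hD2 : 0 < D - 2 := by linarith
  have hl1 : D / a ≤ 1 := (div_le_one ha0).2 ha
  have hl0 : 0 < D / a := by positivity
  -- the exponents sum to `1`; the second and the third factor both come from `v ^ (1 / 2)`
  have H := ENNReal.lintegral_prod_norm_pow_le (μ := μ) (Finset.univ : Finset (Fin 4))
    (f := ![fun x => f x ^ a, v, fun x => v x ^ (D / (D - 2)), J])
    (p := ![1 / a, (1 - D / a) / 2, (D - 2) / (2 * a), 1 / 2])
    (by
      intro i _
      fin_cases i
      · exact hf.pow_const a
      · exact hv
      · exact hv.pow_const _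
      · exact hJ)
    (by simp [Fin.sum_univ_four]; field_simp; ring)
    (by
      intro i _
      fin_cases i
      · simp; positivity
      · simp; linarith
      · simp; positivity
      · simp)
  simp only [Fin.prod_univ_four, Matrix.cons_val_zero, Matrix.cons_val_one, Matrix.cons_val] at H
  have e1 : ∀ x, f x * (v x ^ (1 / 2 : ℝ) * J x ^ (1 / 2 : ℝ)) =
      (f x ^ a) ^ (1 / a) * v x ^ ((1 - D / a) / 2) * (v x ^ (D / (D - 2))) ^ ((D - 2) / (2 * a))
        * J x ^ (1 / 2 : ℝ) := by
    intro x
    rw [← ENNReal.rpow_mul, ← ENNReal.rpow_mul, mul_one_div_cancel ha0.ne', ENNReal.rpow_one,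
      mul_assoc (f x), ← ENNReal.rpow_add_of_nonneg _ _ (by linarith) (by positivity), mul_assoc]
    congr 3
    field_simp
    ring
  simp only [e1]
  refine H.trans ?_
  calc _ ≤ (∫⁻ x, f x ^ a ∂μ) ^ (1 / a) * m ^ ((1 - D / a) / 2)
        * ((K * ∫⁻ x, J x ∂μ) ^ (D / (D - 2))) ^ ((D - 2) / (2 * a))
        * (∫⁻ x, J x ∂μ) ^ (1 / 2 : ℝ) := by
        gcongr
    _ = (∫⁻ x, f x ^ a ∂μ) ^ (1 / a) * m ^ ((1 - D / a) / 2)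
        * (K ^ (D / a / 2) * (∫⁻ x, J x ∂μ) ^ (D / a / 2))
        * (∫⁻ x, J x ∂μ) ^ (1 / 2 : ℝ) := by
        rw [← ENNReal.rpow_mul, ← ENNReal.mul_rpow_of_nonneg _ _ (by positivity)]
        congr 3
        field_simp
    _ = _ := by
        rw [show (1 + D / a) / 2 = D / a / 2 + 1 / 2 by ring,
          ENNReal.rpow_add_of_nonneg _ _ (by positivity) (by norm_num)]
        ring

theorem restrict_slab (s t : ℝ) : (volume.restrict (slab s t) : Measure (ℝ × Space d)) =
    (volume.restrict (Ioo s t)).prod volume := by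
  rw [slab, Measure.volume_eq_prod, ← Measure.prod_restrict, Measure.restrict_univ]

theorem mixedNorm_eq {c a s t : ℝ} (ha : 0 < a) (f : ℝ → Space d → ℝ) :
    mixedNorm c a s t f =
      (∫⁻ r in Ioo s t, ((∫⁻ x, ‖f r x‖ₑ ^ a) ^ (1 / a)) ^ c) ^ (1 / c) := by
  rw [mixedNorm]
  congr 1
  refine lintegral_congr fun r => ?_
  rw [eLpNorm_eq_lintegral_rpow_enorm_toReal (by simpa using ha) ENNReal.ofReal_ne_top,
    ENNReal.toReal_ofReal ha.le]

theorem aemeasurable_lintegral_slice {s t a : ℝ} {f : ℝ × Space d → ℝ}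
    (hf : ContinuousOn f (slab s t)) :
    AEMeasurable (fun r => ∫⁻ x, ‖f (r, x)‖ₑ ^ a) (volume.restrict (Ioo s t)) := by
  refine AEMeasurable.lintegral_prod_right' (f := fun z : ℝ × Space d => ‖f z‖ₑ ^ a) ?_
  rw [← restrict_slab]
  exact (hf.aestronglyMeasurable (measurableSet_slab s t)).enorm.pow_const a

/-- The integral of `f |Dζ|` is controlled by a mixed norm of `f` and by the mass and the Fisher
information of `ζ`. -/
theorem exists_lintegral_mul_gradient_le (hd : 2 < d) {a c : ℝ} (hc : 2 < c)
    (ha : c * d / (c - 2) ≤ a) (m : ℝ≥0) : ∃ K : ℝ≥0,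
    ∀ {τ T : ℝ} {ζ f : ℝ × Space d → ℝ}, ContDiffOn ℝ ∞ ζ (slab τ T) →
      (∀ z ∈ slab τ T, 0 ≤ ζ z) →
      (∀ t ∈ Ioo τ T, Integrable (fun x => ζ (t, x)) ∧ ∫ x, ζ (t, x) ≤ m) →
      ContinuousOn f (slab τ T) →
      ∫⁻ z in slab τ T, ‖f z‖ₑ * ENNReal.ofReal √(∑ i, dx i ζ z ^ 2) ≤
        K * mixedNorm c a τ T (fun t x => f (t, x)) *
          (ENNReal.ofReal (T - τ) + ∫⁻ z in slab τ T, ENNReal.ofReal (fisher ζ z))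
            ^ (1 - 1 / c) := by
  have hd' : (2 : ℝ) < d := by exact_mod_cast hd
  have hc2 : 0 < c - 2 := by linarith
  have hc0 : 0 < c := by linarith
  -- the condition on the exponents, in the form in which it is used
  have hda : (d : ℝ) / a ≤ 1 - 2 / c := by
    have ha0 : 0 < a := lt_of_lt_of_le (by positivity) ha
    rw [div_le_iff₀ hc2] at ha
    rw [div_le_iff₀ ha0, one_sub_div hc0.ne', div_mul_eq_mul_div, le_div_iff₀ hc0]
    linarith
  have hada : (d : ℝ) ≤ a := by
    refine le_trans ?_ ha
    rw [le_div_iff₀ hc2]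
    nlinarith
  have ha0 : 0 < a := by linarith
  have hl1 : (d : ℝ) / a ≤ 1 := (div_le_one ha0).2 hada
  have hl0 : 0 < (d : ℝ) / a := by positivity
  obtain ⟨K, hK⟩ := exists_sobolev_fisher hd
  refine ⟨m ^ ((1 - d / a) / 2) * K ^ ((d : ℝ) / a / 2),
    fun {τ T ζ f} hζ hζ0 hmass hf => ?_⟩
  set M : ℝ≥0∞ := ((m ^ ((1 - d / a) / 2) * K ^ ((d : ℝ) / a / 2) : ℝ≥0) : ℝ≥0∞) with hM
  have hM' : M = (m : ℝ≥0∞) ^ ((1 - d / a) / 2) * (K : ℝ≥0∞) ^ ((d : ℝ) / a / 2) := by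
    rw [hM, ENNReal.coe_mul, ENNReal.coe_rpow_of_nonneg _ (by linarith),
      ENNReal.coe_rpow_of_nonneg _ (by positivity)]
  have hO := isOpen_slab (d := d) τ T
  have hms := measurableSet_slab (d := d) τ T
  have hfm : AEMeasurable (fun z => ‖f z‖ₑ) (volume.restrict (slab τ T)) :=
    (hf.aestronglyMeasurable hms).enorm
  have hζm : AEMeasurable ζ (volume.restrict (slab τ T)) :=
    (hζ.continuousOn.aestronglyMeasurable hms).aemeasurable
  have hgm : ContinuousOn (fun z => ∑ i, dx i ζ z ^ 2) (slab τ T) :=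
    continuousOn_finsetSum _ fun i _ => (contDiffOn_dx hO hζ i).continuousOn.pow 2
  have hJm : AEMeasurable (fisher ζ) (volume.restrict (slab τ T)) :=
    (hgm.aestronglyMeasurable hms).aemeasurable.div hζm
  set I : ℝ → ℝ≥0∞ := fun t => ∫⁻ x, ENNReal.ofReal (fisher ζ (t, x)) with hI
  set G : ℝ → ℝ≥0∞ := fun t => (∫⁻ x, ‖f (t, x)‖ₑ ^ a) ^ (1 / a) with hG
  have hIm : AEMeasurable I (volume.restrict (Ioo τ T)) := by
    refine AEMeasurable.lintegral_prod_right'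
      (f := fun z : ℝ × Space d => ENNReal.ofReal (fisher ζ z)) ?_
    rw [← restrict_slab]; exact hJm.ennreal_ofReal
  have hGm : AEMeasurable G (volume.restrict (Ioo τ T)) :=
    (aemeasurable_lintegral_slice hf).pow_const _
  -- the estimate on a time slice
  have slice : ∀ t ∈ Ioo τ T, ∫⁻ x, ‖f (t, x)‖ₑ * ENNReal.ofReal √(∑ i, dx i ζ (t, x) ^ 2) ≤
      M * ((G t ^ c) ^ (1 / c) * (1 + I t) ^ (1 - 1 / c)) := by
    intro t ht
    have hv : ContDiff ℝ ∞ fun x => ζ (t, x) := by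
      rw [← contDiffOn_univ]
      exact hζ.comp (contDiff_prodMk_right t).contDiffOn fun x _ => mem_slab.2 ht
    have hv0 : ∀ x, 0 ≤ ζ (t, x) := fun x => hζ0 _ (mem_slab.2 ht)
    have epd : ∀ i x, pd i (fun x => ζ (t, x)) x = dx i ζ (t, x) := fun i x =>
      fderiv_slice (differentiableAt_of_contDiffOn hO hζ (mem_slab.2 ht)) i
    have eJ : ∀ x, (∑ i, pd i (fun x => ζ (t, x)) x ^ 2) / ζ (t, x) = fisher ζ (t, x) := fun x => by
      simp only [epd, fisher]
    have sob := hK _ hv hv0 (hmass t ht).1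
    simp only [eJ] at sob
    have hm1 : ∫⁻ x, ENNReal.ofReal (ζ (t, x)) ≤ m := by
      rw [← ofReal_integral_eq_lintegral_ofReal (hmass t ht).1 (ae_of_all _ hv0),
        ← ENNReal.ofReal_coe_nnreal]
      exact ENNReal.ofReal_le_ofReal (hmass t ht).2
    have c1 : Continuous fun x => f (t, x) := continuous_slice hf ht
    have mJ : Measurable fun x => fisher ζ (t, x) :=
      (continuous_slice hgm ht).measurable.div hv.continuous.measurable
    have H := lintegral_mul_sqrt_le (μ := (volume : Measure (Space d))) (a := a) (D := d)
      c1.enorm.measurable.aemeasurable hv.continuous.measurable.ennreal_ofReal.aemeasurable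
      mJ.ennreal_ofReal.aemeasurable hd' hada hm1 sob
    rw [← hM'] at H
    have e1 : ∀ x, ENNReal.ofReal √(∑ i, dx i ζ (t, x) ^ 2) =
        ENNReal.ofReal (ζ (t, x)) ^ (1 / 2 : ℝ) * ENNReal.ofReal (fisher ζ (t, x)) ^ (1 / 2 : ℝ) := by
      intro x
      rw [sum_dx_sq_eq_fisher_mul (z := (t, x)) hζ0 (mem_slab.2 ht), mul_comm,
        ← ENNReal.mul_rpow_of_nonneg _ _ (by norm_num), ← ENNReal.ofReal_mul (hv0 x),
        ENNReal.ofReal_rpow_of_nonneg (mul_nonneg (hv0 x)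
          (fisher_nonneg (z := (t, x)) hζ0 (mem_slab.2 ht))) (by norm_num), Real.sqrt_eq_rpow]
    simp only [e1]
    refine H.trans ?_
    rw [mul_comm _ M, mul_assoc, ← ENNReal.rpow_mul (G t), mul_one_div_cancel hc0.ne',
      ENNReal.rpow_one]
    gcongr
    have hexp : (1 + (d : ℝ) / a) / 2 ≤ 1 - 1 / c := by
      have : 2 / c = 2 * (1 / c) := by ring
      linarith
    exact (ENNReal.rpow_le_rpow le_add_self (by positivity)).trans
      (ENNReal.rpow_le_rpow_of_exponent_le le_self_add hexp)
  have tonelli : ∫⁻ z in slab τ T, ENNReal.ofReal (fisher ζ z) = ∫⁻ t in Ioo τ T, I t := by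
    rw [restrict_slab, lintegral_prod]
    rw [← restrict_slab]; exact hJm.ennreal_ofReal
  have h1c : 0 ≤ 1 - 1 / c := by
    rw [sub_nonneg, div_le_one hc0]; linarith
  calc ∫⁻ z in slab τ T, ‖f z‖ₑ * ENNReal.ofReal √(∑ i, dx i ζ z ^ 2)
      = ∫⁻ t in Ioo τ T, ∫⁻ x, ‖f (t, x)‖ₑ * ENNReal.ofReal √(∑ i, dx i ζ (t, x) ^ 2) := by
        rw [restrict_slab, lintegral_prod]
        rw [← restrict_slab]
        exact hfm.mul (hgm.aestronglyMeasurable hms).aemeasurable.sqrt.ennreal_ofReal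
    _ ≤ ∫⁻ t in Ioo τ T, M * ((G t ^ c) ^ (1 / c) * (1 + I t) ^ (1 - 1 / c)) :=
        setLIntegral_mono_ae' measurableSet_Ioo (ae_of_all _ slice)
    _ = M * ∫⁻ t in Ioo τ T, (G t ^ c) ^ (1 / c) * (1 + I t) ^ (1 - 1 / c) :=
        lintegral_const_mul' _ _ ENNReal.coe_ne_top
    _ ≤ M * ((∫⁻ t in Ioo τ T, G t ^ c) ^ (1 / c)
          * (∫⁻ t in Ioo τ T, (1 + I t)) ^ (1 - 1 / c)) := by
        gcongr
        exact ENNReal.lintegral_mul_norm_pow_le (hGm.pow_const c) (hIm.const_add 1)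
          (by positivity) h1c (by ring)
    _ = _ := by
        rw [mixedNorm_eq ha0, lintegral_add_left measurable_const, setLIntegral_one,
          Real.volume_Ioo, tonelli, mul_assoc]

end MFG

end

noncomputable section

namespace MFG

variable {d : ℕ}

/-! ### The heat kernel and one-sided bounds -/

/-- The heat kernel with pole `(σ, x₀)`, without the factor `(4π)^(-d/2)`. -/
def heat (σ : ℝ) (x₀ : Space d) (z : ℝ × Space d) : ℝ :=
  Real.exp (-(d / 2) * Real.log (z.1 - σ) - ‖z.2 - x₀‖ ^ 2 / (4 * (z.1 - σ)))

section heat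

variable {σ τ T : ℝ} {x₀ : Space d}

theorem heat_pos (z : ℝ × Space d) : 0 < heat σ x₀ z := Real.exp_pos _

theorem contDiffOn_heat_exponent (hσ : σ ≤ τ) : ContDiffOn ℝ ∞ (fun z : ℝ × Space d =>
    -(d / 2 : ℝ) * Real.log (z.1 - σ) - ‖z.2 - x₀‖ ^ 2 / (4 * (z.1 - σ))) (slab τ T) := by
  have h1 : ∀ z ∈ (slab τ T : Set (ℝ × Space d)), z.1 - σ ≠ 0 := fun z hz => by
    have := (mem_slab.1 hz).1
    exact (by linarith : 0 < z.1 - σ).ne'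
  have h2 : ContDiffOn ℝ ∞ (fun z : ℝ × Space d => z.1 - σ) (slab τ T) :=
    (contDiff_fst.sub contDiff_const).contDiffOn
  have h3 : ContDiffOn ℝ ∞ (fun z : ℝ × Space d => ‖z.2 - x₀‖ ^ 2) (slab τ T) :=
    ((contDiff_snd.sub contDiff_const).norm_sq ℝ).contDiffOn
  exact (contDiffOn_const.mul (h2.log h1)).sub
    (h3.div (contDiffOn_const.mul h2) fun z hz => mul_ne_zero (by norm_num) (h1 z hz))

theorem contDiffOn_heat (hσ : σ ≤ τ) : ContDiffOn ℝ ∞ (heat σ x₀) (slab τ T) :=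
  (contDiffOn_heat_exponent hσ).exp

theorem pd_norm_sub_sq (i : Fin d) (x : Space d) :
    pd i (fun y : Space d => ‖y - x₀‖ ^ 2) x = 2 * (x i - x₀ i) := by
  have h1 : HasFDerivAt (fun y : Space d => y - x₀) (ContinuousLinearMap.id ℝ (Space d)) x :=
    (hasFDerivAt_id x).sub_const x₀
  have h := ((hasStrictFDerivAt_norm_sq (x - x₀)).hasFDerivAt).comp x h1
  have e : fderiv ℝ (fun y : Space d => ‖y - x₀‖ ^ 2) x = _ := h.fderiv
  simp [pd, e, EuclideanSpace.inner_single_right]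

theorem dx_heat (hσ : σ ≤ τ) (i : Fin d) : ∀ z ∈ slab τ T,
    dx i (heat σ x₀) z = heat σ x₀ z * (-(1 / (2 * (z.1 - σ))) * (z.2 i - x₀ i)) := by
  rintro ⟨t, x⟩ hz
  have hd := differentiableAt_of_contDiffOn (isOpen_slab τ T)
    (contDiffOn_heat_exponent (x₀ := x₀) hσ) hz
  have h := dx_comp (β := Real.exp) Real.differentiableAt_exp hd i
  rw [Real.deriv_exp] at h
  refine h.trans ?_
  rw [← fderiv_slice hd]
  have e : pd i (fun y : Space d => -(d / 2 : ℝ) * Real.log (t - σ)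
      - ‖y - x₀‖ ^ 2 / (4 * (t - σ))) x = -(1 / (4 * (t - σ))) * (2 * (x i - x₀ i)) := by
    rw [← pd_norm_sub_sq]
    refine pd_real_comp (f := fun r => -(d / 2 : ℝ) * Real.log (t - σ) - r / (4 * (t - σ)))
      (g := fun y => ‖y - x₀‖ ^ 2) ?_
      (((contDiff_id.sub contDiff_const).norm_sq ℝ (n := 1)).differentiable (by simp) x) i
    exact ((hasDerivAt_id' _).div_const _).const_sub _
  have hr : t - σ ≠ 0 := by
    have := (mem_slab.1 hz).1
    exact (by simp only at this; linarith : 0 < t - σ).ne'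
  have e' : -(1 / (4 * (t - σ))) * (2 * (x i - x₀ i)) = -(1 / (2 * (t - σ))) * (x i - x₀ i) := by
    field_simp; norm_num
  rw [pd] at e
  rw [e, e', heat]

theorem dt_heat (hσ : σ ≤ τ) : ∀ z ∈ slab τ T, dt (heat σ x₀) z =
    heat σ x₀ z * (-(d / 2) * (1 / (z.1 - σ)) + ‖z.2 - x₀‖ ^ 2 / (4 * (z.1 - σ) ^ 2)) := by
  rintro ⟨t, x⟩ hz
  have hr : t - σ ≠ 0 := by
    have := (mem_slab.1 hz).1
    exact (by simp only at this; linarith : 0 < t - σ).ne'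
  have hd := differentiableAt_of_contDiffOn (isOpen_slab τ T) (contDiffOn_heat (x₀ := x₀) hσ) hz
  have h1 : HasDerivAt (fun r : ℝ => r - σ) 1 t := (hasDerivAt_id' t).sub_const σ
  have h2 := (((h1.log hr).const_mul (-(d / 2 : ℝ))).fun_sub
    ((hasDerivAt_const t (‖x - x₀‖ ^ 2)).fun_div (h1.const_mul 4)
      (mul_ne_zero (by norm_num) hr))).exp
  refine (hasDerivAt_time hd).unique (h2.congr_deriv ?_)
  simp only [heat]
  congr 1
  field_simp
  ring

theorem dx_dx_heat (hσ : σ ≤ τ) (i : Fin d) : ∀ z ∈ slab τ T, dx i (dx i (heat σ x₀)) z =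
    heat σ x₀ z * ((z.2 i - x₀ i) ^ 2 / (4 * (z.1 - σ) ^ 2) - 1 / (2 * (z.1 - σ))) := by
  rintro ⟨t, x⟩ hz
  have hr : t - σ ≠ 0 := by
    have := (mem_slab.1 hz).1
    exact (by simp only at this; linarith : 0 < t - σ).ne'
  have hO := isOpen_slab (d := d) τ T
  have hd := differentiableAt_of_contDiffOn hO (contDiffOn_heat (x₀ := x₀) hσ) hz
  have hg : ContDiffOn ℝ ∞ (fun z : ℝ × Space d => -(1 / (2 * (z.1 - σ))) * (z.2 i - x₀ i))
      (slab τ T) := by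
    refine ContDiffOn.mul (ContDiffOn.neg (contDiffOn_const.div
      (contDiffOn_const.mul (contDiff_fst.sub contDiff_const).contDiffOn) fun z hz => ?_))
      (((contDiff_coord i).comp contDiff_snd).sub contDiff_const).contDiffOn
    have := (mem_slab.1 hz).1
    exact mul_ne_zero (by norm_num) (by linarith : 0 < z.1 - σ).ne'
  have hgd := differentiableAt_of_contDiffOn hO hg hz
  rw [dx_congr hO (dx_heat hσ i) hz, dx_mul hd hgd, dx_heat hσ i _ hz, ← fderiv_slice hgd]
  have e : pd i (fun y : Space d => -(1 / (2 * (t - σ))) * (y i - x₀ i)) x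
      = -(1 / (2 * (t - σ))) * pd i (fun y : Space d => y i) x :=
    pd_real_comp (f := fun r => -(1 / (2 * (t - σ))) * (r - x₀ i))
      (by simpa using ((hasDerivAt_id' (x i)).sub_const (x₀ i)).const_mul (-(1 / (2 * (t - σ)))))
      ((contDiff_coord i).differentiable (by simp) x) i
  rw [pd_coord, pd] at e
  rw [e]
  field_simp
  ring

theorem heat_rpow_eq {p t : ℝ} (x : Space d) :
    heat σ x₀ (t, x) ^ p = Real.exp (-(d / 2) * Real.log (t - σ) * p)
      * Real.exp (-(p / (4 * (t - σ))) * ‖x - x₀‖ ^ 2) := by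
  rw [heat, ← Real.exp_mul, ← Real.exp_add]
  congr 1
  ring

theorem integrable_heat_rpow {p t : ℝ} (hp : 0 < p) (ht : σ < t) :
    Integrable fun x => heat σ x₀ (t, x) ^ p := by
  simp only [heat_rpow_eq]
  have := GaussianFourier.integrable_cexp_neg_mul_sq_norm_add (V := Space d)
    (b := ((p / (4 * (t - σ)) : ℝ) : ℂ)) (by
      rw [Complex.ofReal_re]; exact div_pos hp (by linarith)) 0 0
  have h2 : Integrable fun x : Space d => Real.exp (-(p / (4 * (t - σ))) * ‖x‖ ^ 2) := by
    refine this.re.congr (ae_of_all _ fun x => ?_)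
    simp only [zero_mul, add_zero]
    rw [show -((p / (4 * (t - σ)) : ℝ) : ℂ) * (‖x‖ : ℂ) ^ 2
      = ((-(p / (4 * (t - σ))) * ‖x‖ ^ 2 : ℝ) : ℂ) by push_cast; ring, ← Complex.ofReal_exp]
    exact Complex.ofReal_re _
  exact (h2.comp_sub_right x₀).const_mul _

theorem integral_heat_rpow {p t : ℝ} (hp : 0 < p) (ht : σ < t) :
    ∫ x, heat σ x₀ (t, x) ^ p =
      (t - σ) ^ (-(d / 2) * p) * (4 * Real.pi * (t - σ) / p) ^ ((d : ℝ) / 2) := by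
  have hr : 0 < t - σ := by linarith
  simp only [heat_rpow_eq]
  rw [integral_const_mul,
    integral_sub_right_eq_self (fun x : Space d => Real.exp (-(p / (4 * (t - σ))) * ‖x‖ ^ 2)) x₀,
    GaussianFourier.integral_rexp_neg_mul_sq_norm (by positivity), finrank_euclideanSpace,
    Fintype.card_fin, Real.rpow_def_of_pos hr]
  congr 2
  · ring
  · field_simp

theorem integral_heat {t : ℝ} (ht : σ < t) :
    Integrable (fun x => heat σ x₀ (t, x)) ∧
      ∫ x, heat σ x₀ (t, x) = (4 * Real.pi) ^ ((d : ℝ) / 2) := by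
  have hr : 0 < t - σ := by linarith
  have h1 := integrable_heat_rpow (x₀ := x₀) one_pos ht
  have h2 := integral_heat_rpow (x₀ := x₀) one_pos ht
  simp only [Real.rpow_one] at h1 h2
  refine ⟨h1, ?_⟩
  rw [h2, div_one, Real.mul_rpow (by positivity) hr.le, mul_left_comm, ← Real.rpow_add hr]
  simp

/-- The heat kernel solves the drift-diffusion equation without drift after the time of its pole. -/
theorem driftDiffusion_heat (hσ : σ < τ) : DriftDiffusion (fun _ _ => 0) (heat σ x₀) τ T where
  smooth_drift _ := contDiffOn_const
  smooth := contDiffOn_heat hσ.le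
  bounded := ⟨0, by simp⟩
  equation z hz := by
    simp only [zero_mul, zero_add]
    have e : ∀ i : Fin d, dx i (fun w => dx i (heat σ x₀) w) z = dx i (dx i (heat σ x₀)) z :=
      fun _ => rfl
    rw [dt_heat hσ.le z hz, Finset.sum_congr rfl fun i _ => (e i).trans (dx_dx_heat hσ.le i z hz),
      ← Finset.mul_sum, Finset.sum_sub_distrib, ← Finset.sum_div, EuclideanSpace.real_norm_sq_eq]
    congr 1
    simp
    ring
  integrable := by
    have hm : AEStronglyMeasurable (heat σ x₀) (volume.restrict (slab τ T)) :=
      (contDiffOn_heat hσ.le).continuousOn.aestronglyMeasurable (measurableSet_slab τ T)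
    rw [restrict_slab] at hm
    rw [IntegrableOn, restrict_slab, integrable_prod_iff hm]
    constructor
    · filter_upwards [ae_restrict_mem measurableSet_Ioo] with t ht
      exact (integral_heat (hσ.trans ht.1)).1
    · refine (integrable_const ((4 * Real.pi) ^ ((d : ℝ) / 2))).congr ?_
      filter_upwards [ae_restrict_mem measurableSet_Ioo] with t ht
      rw [← (integral_heat (x₀ := x₀) (hσ.trans ht.1)).2]
      exact integral_congr_ae (ae_of_all _ fun x => (Real.norm_of_nonneg (heat_pos _).le).symm)

end heat

/-- Hölder's inequality in the mixed norms, for the heat kernel: its norm in the dual of `Lᵃ` is of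
order `t ^ (-d / (2 a))`, which belongs to the dual of `Lᶜ` in time as `d / (2 a) < 1 - 1 / c`. -/
theorem exists_lintegral_mul_heat_le (hd : 2 < d) {a c T : ℝ} (hc : 2 < c)
    (ha : c * d / (c - 2) ≤ a) : ∃ C : ℝ≥0,
    ∀ {s₀ σ : ℝ} {x₀ : Space d} {f : ℝ × Space d → ℝ}, 0 ≤ s₀ → σ ≤ s₀ →
      ContinuousOn f (slab 0 T) →
      ∫⁻ z in slab s₀ T, ‖f z‖ₑ * ENNReal.ofReal (heat σ x₀ z) ≤
        C * mixedNorm c a 0 T (fun t x => f (t, x)) := by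
  have hd' : (2 : ℝ) < d := by exact_mod_cast hd
  have hc2 : 0 < c - 2 := by linarith
  have hc0 : 0 < c := by linarith
  have ha0 : 0 < a := lt_of_lt_of_le (by positivity) ha
  have hda : (d : ℝ) / a ≤ 1 - 2 / c := by
    rw [div_le_iff₀ hc2] at ha
    rw [div_le_iff₀ ha0, one_sub_div hc0.ne', div_mul_eq_mul_div, le_div_iff₀ hc0]
    linarith
  set q : ℝ := 1 - 1 / a with hq
  set q₂ : ℝ := 1 - 1 / c with hq₂
  have hq₂0 : 0 < q₂ := by
    have : 1 / c < 1 := by rw [div_lt_one hc0]; linarith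
    linarith
  have hq0 : 0 < q := by
    have h1 : 0 < 2 / c := by positivity
    have h2 : 2 * (1 / a) ≤ d / a := by rw [mul_one_div]; gcongr
    have h3 : 0 < 1 / a := by positivity
    linarith
  -- the singularity in time of the heat kernel, which is integrable since `γ < 1`
  set γ : ℝ := d / (2 * a) / q₂ with hγ
  have hγ1 : γ < 1 := by
    rw [hγ, div_lt_one hq₂0]
    have e : (d : ℝ) / (2 * a) = d / a / 2 := by ring
    have e2 : 2 / c = 2 * (1 / c) := by ring
    have : 0 < (d : ℝ) / a := by positivity
    rw [e, hq₂]; linarith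
  set k : ℝ := (4 * Real.pi * q) ^ (d / 2 * q) with hk
  set Λ : ℝ≥0∞ := ∫⁻ r in Ioo 0 T, ENNReal.ofReal (r ^ (-γ)) with hΛ
  have hΛt : Λ ≠ ⊤ := by
    rcases le_or_gt T 0 with hT | hT
    · simp [hΛ, Ioo_eq_empty (not_lt.2 hT)]
    have : IntegrableOn (fun r : ℝ => r ^ (-γ)) (Ioo 0 T) :=
      (intervalIntegral.integrableOn_Ioo_rpow_iff hT).2 (by linarith)
    exact this.lintegral_lt_top.ne
  refine ⟨(ENNReal.ofReal k * Λ ^ q₂).toNNReal, fun {s₀ σ x₀ f} hs₀ hσ hf => ?_⟩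
  rw [ENNReal.coe_toNNReal (by finiteness)]
  have hsub : (slab s₀ T : Set (ℝ × Space d)) ⊆ slab 0 T := slab_subset hs₀ le_rfl
  have hf' := hf.mono hsub
  have hms := measurableSet_slab (d := d) s₀ T
  have hh := (contDiffOn_heat (x₀ := x₀) (T := T) hσ).continuousOn
  set G : ℝ → ℝ≥0∞ := fun t => (∫⁻ x, ‖f (t, x)‖ₑ ^ a) ^ (1 / a) with hG
  have hGm : AEMeasurable G (volume.restrict (Ioo s₀ T)) :=
    (aemeasurable_lintegral_slice hf').pow_const _
  have slice : ∀ t ∈ Ioo s₀ T, ∫⁻ x, ‖f (t, x)‖ₑ * ENNReal.ofReal (heat σ x₀ (t, x)) ≤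
      ENNReal.ofReal k * ((G t ^ c) ^ (1 / c) * ENNReal.ofReal ((t - s₀) ^ (-γ)) ^ q₂) := by
    intro t ht
    have hr : 0 < t - σ := by linarith [ht.1]
    have hr₀ : 0 < t - s₀ := by linarith [ht.1]
    have H := ENNReal.lintegral_mul_norm_pow_le (μ := (volume : Measure (Space d)))
      (f := fun x => ‖f (t, x)‖ₑ ^ a) (g := fun x => ENNReal.ofReal (heat σ x₀ (t, x)) ^ (1 / q))
      ((continuous_slice hf' ht).enorm.measurable.pow_const a).aemeasurable
      ((continuous_slice hh ht).measurable.ennreal_ofReal.pow_const _).aemeasurable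
      (p := 1 / a) (q := q) (by positivity) hq0.le (by rw [hq]; ring)
    have e1 : ∀ x, (‖f (t, x)‖ₑ ^ a) ^ (1 / a)
        * (ENNReal.ofReal (heat σ x₀ (t, x)) ^ (1 / q)) ^ q
        = ‖f (t, x)‖ₑ * ENNReal.ofReal (heat σ x₀ (t, x)) := fun x => by
      rw [← ENNReal.rpow_mul, ← ENNReal.rpow_mul, mul_one_div_cancel ha0.ne',
        one_div_mul_cancel hq0.ne', ENNReal.rpow_one, ENNReal.rpow_one]
    have e2 : (∫⁻ x, ENNReal.ofReal (heat σ x₀ (t, x)) ^ (1 / q)) ^ q =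
        ENNReal.ofReal (k * (t - σ) ^ (-(d / (2 * a)))) := by
      have h1 : ∀ x, ENNReal.ofReal (heat σ x₀ (t, x)) ^ (1 / q)
          = ENNReal.ofReal (heat σ x₀ (t, x) ^ (1 / q)) := fun x =>
        ENNReal.ofReal_rpow_of_nonneg (heat_pos _).le (by positivity)
      simp only [h1]
      rw [← ofReal_integral_eq_lintegral_ofReal (integrable_heat_rpow (by positivity) (by linarith))
          (ae_of_all _ fun x => Real.rpow_nonneg (heat_pos _).le _),
        integral_heat_rpow (by positivity) (by linarith),
        ENNReal.ofReal_rpow_of_nonneg (by positivity) hq0.le,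
        Real.mul_rpow (by positivity) (by positivity), ← Real.rpow_mul hr.le,
        ← Real.rpow_mul (by positivity),
        show 4 * Real.pi * (t - σ) / (1 / q) = (4 * Real.pi * q) * (t - σ) by field_simp,
        Real.mul_rpow (by positivity) hr.le, mul_left_comm, ← Real.rpow_add hr]
      congr 3
      rw [mul_assoc, one_div_mul_cancel hq0.ne', hq]; ring
    simp only [e1] at H
    rw [e2] at H
    refine H.trans ?_
    rw [← ENNReal.rpow_mul (G t), mul_one_div_cancel hc0.ne', ENNReal.rpow_one,
      ENNReal.ofReal_mul (by positivity), mul_left_comm]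
    gcongr
    rw [ENNReal.ofReal_rpow_of_nonneg (by positivity) hq₂0.le, ← Real.rpow_mul hr₀.le]
    have e3 : -γ * q₂ = -(d / (2 * a)) := by rw [hγ]; field_simp
    rw [e3]
    exact ENNReal.ofReal_le_ofReal (Real.rpow_le_rpow_of_nonpos hr₀ (by linarith)
      (by rw [neg_nonpos]; positivity))
  calc ∫⁻ z in slab s₀ T, ‖f z‖ₑ * ENNReal.ofReal (heat σ x₀ z)
      = ∫⁻ t in Ioo s₀ T, ∫⁻ x, ‖f (t, x)‖ₑ * ENNReal.ofReal (heat σ x₀ (t, x)) := by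
        rw [restrict_slab, lintegral_prod]
        rw [← restrict_slab]
        exact (hf'.aestronglyMeasurable hms).enorm.mul
          (hh.aestronglyMeasurable hms).aemeasurable.ennreal_ofReal
    _ ≤ ∫⁻ t in Ioo s₀ T,
          ENNReal.ofReal k * ((G t ^ c) ^ (1 / c) * ENNReal.ofReal ((t - s₀) ^ (-γ)) ^ q₂) :=
        setLIntegral_mono_ae' measurableSet_Ioo (ae_of_all _ slice)
    _ = ENNReal.ofReal k * ∫⁻ t in Ioo s₀ T,
          (G t ^ c) ^ (1 / c) * ENNReal.ofReal ((t - s₀) ^ (-γ)) ^ q₂ :=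
        lintegral_const_mul' _ _ ENNReal.ofReal_ne_top
    _ ≤ ENNReal.ofReal k * ((∫⁻ t in Ioo s₀ T, G t ^ c) ^ (1 / c)
          * (∫⁻ t in Ioo s₀ T, ENNReal.ofReal ((t - s₀) ^ (-γ))) ^ q₂) := by
        gcongr
        exact ENNReal.lintegral_mul_norm_pow_le (hGm.pow_const c)
          (by fun_prop) (by positivity) hq₂0.le (by rw [hq₂]; ring)
    _ ≤ ENNReal.ofReal k * ((∫⁻ t in Ioo 0 T, G t ^ c) ^ (1 / c) * Λ ^ q₂) := by
        have h1 : ∫⁻ t in Ioo s₀ T, G t ^ c ≤ ∫⁻ t in Ioo 0 T, G t ^ c :=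
          lintegral_mono_set (Ioo_subset_Ioo hs₀ le_rfl)
        have h2 : ∫⁻ t in Ioo s₀ T, ENNReal.ofReal ((t - s₀) ^ (-γ)) ≤ Λ := by
          have := (measurePreserving_sub_right (volume : Measure ℝ) s₀).setLIntegral_comp_preimage
            (s := Ioo 0 (T - s₀)) measurableSet_Ioo
            (f := fun r => ENNReal.ofReal (r ^ (-γ))) (by fun_prop)
          rw [show (fun x => x - s₀) ⁻¹' Ioo 0 (T - s₀) = Ioo s₀ T by
            ext x; simp] at this
          rw [this]
          exact lintegral_mono_set (Ioo_subset_Ioo le_rfl (by linarith))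
        gcongr
    _ = _ := by
        rw [mixedNorm_eq ha0]
        ring

/-- The heat kernel converges to a multiple of the point mass at its pole. -/
theorem tendsto_integral_mul_heat {w : Space d → ℝ} (hw : Continuous w) {W : ℝ}
    (hW : ∀ x, |w x| ≤ W) (x₀ : Space d) (t : ℝ) :
    Tendsto (fun δ : ℝ => ∫ x, w x * heat (t - δ) x₀ (t, x)) (𝓝[>] 0)
      (𝓝 ((4 * Real.pi) ^ ((d : ℝ) / 2) * w x₀)) := by
  -- substitute `x = x₀ + √δ y`
  have e : ∀ δ : ℝ, 0 < δ → ∫ x, w x * heat (t - δ) x₀ (t, x) =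
      ∫ y : Space d, w (x₀ + √δ • y) * heat (-1) 0 (0, y) := by
    intro δ hδ
    have hs : 0 < √δ := Real.sqrt_pos.2 hδ
    have h1 := integral_add_left_eq_self (μ := (volume : Measure (Space d)))
      (fun x => w x * heat (t - δ) x₀ (t, x)) x₀
    have h2 := Measure.integral_comp_smul (volume : Measure (Space d))
      (fun y => w (x₀ + y) * heat (t - δ) x₀ (t, x₀ + y)) (√δ)
    rw [← h1]
    have h3 : ∀ y : Space d, w (x₀ + √δ • y) * heat (-1) 0 (0, y) =
        √δ ^ d * (w (x₀ + √δ • y) * heat (t - δ) x₀ (t, x₀ + √δ • y)) := by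
      intro y
      have hp : √δ ^ d = Real.exp (d / 2 * Real.log δ) := by
        rw [← Real.exp_log (pow_pos hs d), Real.log_pow, Real.log_sqrt hδ.le]
        congr 1; ring
      have h4 : heat (-1) 0 (0, y) = √δ ^ d * heat (t - δ) x₀ (t, x₀ + √δ • y) := by
        rw [hp, heat, heat, ← Real.exp_add]
        congr 1
        simp only [sub_zero, zero_sub, neg_neg, Real.log_one, mul_zero, add_sub_cancel_left,
          sub_sub_cancel, norm_smul, Real.norm_of_nonneg hs.le, mul_pow, Real.sq_sqrt hδ.le]
        field_simp
        ring
      rw [h4]; ring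
    simp only [h3]
    rw [integral_const_mul, h2, finrank_euclideanSpace, Fintype.card_fin,
      abs_of_pos (by positivity), smul_eq_mul, mul_inv_cancel_left₀ (by positivity)]
  have hi := (integral_heat (σ := -1) (x₀ := (0 : Space d)) (t := 0) (by norm_num))
  have hc : Continuous fun y : Space d => heat (-1) 0 (0, y) := by
    simp only [heat]; fun_prop
  have lim : Tendsto (fun δ : ℝ => ∫ y : Space d, w (x₀ + √δ • y) * heat (-1) 0 (0, y)) (𝓝[>] 0)
      (𝓝 (∫ y : Space d, w x₀ * heat (-1) 0 (0, y))) := by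
    refine tendsto_integral_filter_of_dominated_convergence
      (fun y : Space d => W * heat (-1) 0 (0, y)) (Eventually.of_forall fun δ => ?_)
      (Eventually.of_forall fun δ => ae_of_all _ fun y => ?_) (hi.1.const_mul W)
      (ae_of_all _ fun y => ?_)
    · exact ((hw.comp (by fun_prop)).mul hc).aestronglyMeasurable
    · rw [norm_mul, Real.norm_eq_abs, Real.norm_of_nonneg (heat_pos _).le]
      exact mul_le_mul_of_nonneg_right (hW _) (heat_pos _).le
    · have : Tendsto (fun δ : ℝ => w (x₀ + √δ • y)) (𝓝 0) (𝓝 (w (x₀ + √0 • y))) :=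
        (by fun_prop : Continuous fun δ : ℝ => w (x₀ + √δ • y)).tendsto 0
      rw [Real.sqrt_zero, zero_smul, add_zero] at this
      exact (this.mono_left nhdsWithin_le_nhds).mul_const _
  rw [integral_const_mul, hi.2, mul_comm] at lim
  refine lim.congr' ?_
  filter_upwards [self_mem_nhdsWithin] with δ hδ using (e δ hδ).symm

/-- A bounded function with bounded spatial gradient which satisfies `w_t + Δw ≥ -|f|` is bounded
above by its terminal values and the mixed norm of `f`. -/
theorem exists_upper_bound (hd : 2 < d) {a c T : ℝ} (hc : 2 < c) (ha : c * d / (c - 2) ≤ a) :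
    ∃ C : ℝ, 0 ≤ C ∧ ∀ {w f : ℝ × Space d → ℝ} {U W : ℝ}, ContDiffOn ℝ ∞ w (slab 0 T) →
      ContinuousOn f (slab 0 T) → 0 ≤ U → (∀ z ∈ slab 0 T, |w z| ≤ W) →
      (∀ z ∈ slab 0 T, ∀ i, |dx i w z| ≤ W) →
      (∀ z ∈ slab 0 T, -|f z| ≤ dt w z + ∑ i, dx i (dx i w) z) →
      (∀ K : Set (Space d), IsCompact K → ∀ η > 0, ∀ᶠ t in 𝓝[<] T, ∀ x ∈ K, w (t, x) ≤ U + η) →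
      mixedNorm c a 0 T (fun t x => f (t, x)) ≠ ⊤ →
      ∀ z ∈ slab 0 T, w z ≤ U + C * (mixedNorm c a 0 T (fun t x => f (t, x))).toReal := by
  obtain ⟨C₀, hC₀⟩ := exists_lintegral_mul_heat_le (T := T) hd hc ha
  obtain ⟨C₁, hC₁0, hC₁⟩ := exists_testFunction_cutoff d
  set g : ℝ := (4 * Real.pi) ^ ((d : ℝ) / 2) with hg
  have hg0 : 0 < g := by positivity
  refine ⟨C₀ / g, by positivity, fun {w f U W} hw hf hU hW hW' hsub hterm hN => ?_⟩
  rintro ⟨s₀, x₀⟩ hz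
  obtain ⟨hs0, hsT⟩ := mem_slab.1 hz
  simp only at hs0 hsT
  set N := (mixedNorm c a 0 T (fun t x => f (t, x))).toReal with hNdef
  have hW0 : 0 ≤ W := (abs_nonneg _).trans (hW _ hz)
  have cw : Continuous fun x => w (s₀, x) := continuous_slice hw.continuousOn ⟨hs0, hsT⟩
  -- the estimate for a kernel which is not singular at time `s₀`
  have main : ∀ δ ∈ Ioo 0 s₀, ∫ x, w (s₀, x) * heat (s₀ - δ) x₀ (s₀, x) ≤ U * g + C₀ * N := by
    intro δ hδ
    set τ := s₀ - δ / 2 with hτ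
    have hτ0 : 0 < τ := by linarith [hδ.2, hδ.1]
    have hτs : τ < s₀ := by linarith [hδ.1]
    have hστ : s₀ - δ < τ := by linarith [hδ.1]
    have hDD := driftDiffusion_heat (x₀ := x₀) (T := T) hστ
    set k := heat (s₀ - δ) x₀ with hk
    have hkpos : ∀ z, 0 < k z := heat_pos
    have hsubset : (slab τ T : Set (ℝ × Space d)) ⊆ slab 0 T := slab_subset hτ0.le le_rfl
    have hw' := hw.mono hsubset
    have hsub' : (slab s₀ T : Set (ℝ × Space d)) ⊆ slab τ T := slab_subset hτs.le le_rfl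
    have ik : IntegrableOn k (slab s₀ T) := hDD.integrable.mono_set hsub'
    have hf' : ContinuousOn f (slab s₀ T) := hf.mono (hsub'.trans hsubset)
    have hms := measurableSet_slab (d := d) s₀ T
    have L := hC₀ (x₀ := x₀) hs0.le (by linarith [hδ.1] : s₀ - δ ≤ s₀) hf
    have hcont : ContinuousOn (fun z => |f z| * k z) (slab s₀ T) :=
      hf'.abs.mul (hDD.smooth.continuousOn.mono hsub')
    have L' : ∫⁻ z in slab s₀ T, ENNReal.ofReal (|f z| * k z) ≤
        C₀ * mixedNorm c a 0 T (fun t x => f (t, x)) := by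
      refine le_trans (le_of_eq (lintegral_congr fun z => ?_)) L
      rw [ENNReal.ofReal_mul (abs_nonneg _), ← Real.norm_eq_abs, ofReal_norm]
    have ifk : IntegrableOn (fun z => |f z| * k z) (slab s₀ T) := by
      refine ⟨hcont.aestronglyMeasurable hms, ?_⟩
      rw [hasFiniteIntegral_iff_ofReal
        (ae_of_all _ fun z => mul_nonneg (abs_nonneg _) (hkpos z).le)]
      exact L'.trans_lt (ENNReal.mul_lt_top ENNReal.coe_lt_top (lt_top_iff_ne_top.2 hN))
    have hfk : ∫ z in slab s₀ T, |f z| * k z ≤ C₀ * N := by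
      rw [integral_eq_lintegral_of_nonneg_ae
        (ae_of_all _ fun z => mul_nonneg (abs_nonneg _) (hkpos z).le) ifk.1]
      refine (ENNReal.toReal_mono (ENNReal.mul_ne_top ENNReal.coe_ne_top hN) L').trans_eq ?_
      rw [ENNReal.toReal_mul]; rfl
    set Ik := ∫ z in slab s₀ T, k z with hIk
    have step : ∀ n : ℕ, ∫ x, w (s₀, x) * k (s₀, x) * cutoff n x ≤
        U * g + C₀ * N + (3 * d * W * C₁ * Ik) / (n + 1) := by
      intro n
      set κ : ℝ := C₁ / (n + 1) with hκ
      have hκ0 : 0 ≤ κ := by positivity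
      refine le_of_forall_pos_le_add fun η hη => ?_
      have ev := (hterm _ (hasCompactSupport_cutoff n) (η / g) (by positivity)).and
        (Ioo_mem_nhdsLT hsT)
      obtain ⟨t, hevt, ht⟩ := ev.exists
      have id := hDD.duality_identity hw' 1 (contDiff_cutoff n) (hasCompactSupport_cutoff n)
        hτs ht.1.le ht.2
      have hst : (slab s₀ t : Set (ℝ × Space d)) ⊆ slab s₀ T := slab_subset le_rfl ht.2.le
      have htI := integral_heat (x₀ := x₀) (by linarith [hδ.1, ht.1] : s₀ - δ < t)
      have b1 : ∫ x, w (t, x) * k (t, x) * cutoff n x ≤ (U + η / g) * g := by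
        calc _ ≤ ∫ x, (U + η / g) * k (t, x) := by
              have htτ : t ∈ Ioo τ T := ⟨hτs.trans ht.1, ht.2⟩
              refine integral_mono
                ((((continuous_slice hw'.continuousOn htτ).mul
                  (continuous_slice hDD.smooth.continuousOn htτ)).mul
                  (contDiff_cutoff n).continuous).integrable_of_hasCompactSupport
                    (hasCompactSupport_cutoff n).mul_left) (htI.1.const_mul _) fun x => ?_
              have hkx := hkpos (t, x)
              have hη' : 0 ≤ U + η / g := by positivity
              by_cases hx : x ∈ tsupport (cutoff n)
              · calc w (t, x) * k (t, x) * cutoff n x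
                    ≤ (U + η / g) * k (t, x) * cutoff n x :=
                      mul_le_mul_of_nonneg_right
                        (mul_le_mul_of_nonneg_right (hevt x hx) hkx.le) (cutoff_nonneg n x)
                  _ ≤ (U + η / g) * k (t, x) :=
                      mul_le_of_le_one_right (by positivity) (cutoff_le_one n x)
              · simp only [image_eq_zero_of_notMem_tsupport hx, mul_zero]
                positivity
          _ = (U + η / g) * g := by rw [integral_const_mul, htI.2]
      have b2 : -(C₀ * N + 3 * d * W * κ * Ik) ≤
          (∫ x, w (t, x) * k (t, x) * cutoff n x) - ∫ x, w (s₀, x) * k (s₀, x) * cutoff n x := by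
        have int1 := (ifk.mono_set hst).neg.sub ((ik.mono_set hst).const_mul (3 * d * W * κ))
        have hmono : ∫ z in slab s₀ t, (-(|f z| * k z) - 3 * d * W * κ * k z) ≤
            (∫ x, w (t, x) * k (t, x) * cutoff n x) - ∫ x, w (s₀, x) * k (s₀, x) * cutoff n x := by
          rw [id]
          refine setIntegral_mono_on int1 ?_ (measurableSet_slab s₀ t) fun z hz => ?_
          · refine integrableOn_slab_of_notMem_eq_zero (τ := τ) (T := T) (K := tsupport (cutoff n))
              ?_ (hasCompactSupport_cutoff n) ?_ hτs ht.2
            · have hO := isOpen_slab (d := d) τ T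
              have cχ := (contDiffOn_snd (contDiff_cutoff (d := d) n) (slab τ T)).continuousOn
              have cχ1 := fun i => (contDiffOn_snd (contDiff_pd (contDiff_cutoff (d := d) n) i)
                (slab τ T)).continuousOn
              have cχ2 := fun i => (contDiffOn_snd (contDiff_pd (contDiff_pd
                (contDiff_cutoff (d := d) n) i) i) (slab τ T)).continuousOn
              have cw0 := hw'.continuousOn
              have cwt := (contDiffOn_dt hO hw').continuousOn
              have cw1 := fun i => (contDiffOn_dx hO hw' i).continuousOn
              have cw2 := fun i => (contDiffOn_dx hO (contDiffOn_dx hO hw' i) i).continuousOn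
              have ck0 := hDD.smooth.continuousOn
              have ck1 := fun i => (contDiffOn_dx hO hDD.smooth i).continuousOn
              fun_prop
            · intro z _ hz
              have hz2 : ∀ i, z.2 ∉ tsupport (pd i (cutoff n)) := fun i h =>
                hz (tsupport_pd_subset i h)
              simp [image_eq_zero_of_notMem_tsupport hz, pd_eq_zero_of_notMem _ hz,
                pd_eq_zero_of_notMem _ (hz2 _)]
          · have hz0 : z ∈ slab 0 T := hsubset (hsub' (hst hz))
            have hkz := hkpos z
            have hχ0 := cutoff_nonneg n z.2
            have c1 : -(|f z| * k z) ≤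
                k z * cutoff n z.2 * (dt w z + ∑ i, (dx i (dx i w) z - 0 * dx i w z)) := by
              simp only [zero_mul, sub_zero]
              have := mul_le_mul_of_nonneg_left (hsub z hz0) (mul_nonneg hkz.le hχ0)
              have h2 : |f z| * k z * cutoff n z.2 ≤ |f z| * k z :=
                mul_le_of_le_one_right (by positivity) (cutoff_le_one n _)
              linarith
            have c2 : -(3 * d * W * κ * k z) ≤ ∑ i, (-w z * k z * 0 * pd i (cutoff n) z.2
                + (1 - 1) * w z * dx i k z * pd i (cutoff n) z.2
                + (1 + 1) * k z * dx i w z * pd i (cutoff n) z.2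
                + 1 * w z * k z * pd i (pd i (cutoff n)) z.2) := by
              have h1 : ∀ i : Fin d, -(3 * W * κ * k z) ≤ -w z * k z * 0 * pd i (cutoff n) z.2
                + (1 - 1) * w z * dx i k z * pd i (cutoff n) z.2
                + (1 + 1) * k z * dx i w z * pd i (cutoff n) z.2
                + 1 * w z * k z * pd i (pd i (cutoff n)) z.2 := by
                intro i
                have a1 : |dx i w z * pd i (cutoff n) z.2| ≤ W * κ := by
                  rw [abs_mul]
                  exact mul_le_mul (hW' z hz0 i) ((hC₁ n).first i _) (abs_nonneg _) hW0
                have a2 : |w z * pd i (pd i (cutoff n)) z.2| ≤ W * κ := by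
                  rw [abs_mul]
                  exact mul_le_mul (hW z hz0) ((hC₁ n).second i _) (abs_nonneg _) hW0
                have a3 := mul_le_mul_of_nonneg_right (abs_le.1 a1).1 hkz.le
                have a4 := mul_le_mul_of_nonneg_right (abs_le.1 a2).1 hkz.le
                linarith
              have := Finset.sum_le_sum fun i (_ : i ∈ Finset.univ) => h1 i
              refine le_trans (le_of_eq ?_) this
              simp; ring
            linarith
        refine le_trans ?_ hmono
        rw [integral_sub (ifk.mono_set hst).fun_neg ((ik.mono_set hst).const_mul _), integral_neg,
          integral_const_mul]
        have m1 := setIntegral_mono_set ifk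
          (ae_of_all _ fun z => mul_nonneg (abs_nonneg _) (hkpos z).le) hst.eventuallyLE
        have m2 := setIntegral_mono_set ik (ae_of_all _ fun z => (hkpos z).le) hst.eventuallyLE
        have m3 := mul_le_mul_of_nonneg_left m2 (by positivity : 0 ≤ 3 * d * W * κ)
        linarith
      have e1 : (U + η / g) * g = U * g + η := by field_simp
      have e2 : 3 * d * W * C₁ * Ik / (n + 1) = 3 * d * W * κ * Ik := by rw [hκ]; ring
      rw [e2]
      linarith
    have hs0I := integral_heat (x₀ := x₀) (by linarith [hδ.1] : s₀ - δ < s₀)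
    have lim1 : Tendsto (fun n => ∫ x, w (s₀, x) * k (s₀, x) * cutoff n x) atTop
        (𝓝 (∫ x, w (s₀, x) * k (s₀, x))) := by
      have ck : Continuous fun x => k (s₀, x) :=
        continuous_slice hDD.smooth.continuousOn ⟨hτs, hsT⟩
      refine tendsto_integral_of_dominated_convergence (fun x => W * k (s₀, x))
        (fun n => ((cw.mul ck).mul (contDiff_cutoff n).continuous).aestronglyMeasurable)
        (hs0I.1.const_mul W) (fun n => ae_of_all _ fun x => ?_)
        (ae_of_all _ fun x => by simpa using (tendsto_cutoff x).const_mul (w (s₀, x) * k (s₀, x)))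
      have hkx := hkpos (s₀, x)
      rw [Real.norm_eq_abs, abs_mul, abs_mul, abs_of_pos hkx, abs_of_nonneg (cutoff_nonneg n x)]
      exact (mul_le_of_le_one_right (by positivity) (cutoff_le_one n x)).trans
        (mul_le_mul_of_nonneg_right (hW (s₀, x) hz) hkx.le)
    have lim2 := (tendsto_const_div_succ (3 * d * W * C₁ * Ik)).const_add (U * g + C₀ * N)
    rw [add_zero] at lim2
    exact le_of_tendsto_of_tendsto' lim1 lim2 step
  have lim := tendsto_integral_mul_heat cw (fun x => hW (s₀, x) hz) x₀ s₀
  have := le_of_tendsto lim (by filter_upwards [Ioo_mem_nhdsGT hs0] with δ hδ using main δ hδ)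
  rw [← hg] at this
  have e : U + C₀ / g * N = (U * g + C₀ * N) / g := by field_simp
  rw [e, le_div_iff₀ hg0]
  linarith

end MFG

end

noncomputable section

namespace MFG

variable {d : ℕ}

/-! ### The adjoint method -/

/-- The properties of a solution `U` of `-U_t + h = ΔU + f` on which the adjoint method rests.
Here `h` stands for `H(x,DU)`, `b` for `D_pH(x,DU)` and `e` for `D_xH(x,DU)`, and `B` bounds `U`
and `DU` at the terminal time. The bounds in `bounded` are only qualitative. -/
structure HamiltonJacobiSystem (U f h : ℝ × Space d → ℝ) (b e : Fin d → ℝ × Space d → ℝ)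
    (T k K B : ℝ) : Prop where
  smooth : ContDiffOn ℝ ∞ U (slab 0 T)
  smooth_source : ContDiffOn ℝ ∞ f (slab 0 T)
  continuous_energy : ContinuousOn h (slab 0 T)
  source_nonneg : ∀ z ∈ slab 0 T, 0 ≤ f z
  energy_nonneg : ∀ z ∈ slab 0 T, 0 ≤ h z
  equation : ∀ z ∈ slab 0 T, dt U z + ∑ i, dx i (dx i U) z = h z - f z
  equation_dx : ∀ j, ∀ z ∈ slab 0 T, dt (dx j U) z
    + ∑ i, (dx i (dx i (dx j U)) z - b i z * dx i (dx j U) z) = e j z - dx j f z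
  lower : ∀ z ∈ slab 0 T, k * h z - K ≤ ∑ i, b i z * dx i U z - h z
  drift_le : ∀ z ∈ slab 0 T, ∑ i, b i z ^ 2 ≤ K + K * h z
  abs_le : ∀ j, ∀ z ∈ slab 0 T, |e j z| ≤ K + K * h z
  bounded : ∃ W : ℝ, ∀ z ∈ slab 0 T, |U z| ≤ W ∧ (∀ j, |dx j U z| ≤ W) ∧ ∀ j, |b j z| ≤ W
  terminal : ∀ S : Set (Space d), IsCompact S → ∀ η > 0, ∀ᶠ t in 𝓝[<] T, ∀ x ∈ S,
    |U (t, x)| ≤ B + η ∧ ∀ j, |dx j U (t, x)| ≤ B + η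

/-- The initial densities to which the estimates apply, with a bound `M` for their mass, weight
and entropy. -/
structure DensityBound (φ : Space d → ℝ) (M : ℝ) : Prop where
  nonneg : ∀ x, 0 ≤ φ x
  integrable : Integrable φ
  integrable_weight : Integrable fun x => φ x * weight x
  integrable_entropy : Integrable fun x => φ x * Real.log (1 + φ x)
  mass_le : ∫ x, φ x ≤ M
  weight_le : ∫ x, φ x * weight x ≤ M
  entropy_le : ∫ x, (φ x + φ x * Real.log (1 + φ x)) ≤ M

section adjoint

variable {U f h : ℝ × Space d → ℝ} {b e : Fin d → ℝ × Space d → ℝ} {T k K B : ℝ}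
  {τ : ℝ} {ζ : ℝ × Space d → ℝ} {φ : Space d → ℝ} {M : ℝ}

theorem DensityBound.bound_nonneg (hφ : DensityBound φ M) : 0 ≤ M :=
  (integral_nonneg hφ.nonneg).trans hφ.mass_le

theorem DriftDiffusion.integral_slab_le (hζ : DriftDiffusion b ζ τ T) (hφ : DensityBound φ M)
    (h0 : HasInitialValue ζ τ φ) (hτ : τ < T) : ∫ z in slab τ T, ζ z ≤ (T - τ) * M := by
  rw [setIntegral_slab hζ.integrable]
  have hi : IntegrableOn (fun t => ∫ x, ζ (t, x)) (Ioo τ T) := by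
    have := hζ.integrable
    rw [IntegrableOn, restrict_slab] at this
    exact this.integral_prod_left
  calc ∫ t in Ioo τ T, ∫ x, ζ (t, x) ≤ ∫ t in Ioo τ T, M :=
        setIntegral_mono_on hi (by simp) measurableSet_Ioo fun t ht =>
          (hζ.mass_le hφ.integrable h0 hφ.nonneg ht).2.trans hφ.mass_le
    _ = (T - τ) * M := by simp [hτ.le]

/-- The energy estimate: the solution `U` itself, tested against the adjoint density. -/
theorem HamiltonJacobiSystem.integral_energy_le (S : HamiltonJacobiSystem U f h b e T k K B)
    (hk : 0 < k) (hK : 0 ≤ K) (hB : 0 ≤ B) (hτ0 : 0 ≤ τ) (hτ : τ < T)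
    (hζ : DriftDiffusion b ζ τ T) (hφ : DensityBound φ M) (h0 : HasInitialValue ζ τ φ) {Y : ℝ}
    (hY0 : 0 ≤ Y) (hY : ∀ z ∈ slab 0 T, U z ≤ Y) :
    IntegrableOn (fun z => (k * h z + f z) * ζ z) (slab τ T) ∧
      ∫ z in slab τ T, (k * h z + f z) * ζ z ≤ Y * M + B * M + K * (T * M) := by
  have hpos := hζ.nonneg hφ.integrable h0 hφ.nonneg
  have hM := hφ.bound_nonneg
  have hO := isOpen_slab (d := d) τ T
  have hm := measurableSet_slab (d := d) τ T
  have hsub : (slab τ T : Set (ℝ × Space d)) ⊆ slab 0 T := slab_subset hτ0 le_rfl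
  have hU := S.smooth.mono hsub
  obtain ⟨W, hW⟩ := S.bounded
  obtain ⟨C, hC0, hC⟩ := exists_testFunction_cutoff d
  have hW0 : 0 ≤ W := by
    have : ((τ + T) / 2, (0 : Space d)) ∈ slab 0 T := hsub (mem_slab.2 ⟨by
      simp only; linarith, by simp only; linarith⟩)
    exact (abs_nonneg _).trans (hW _ this).1
  set Z := ∫ z in slab τ T, ζ z with hZ
  have hZle := hζ.integral_slab_le hφ h0 hτ
  have hZ0 : 0 ≤ Z := setIntegral_nonneg hm hpos
  set δ : ℕ → ℝ := fun n => (T - τ) / 2 / ((n : ℝ) + 1) with hδ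
  have hδ0 : ∀ n, 0 < δ n := fun n => div_pos (by linarith) (by positivity)
  have hδ2 : ∀ n, δ n ≤ (T - τ) / 2 := fun n =>
    div_le_self (by linarith) (by linarith [(Nat.cast_nonneg n : (0 : ℝ) ≤ n)])
  have hδlim : Tendsto δ atTop (𝓝 0) := tendsto_const_div_succ _
  -- times close to `T` at which `U` is close to its terminal values on the support of the cutoff
  have ex : ∀ n : ℕ, ∃ t ∈ Ioo (T - δ n) T, ∀ x ∈ tsupport (cutoff n : Space d → ℝ),
      |U (t, x)| ≤ B + 1 / ((n : ℝ) + 1) := fun n => by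
    obtain ⟨t, h1, h2⟩ := ((S.terminal _ (hasCompactSupport_cutoff n) (1 / ((n : ℝ) + 1))
      (by positivity)).and (Ioo_mem_nhdsLT (by linarith [hδ0 n] : T - δ n < T))).exists
    exact ⟨t, h2, fun x hx => (h1 x hx).1⟩
  choose t ht htU using ex
  have hst : ∀ n, τ + δ n ≤ t n := fun n => by linarith [hδ2 n, (ht n).1]
  have hsubn : ∀ n, (slab (τ + δ n) (t n) : Set (ℝ × Space d)) ⊆ slab τ T := fun n =>
    slab_subset (by linarith [hδ0 n]) (ht n).2.le
  have cζ := hζ.smooth.continuousOn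
  have cE : ContinuousOn (fun z => (k * h z + f z) * ζ z) (slab τ T) :=
    (((continuousOn_const.mul (S.continuous_energy.mono hsub)).add
      (S.smooth_source.continuousOn.mono hsub))).mul cζ
  have cχ : ∀ n, ContinuousOn (fun z : ℝ × Space d => cutoff n z.2) (slab τ T) := fun n =>
    (contDiffOn_snd (contDiff_cutoff (d := d) n) (slab τ T)).continuousOn
  have E0 : ∀ z ∈ slab τ T, 0 ≤ (k * h z + f z) * ζ z := fun z hz => mul_nonneg
    (add_nonneg (mul_nonneg hk.le (S.energy_nonneg z (hsub hz))) (S.source_nonneg z (hsub hz)))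
    (hpos z hz)
  have iE : ∀ n, IntegrableOn (fun z => (k * h z + f z) * ζ z * cutoff n z.2)
      (slab (τ + δ n) (t n)) := fun n =>
    integrableOn_slab_of_notMem_eq_zero (τ := τ) (T := T) (K := tsupport (cutoff n))
      (cE.mul (cχ n)) (hasCompactSupport_cutoff n)
      (fun z _ hz => by simp [image_eq_zero_of_notMem_tsupport hz])
      (by linarith [hδ0 n]) (ht n).2
  have hlim : Tendsto (fun n : ℕ => Y * M + B * M + K * (T * M)
      + (M + C * (d * (W * (W + 3)) * Z)) / ((n : ℝ) + 1)) atTop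
      (𝓝 (Y * M + B * M + K * (T * M))) := by
    simpa using (tendsto_const_div_succ (M + C * (d * (W * (W + 3)) * Z))).const_add
      (Y * M + B * M + K * (T * M))
  refine integrable_and_integral_le_of_tendsto
    (F := fun n => (slab (τ + δ n) (t n)).indicator
      fun z => (k * h z + f z) * ζ z * cutoff n z.2)
    (a := fun n : ℕ => Y * M + B * M + K * (T * M)
      + (M + C * (d * (W * (W + 3)) * Z)) / ((n : ℝ) + 1)) (fun n => ?_) (fun n => ?_) ?_
    (fun n => ?_) hlim
  · exact ((iE n).integrable_indicator (measurableSet_slab _ _)).restrict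
  · exact ae_of_all _ fun z => indicator_nonneg (fun w hw =>
      mul_nonneg (E0 w (hsubn n hw)) (cutoff_nonneg n _)) z
  · filter_upwards [ae_restrict_mem hm] with z hz
    obtain ⟨hz1, hz2⟩ := mem_slab.1 hz
    have l1 : Tendsto (fun n => (k * h z + f z) * ζ z * cutoff n z.2) atTop
        (𝓝 ((k * h z + f z) * ζ z)) := by
      simpa using (tendsto_cutoff z.2).const_mul ((k * h z + f z) * ζ z)
    refine l1.congr' ?_
    filter_upwards [hδlim.eventually_lt_const (sub_pos.2 hz1),
      hδlim.eventually_lt_const (sub_pos.2 hz2)] with n h1 h2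
    rw [indicator_of_mem]
    exact mem_slab.2 ⟨by linarith, by linarith [(ht n).1]⟩
  · rw [setIntegral_indicator (measurableSet_slab _ _),
      inter_eq_self_of_subset_right (hsubn n)]
    set κ : ℝ := C / (n + 1) with hκ
    have hκ0 : 0 ≤ κ := by positivity
    have hs : τ < τ + δ n := by linarith [hδ0 n]
    have hsT : τ + δ n ∈ Ioo τ T := ⟨hs, (hst n).trans_lt (ht n).2⟩
    have htT : t n ∈ Ioo τ T := ⟨hs.trans_le (hst n), (ht n).2⟩
    have id := hζ.duality_identity hU 1 (contDiff_cutoff n) (hasCompactSupport_cutoff n) hs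
      (hst n) (ht n).2
    have ms := hζ.mass_le hφ.integrable h0 hφ.nonneg hsT
    have mt := hζ.mass_le hφ.integrable h0 hφ.nonneg htT
    have iUζ : ∀ r ∈ Ioo τ T, Integrable fun x => U (r, x) * ζ (r, x) * cutoff n x := fun r hr =>
      (((continuous_slice hU.continuousOn hr).mul (continuous_slice cζ hr)).mul
        (contDiff_cutoff n).continuous).integrable_of_hasCompactSupport
          (hasCompactSupport_cutoff n).mul_left
    have b1 : ∫ x, U (τ + δ n, x) * ζ (τ + δ n, x) * cutoff n x ≤ Y * M := by
      calc _ ≤ ∫ x, Y * ζ (τ + δ n, x) := by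
            refine integral_mono (iUζ _ hsT) (ms.1.const_mul Y) fun x => ?_
            have hz := hpos (τ + δ n, x) (mem_slab.2 hsT)
            calc _ ≤ Y * ζ (τ + δ n, x) * cutoff n x :=
                  mul_le_mul_of_nonneg_right (mul_le_mul_of_nonneg_right
                    (hY _ (hsub ((mem_slab (z := (τ + δ n, x))).2 hsT))) hz) (cutoff_nonneg n x)
              _ ≤ _ := mul_le_of_le_one_right (by positivity) (cutoff_le_one n x)
        _ ≤ Y * M := by
            rw [integral_const_mul]
            exact mul_le_mul_of_nonneg_left (ms.2.trans hφ.mass_le) hY0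
    have b2 : -∫ x, U (t n, x) * ζ (t n, x) * cutoff n x ≤ (B + 1 / ((n : ℝ) + 1)) * M := by
      have hBn : 0 ≤ B + 1 / ((n : ℝ) + 1) := by positivity
      rw [← integral_neg]
      calc _ ≤ ∫ x, (B + 1 / ((n : ℝ) + 1)) * ζ (t n, x) := by
            refine integral_mono (iUζ _ htT).neg (mt.1.const_mul _) fun x => ?_
            have hz := hpos (t n, x) (mem_slab.2 htT)
            by_cases hx : x ∈ tsupport (cutoff n)
            · have h1 : -U (t n, x) ≤ B + 1 / ((n : ℝ) + 1) := (neg_le_abs _).trans (htU n x hx)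
              calc -(U (t n, x) * ζ (t n, x) * cutoff n x)
                  = -U (t n, x) * ζ (t n, x) * cutoff n x := by ring
                _ ≤ (B + 1 / ((n : ℝ) + 1)) * ζ (t n, x) * cutoff n x :=
                    mul_le_mul_of_nonneg_right (mul_le_mul_of_nonneg_right h1 hz)
                      (cutoff_nonneg n x)
                _ ≤ _ := mul_le_of_le_one_right (by positivity) (cutoff_le_one n x)
            · simp only [image_eq_zero_of_notMem_tsupport hx, mul_zero, neg_zero]
              positivity
        _ ≤ _ := by
            rw [integral_const_mul]
            exact mul_le_mul_of_nonneg_left (mt.2.trans hφ.mass_le) hBn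
    have iζ : IntegrableOn ζ (slab (τ + δ n) (t n)) := hζ.integrable.mono_set (hsubn n)
    set L : ℝ := K + κ * (d * (W * (W + 3))) with hL
    have hL0 : 0 ≤ L := by positivity
    have b3 : (∫ x, U (t n, x) * ζ (t n, x) * cutoff n x)
        - ∫ x, U (τ + δ n, x) * ζ (τ + δ n, x) * cutoff n x ≤
        ∫ z in slab (τ + δ n) (t n),
          (L * ζ z - (k * h z + f z) * ζ z * cutoff n z.2) := by
      rw [id]
      refine setIntegral_mono_on ?_ ((iζ.const_mul L).sub (iE n)) (measurableSet_slab _ _)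
        fun z hz => ?_
      · refine integrableOn_slab_of_notMem_eq_zero (τ := τ) (T := T) (K := tsupport (cutoff n))
          ?_ (hasCompactSupport_cutoff n) ?_ hs (ht n).2
        · have cχ0 := cχ n
          have cχ1 := fun i => (contDiffOn_snd (contDiff_pd (contDiff_cutoff (d := d) n) i)
            (slab τ T)).continuousOn
          have cχ2 := fun i => (contDiffOn_snd (contDiff_pd (contDiff_pd
            (contDiff_cutoff (d := d) n) i) i) (slab τ T)).continuousOn
          have cw0 := hU.continuousOn
          have cwt := (contDiffOn_dt hO hU).continuousOn
          have cw1 := fun i => (contDiffOn_dx hO hU i).continuousOn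
          have cw2 := fun i => (contDiffOn_dx hO (contDiffOn_dx hO hU i) i).continuousOn
          have ck1 := fun i => (contDiffOn_dx hO hζ.smooth i).continuousOn
          have cb := fun i => (hζ.smooth_drift i).continuousOn
          fun_prop
        · intro z _ hz
          have hz2 : ∀ i, z.2 ∉ tsupport (pd i (cutoff n)) := fun i h =>
            hz (tsupport_pd_subset i h)
          simp [image_eq_zero_of_notMem_tsupport hz, pd_eq_zero_of_notMem _ hz,
            pd_eq_zero_of_notMem _ (hz2 _)]
      · have hzτ := hsubn n hz
        have hz0 := hsub hzτ
        obtain ⟨w1, w2, w3⟩ := hW z hz0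
        have hζz := hpos z hzτ
        have hχ0 := cutoff_nonneg n z.2
        have c1 : ζ z * cutoff n z.2 * (dt U z + ∑ i, (dx i (dx i U) z - b i z * dx i U z)) ≤
            K * ζ z - (k * h z + f z) * ζ z * cutoff n z.2 := by
          have e1 : dt U z + ∑ i, (dx i (dx i U) z - b i z * dx i U z) ≤ K - (k * h z + f z) := by
            rw [Finset.sum_sub_distrib]
            linarith [S.equation z hz0, S.lower z hz0]
          have e2 := mul_le_mul_of_nonneg_left e1 (mul_nonneg hζz hχ0)
          have e3 : K * (ζ z * cutoff n z.2) ≤ K * ζ z :=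
            mul_le_mul_of_nonneg_left (mul_le_of_le_one_right hζz (cutoff_le_one n _)) hK
          linarith
        have c2 : ∑ i, (-U z * ζ z * b i z * pd i (cutoff n) z.2
            + (1 - 1) * U z * dx i ζ z * pd i (cutoff n) z.2
            + (1 + 1) * ζ z * dx i U z * pd i (cutoff n) z.2
            + 1 * U z * ζ z * pd i (pd i (cutoff n)) z.2) ≤
            κ * (d * (W * (W + 3))) * ζ z := by
          have h1 : ∀ i : Fin d, -U z * ζ z * b i z * pd i (cutoff n) z.2
              + (1 - 1) * U z * dx i ζ z * pd i (cutoff n) z.2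
              + (1 + 1) * ζ z * dx i U z * pd i (cutoff n) z.2
              + 1 * U z * ζ z * pd i (pd i (cutoff n)) z.2 ≤ κ * (W * (W + 3)) * ζ z := by
            intro i
            have a0 : |U z * b i z * pd i (cutoff n) z.2| ≤ W * W * κ := by
              rw [abs_mul, abs_mul]
              exact mul_le_mul (mul_le_mul w1 (w3 i) (abs_nonneg _) hW0) ((hC n).first i _)
                (abs_nonneg _) (by positivity)
            have a1 : |dx i U z * pd i (cutoff n) z.2| ≤ W * κ := by
              rw [abs_mul]
              exact mul_le_mul (w2 i) ((hC n).first i _) (abs_nonneg _) hW0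
            have a2 : |U z * pd i (pd i (cutoff n)) z.2| ≤ W * κ := by
              rw [abs_mul]
              exact mul_le_mul w1 ((hC n).second i _) (abs_nonneg _) hW0
            have a3 := mul_le_mul_of_nonneg_right (_root_.abs_le.1 a0).1 hζz
            have a4 := mul_le_mul_of_nonneg_right (_root_.abs_le.1 a1).2 hζz
            have a5 := mul_le_mul_of_nonneg_right (_root_.abs_le.1 a2).2 hζz
            linarith
          refine (Finset.sum_le_sum fun i (_ : i ∈ Finset.univ) => h1 i).trans_eq ?_
          simp; ring
        rw [hL, add_mul K]
        linarith
    rw [integral_sub (iζ.const_mul L) (iE n), integral_const_mul] at b3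
    have b4 : ∫ z in slab (τ + δ n) (t n), ζ z ≤ Z :=
      setIntegral_mono_set hζ.integrable ((ae_restrict_mem hm).mono fun z hz => hpos z hz)
        (hsubn n).eventuallyLE
    have b5 := mul_le_mul_of_nonneg_left b4 hL0
    have b6 : K * Z ≤ K * (T * M) := by
      refine mul_le_mul_of_nonneg_left (hZle.trans ?_) hK
      exact mul_le_mul_of_nonneg_right (by linarith) hM
    have e1 : (M + C * (d * (W * (W + 3)) * Z)) / ((n : ℝ) + 1)
        = 1 / ((n : ℝ) + 1) * M + κ * (d * (W * (W + 3))) * Z := by rw [hκ]; ring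
    rw [e1]
    have e2 : L * Z = K * Z + κ * (d * (W * (W + 3))) * Z := by rw [hL]; ring
    linarith

/-- The truncated adjoint estimate for the derivatives of `U`, at a time `s` after the initial time:
the equation for `∂ⱼU` is tested against `ζ χ`, and the derivative of the source `f` is moved to
`ζ χ`. The last term is the error due to the cutoff. -/
theorem HamiltonJacobiSystem.abs_integral_slice_le (S : HamiltonJacobiSystem U f h b e T k K B)
    (hK : 0 ≤ K) (hB : 0 ≤ B) (hτ0 : 0 ≤ τ) (hζ : DriftDiffusion b ζ τ T)
    (hφ : DensityBound φ M) (h0 : HasInitialValue ζ τ φ) (j : Fin d) {W : ℝ}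
    (hW : ∀ z ∈ slab 0 T, |dx j U z| ≤ W ∧ ∀ i, |b i z| ≤ W)
    (ihζ : IntegrableOn (fun z => h z * ζ z) (slab τ T))
    (ifζ : IntegrableOn (fun z => f z * ζ z) (slab τ T))
    (ifish : IntegrableOn (fisher ζ) (slab τ T))
    (ifD : IntegrableOn (fun z => f z * |dx j ζ z|) (slab τ T))
    {χ : Space d → ℝ} {κ : ℝ} (hχ : TestFunction χ κ) (hχ1 : ∀ x, χ x ≤ 1) {s : ℝ}
    (hs : s ∈ Ioo τ T) :
    |∫ x, dx j U (s, x) * ζ (s, x) * χ x| ≤ B * M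
      + (∫ z in slab τ T, ((K + K * h z) * ζ z + f z * |dx j ζ z|))
      + κ * ∫ z in slab τ T, (f z * ζ z
          + d * (W * W * ζ z + 2 * W * (fisher ζ z + ζ z) + W * ζ z)) := by
  have hpos := hζ.nonneg hφ.integrable h0 hφ.nonneg
  have hM := hφ.bound_nonneg
  have hO := isOpen_slab (d := d) τ T
  have hm := measurableSet_slab (d := d) τ T
  have hκ : 0 ≤ κ := hχ.bound_nonneg j
  have hsub : (slab τ T : Set (ℝ × Space d)) ⊆ slab 0 T := slab_subset hτ0 le_rfl
  have hf := S.smooth_source.mono hsub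
  have hw : ContDiffOn ℝ ∞ (dx j U) (slab τ T) :=
    (contDiffOn_dx (isOpen_slab 0 T) S.smooth j).mono hsub
  have hW0 : 0 ≤ W :=
    (abs_nonneg _).trans (hW (s, 0) (hsub ((mem_slab (z := (s, (0 : Space d)))).2 hs))).1
  set P : ℝ × Space d → ℝ := fun z => (K + K * h z) * ζ z + f z * |dx j ζ z| with hP
  set Q : ℝ × Space d → ℝ := fun z =>
    f z * ζ z + d * (W * W * ζ z + 2 * W * (fisher ζ z + ζ z) + W * ζ z) with hQ
  have iζ := hζ.integrable
  have iP : IntegrableOn P (slab τ T) := by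
    have : IntegrableOn (fun z => K * ζ z + K * (h z * ζ z) + f z * |dx j ζ z|) (slab τ T) :=
      ((iζ.const_mul K).add (ihζ.const_mul K)).add ifD
    refine this.congr_fun (fun z _ => ?_) hm
    simp only [hP]; ring
  have iQ : IntegrableOn Q (slab τ T) :=
    ifζ.add ((((iζ.const_mul (W * W)).add ((ifish.add iζ).const_mul (2 * W))).add
      (iζ.const_mul W)).const_mul (d : ℝ))
  have pP : ∀ z ∈ slab τ T, 0 ≤ P z := fun z hz => add_nonneg
    (mul_nonneg (add_nonneg hK (mul_nonneg hK (S.energy_nonneg z (hsub hz)))) (hpos z hz))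
    (mul_nonneg (S.source_nonneg z (hsub hz)) (abs_nonneg _))
  have pQ : ∀ z ∈ slab τ T, 0 ≤ Q z := fun z hz => by
    have h1 := hpos z hz
    have h2 := fisher_nonneg hpos hz
    have h3 := S.source_nonneg z (hsub hz)
    positivity
  have hX := contDiffOn_snd hχ.smooth (slab τ T)
  have hfζ := hf.mul hζ.smooth
  have cχ0 := hχ.smooth.continuous
  have cχ1 := fun i => (contDiffOn_snd (contDiff_pd hχ.smooth i) (slab τ T)).continuousOn
  have cχ2 := fun i =>
    (contDiffOn_snd (contDiff_pd (contDiff_pd hχ.smooth i) i) (slab τ T)).continuousOn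
  have cw0 := hw.continuousOn
  have cwt := (contDiffOn_dt hO hw).continuousOn
  have cw1 := fun i => (contDiffOn_dx hO hw i).continuousOn
  have cw2 := fun i => (contDiffOn_dx hO (contDiffOn_dx hO hw i) i).continuousOn
  have ck0 := hζ.smooth.continuousOn
  have ck1 := fun i => (contDiffOn_dx hO hζ.smooth i).continuousOn
  have cb := fun i => (hζ.smooth_drift i).continuousOn
  have cf := hf.continuousOn
  have cf1 := (contDiffOn_dx hO hf j).continuousOn
  -- the estimate up to an intermediate time `t`
  have step : ∀ t, s ≤ t → t < T → |∫ x, dx j U (s, x) * ζ (s, x) * χ x| ≤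
      |∫ x, dx j U (t, x) * ζ (t, x) * χ x| + ((∫ z in slab τ T, P z)
        + κ * ∫ z in slab τ T, Q z) := by
    intro t hst ht
    have hsubt : (slab s t : Set (ℝ × Space d)) ⊆ slab τ T := slab_subset hs.1.le ht.le
    have id := hζ.duality_identity hw (-1) hχ.smooth hχ.compact hs.1 hst ht
    -- the integral of `∂ⱼ(f ζ χ)` vanishes
    have id2 := integral_slice_sub_integral_slice (F := fun _ => 0)
      (V := fun i z => if i = j then f z * ζ z * χ z.2 else 0) (K := tsupport χ) hχ.compact
      contDiffOn_const
      (fun i => by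
        by_cases hi : i = j
        · simpa only [hi, if_true] using hfζ.mul hX
        · simpa only [hi, if_false] using contDiffOn_const)
      (fun _ _ _ => rfl)
      (fun i z _ hz => by simp [image_eq_zero_of_notMem_tsupport hz]) hs.1 hst ht
    have e1 : ∀ z ∈ slab s t, (dt (fun _ : ℝ × Space d => (0 : ℝ)) z
        - ∑ i, dx i (fun z => if i = j then f z * ζ z * χ z.2 else 0) z) =
        -(ζ z * χ z.2 * dx j f z + f z * dx j ζ z * χ z.2 + f z * ζ z * pd j χ z.2) := by
      intro z hz
      have hz' := hsubt hz
      rw [Finset.sum_eq_single j (fun i _ hi => by simp [hi, dx]) (by simp)]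
      have df := differentiableAt_of_contDiffOn hO hf hz'
      have dζ := differentiableAt_of_contDiffOn hO hζ.smooth hz'
      have dX := differentiableAt_of_contDiffOn hO hX hz'
      simp only [if_true]
      rw [dx_mul (df.fun_mul dζ) dX, dx_mul df dζ, dx_snd_eq_pd hχ.smooth]
      simp only [dt, fderiv_fun_const, Pi.zero_apply, _root_.zero_apply]
      ring
    rw [setIntegral_congr_fun (measurableSet_slab s t) e1] at id2
    have v0 : ∀ z : ℝ × Space d, z.2 ∉ tsupport χ → χ z.2 = 0 ∧ (∀ i, pd i χ z.2 = 0) ∧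
        ∀ i, pd i (pd i χ) z.2 = 0 := fun z hz =>
      ⟨image_eq_zero_of_notMem_tsupport hz, fun i => pd_eq_zero_of_notMem _ hz,
        fun i => pd_eq_zero_of_notMem _ fun h => hz (tsupport_pd_subset i h)⟩
    have i1 : IntegrableOn (fun z => -(ζ z * χ z.2 * dx j f z + f z * dx j ζ z * χ z.2
        + f z * ζ z * pd j χ z.2)) (slab s t) := by
      refine integrableOn_slab_of_notMem_eq_zero (τ := τ) (T := T) (K := tsupport χ)
        ?_ hχ.compact (fun z _ hz => ?_) hs.1 ht
      · fun_prop
      obtain ⟨v1, v2, v3⟩ := v0 z hz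
      simp [v1, v2]
    have i2 : IntegrableOn (fun z => ζ z * χ z.2 * (dt (dx j U) z
        + ∑ i, (dx i (dx i (dx j U)) z - b i z * dx i (dx j U) z))
        + ∑ i, (-dx j U z * ζ z * b i z * pd i χ z.2
          + (-1 - 1) * dx j U z * dx i ζ z * pd i χ z.2
          + (-1 + 1) * ζ z * dx i (dx j U) z * pd i χ z.2
          + -1 * dx j U z * ζ z * pd i (pd i χ) z.2)) (slab s t) := by
      refine integrableOn_slab_of_notMem_eq_zero (τ := τ) (T := T) (K := tsupport χ)
        ?_ hχ.compact (fun z _ hz => ?_) hs.1 ht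
      · fun_prop
      obtain ⟨v1, v2, v3⟩ := v0 z hz
      simp [v1, v2, v3]
    have id3 : (∫ x, dx j U (t, x) * ζ (t, x) * χ x) - ∫ x, dx j U (s, x) * ζ (s, x) * χ x =
        ∫ z in slab s t, (ζ z * χ z.2 * e j z + f z * dx j ζ z * χ z.2
          + f z * ζ z * pd j χ z.2
          - ∑ i, (dx j U z * ζ z * b i z * pd i χ z.2 + 2 * dx j U z * dx i ζ z * pd i χ z.2
            + dx j U z * ζ z * pd i (pd i χ) z.2)) := by
      have : (0 : ℝ) = ∫ z in slab s t, -(ζ z * χ z.2 * dx j f z + f z * dx j ζ z * χ z.2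
        + f z * ζ z * pd j χ z.2) := by simpa using id2
      rw [id, ← sub_zero (∫ z in slab s t, _), this, ← integral_sub i2 i1]
      refine setIntegral_congr_fun (measurableSet_slab s t) fun z hz => ?_
      have e2 := S.equation_dx j z (hsub (hsubt hz))
      rw [e2, sub_neg_eq_add, sub_eq_add_neg (_ + _), ← Finset.sum_neg_distrib]
      have e3 : ∀ i, -dx j U z * ζ z * b i z * pd i χ z.2
          + (-1 - 1) * dx j U z * dx i ζ z * pd i χ z.2
          + (-1 + 1) * ζ z * dx i (dx j U) z * pd i χ z.2
          + -1 * dx j U z * ζ z * pd i (pd i χ) z.2 =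
          -(dx j U z * ζ z * b i z * pd i χ z.2 + 2 * dx j U z * dx i ζ z * pd i χ z.2
            + dx j U z * ζ z * pd i (pd i χ) z.2) := fun i => by ring
      rw [Finset.sum_congr rfl fun i _ => e3 i]
      ring
    have b1 : |∫ z in slab s t, (ζ z * χ z.2 * e j z + f z * dx j ζ z * χ z.2
          + f z * ζ z * pd j χ z.2
          - ∑ i, (dx j U z * ζ z * b i z * pd i χ z.2 + 2 * dx j U z * dx i ζ z * pd i χ z.2
            + dx j U z * ζ z * pd i (pd i χ) z.2))| ≤
        ∫ z in slab s t, (P z + κ * Q z) := by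
      rw [← Real.norm_eq_abs]
      refine norm_integral_le_of_norm_le (g := fun z => P z + κ * Q z)
        ((iP.mono_set hsubt).add ((iQ.mono_set hsubt).const_mul κ)) ?_
      filter_upwards [ae_restrict_mem (measurableSet_slab s t)] with z hz
      have hz' := hsubt hz
      have hz0 := hsub hz'
      obtain ⟨w1, w2⟩ := hW z hz0
      have q0 := hpos z hz'
      have q1 := hχ.nonneg z.2
      have q2 := S.source_nonneg z hz0
      have q3 := fisher_nonneg hpos hz'
      rw [Real.norm_eq_abs]
      have a1 : |ζ z * χ z.2 * e j z| ≤ (K + K * h z) * ζ z := by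
        rw [abs_mul, abs_of_nonneg (mul_nonneg q0 q1), mul_comm (K + K * h z)]
        refine mul_le_mul (mul_le_of_le_one_right q0 (hχ1 _)) (S.abs_le j z hz0) (abs_nonneg _) q0
      have a2 : |f z * dx j ζ z * χ z.2| ≤ f z * |dx j ζ z| := by
        rw [abs_mul, abs_mul, abs_of_nonneg q1, abs_of_nonneg q2]
        exact mul_le_of_le_one_right (by positivity) (hχ1 _)
      have a3 : |f z * ζ z * pd j χ z.2| ≤ κ * (f z * ζ z) := by
        rw [abs_mul, abs_of_nonneg (mul_nonneg q2 q0), mul_comm κ]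
        exact mul_le_mul_of_nonneg_left (hχ.first j _) (by positivity)
      have a4 : |∑ i, (dx j U z * ζ z * b i z * pd i χ z.2
          + 2 * dx j U z * dx i ζ z * pd i χ z.2 + dx j U z * ζ z * pd i (pd i χ) z.2)| ≤
          ∑ i : Fin d, κ * (W * W * ζ z + 2 * W * (fisher ζ z + ζ z) + W * ζ z) := by
        refine (Finset.abs_sum_le_sum_abs _ _).trans (Finset.sum_le_sum fun i _ => ?_)
        have c1 : |dx j U z * ζ z * b i z * pd i χ z.2| ≤ W * ζ z * W * κ := by
          rw [abs_mul, abs_mul, abs_mul, abs_of_nonneg q0]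
          have := w2 i
          have := hχ.first i z.2
          gcongr
        have c2 : |2 * dx j U z * dx i ζ z * pd i χ z.2| ≤ 2 * W * (fisher ζ z + ζ z) * κ := by
          rw [abs_mul, abs_mul, abs_mul, abs_two]
          have := abs_dx_le_fisher_add hpos hz' i
          have := hχ.first i z.2
          gcongr
        have c3 : |dx j U z * ζ z * pd i (pd i χ) z.2| ≤ W * ζ z * κ := by
          rw [abs_mul, abs_mul, abs_of_nonneg q0]
          have := hχ.second i z.2
          gcongr
        refine (abs_add_three _ _ _).trans ((add_le_add_three c1 c2 c3).trans_eq ?_)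
        ring
      refine (abs_sub _ _).trans ((add_le_add ((abs_add_three _ _ _).trans
        (add_le_add_three a1 a2 a3)) a4).trans_eq ?_)
      simp only [hP, hQ, Finset.sum_const, Finset.card_univ, Fintype.card_fin, nsmul_eq_mul]
      ring
    have b2 : ∫ z in slab s t, (P z + κ * Q z) ≤ (∫ z in slab τ T, P z)
        + κ * ∫ z in slab τ T, Q z := by
      rw [← integral_const_mul, ← integral_add iP (iQ.const_mul κ)]
      refine setIntegral_mono_set (iP.add (iQ.const_mul κ)) ?_ hsubt.eventuallyLE
      filter_upwards [ae_restrict_mem hm] with z hz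
      exact add_nonneg (pP z hz) (mul_nonneg hκ (pQ z hz))
    rw [← id3] at b1
    have := abs_sub_abs_le_abs_sub (∫ x, dx j U (s, x) * ζ (s, x) * χ x)
      (∫ x, dx j U (t, x) * ζ (t, x) * χ x)
    rw [abs_sub_comm] at this
    linarith
  refine le_of_forall_pos_le_add fun ε hε => ?_
  -- a time near `T` at which `∂ⱼU` is close to its terminal values on the support of `χ`
  obtain ⟨t, h1, h2⟩ := ((S.terminal _ hχ.compact (ε / (M + 1)) (by positivity)).and
    (Ioo_mem_nhdsLT hs.2)).exists
  have htT : t ∈ Ioo τ T := ⟨hs.1.trans h2.1, h2.2⟩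
  have mt := hζ.mass_le hφ.integrable h0 hφ.nonneg htT
  have hBε : 0 ≤ B + ε / (M + 1) := by positivity
  have b3 : |∫ x, dx j U (t, x) * ζ (t, x) * χ x| ≤ (B + ε / (M + 1)) * M := by
    have : |∫ x, dx j U (t, x) * ζ (t, x) * χ x| ≤ ∫ x, (B + ε / (M + 1)) * ζ (t, x) := by
      rw [← Real.norm_eq_abs]
      refine norm_integral_le_of_norm_le (mt.1.const_mul _) (ae_of_all _ fun x => ?_)
      have hz := hpos (t, x) (mem_slab.2 htT)
      by_cases hx : x ∈ tsupport χ
      · rw [Real.norm_eq_abs, abs_mul, abs_mul, abs_of_nonneg hz, abs_of_nonneg (hχ.nonneg x)]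
        calc _ ≤ |dx j U (t, x)| * ζ (t, x) :=
              mul_le_of_le_one_right (by positivity) (hχ1 x)
          _ ≤ _ := mul_le_mul_of_nonneg_right ((h1 x hx).2 j) hz
      · simp only [image_eq_zero_of_notMem_tsupport hx, mul_zero, norm_zero]
        positivity
    refine this.trans ?_
    rw [integral_const_mul]
    exact mul_le_mul_of_nonneg_left (mt.2.trans hφ.mass_le) hBε
  have b4 : ε / (M + 1) * M ≤ ε := by
    rw [div_mul_eq_mul_div, div_le_iff₀ (by positivity)]
    nlinarith
  have := step t h2.1.le h2.2
  linarith

/-- The adjoint estimate for the derivatives of `U` at the initial time of the adjoint density. -/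
theorem HamiltonJacobiSystem.abs_integral_le (S : HamiltonJacobiSystem U f h b e T k K B)
    (hK : 0 ≤ K) (hB : 0 ≤ B) (hτ0 : 0 ≤ τ) (hτ : τ < T) (hζ : DriftDiffusion b ζ τ T)
    (hφ : DensityBound φ M) (h0 : HasInitialValue ζ τ φ) (j : Fin d)
    (ihζ : IntegrableOn (fun z => h z * ζ z) (slab τ T))
    (ifζ : IntegrableOn (fun z => f z * ζ z) (slab τ T))
    (ifish : IntegrableOn (fisher ζ) (slab τ T))
    (ifD : IntegrableOn (fun z => f z * |dx j ζ z|) (slab τ T)) {w₀ : Space d → ℝ}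
    (hw₀ : Continuous w₀) (hw : ∀ x, Tendsto (fun s => dx j U (s, x)) (𝓝[>] τ) (𝓝 (w₀ x))) :
    |∫ x, w₀ x * φ x| ≤ B * M
      + ∫ z in slab τ T, ((K + K * h z) * ζ z + f z * |dx j ζ z|) := by
  obtain ⟨W, hW⟩ := S.bounded
  obtain ⟨C, hC0, hC⟩ := exists_testFunction_cutoff d
  have hev : ∀ᶠ s in 𝓝[>] τ, s ∈ Ioo τ T := Ioo_mem_nhdsGT hτ
  have mem0 : ∀ {s : ℝ} (x : Space d), s ∈ Ioo τ T → (s, x) ∈ slab 0 T := fun x hs =>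
    mem_slab.2 ⟨hτ0.trans_lt hs.1, hs.2⟩
  have hw₀W : ∀ x, |w₀ x| ≤ W := fun x =>
    le_of_tendsto (hw x).abs (hev.mono fun s hs => (hW _ (mem0 x hs)).2.1 j)
  have hW0 : 0 ≤ W := (abs_nonneg _).trans (hw₀W 0)
  have cw : ∀ s ∈ Ioo τ T, Continuous fun x => dx j U (s, x) := fun s hs =>
    continuous_slice (contDiffOn_dx (isOpen_slab 0 T) S.smooth j).continuousOn
      ⟨hτ0.trans_lt hs.1, hs.2⟩
  set Q : ℝ := ∫ z in slab τ T, (f z * ζ z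
    + d * (W * W * ζ z + 2 * W * (fisher ζ z + ζ z) + W * ζ z)) with hQ
  set P : ℝ := B * M + ∫ z in slab τ T, ((K + K * h z) * ζ z + f z * |dx j ζ z|) with hP
  have bχ : ∀ (n : ℕ) (x : Space d), ‖cutoff n x‖ ≤ 1 := fun n x => by
    rw [Real.norm_of_nonneg (cutoff_nonneg n x)]; exact cutoff_le_one n x
  have step : ∀ n : ℕ, |∫ x, w₀ x * φ x * cutoff n x| ≤ P + C * Q / ((n : ℝ) + 1) := by
    intro n
    have cχ := (contDiff_cutoff (d := d) n).continuous
    -- as `s ↓ τ`, the density converges in `L¹` and the derivatives of `U` converge pointwise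
    have l1 : Tendsto (fun s => ∫ x, dx j U (s, x) * cutoff n x * (ζ (s, x) - φ x)) (𝓝[>] τ)
        (𝓝 (∫ _ : Space d, (0 : ℝ))) := by
      have hb : ∀ s ∈ Ioo τ T, ∀ x, ‖dx j U (s, x) * cutoff n x‖ ≤ W := fun s hs x => by
        rw [norm_mul]
        exact (mul_le_of_le_one_right (norm_nonneg _) (bχ n x)).trans
          ((hW _ (mem0 x hs)).2.1 j)
      refine h0.tendsto_integral (M := W) hW0 (hev.mono fun s hs => ?_) (integrable_zero _ _ _)
        (hev.mono fun s hs x => ?_)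
      · exact ((hζ.mass_le hφ.integrable h0 hφ.nonneg hs).1.sub hφ.integrable).bdd_mul
          ((cw s hs).mul cχ).aestronglyMeasurable (ae_of_all _ (hb s hs))
      · rw [sub_zero, abs_mul]
        exact mul_le_mul_of_nonneg_right (hb s hs x) (abs_nonneg _)
    have l2 : Tendsto (fun s => ∫ x, dx j U (s, x) * φ x * cutoff n x) (𝓝[>] τ)
        (𝓝 (∫ x, w₀ x * φ x * cutoff n x)) := by
      refine tendsto_integral_filter_of_dominated_convergence (fun x => W * φ x)
        (hev.mono fun s hs => (((cw s hs).aestronglyMeasurable.mul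
          hφ.integrable.aestronglyMeasurable).mul cχ.aestronglyMeasurable))
        (hev.mono fun s hs => ae_of_all _ fun x => ?_) (hφ.integrable.const_mul W)
        (ae_of_all _ fun x => ((hw x).mul_const _).mul_const _)
      rw [norm_mul, norm_mul, Real.norm_of_nonneg (hφ.nonneg x)]
      exact (mul_le_of_le_one_right (mul_nonneg (norm_nonneg _) (hφ.nonneg x)) (bχ n x)).trans
        (mul_le_mul_of_nonneg_right ((hW _ (mem0 x hs)).2.1 j) (hφ.nonneg x))
    have l3 := (l1.add l2).abs
    rw [integral_zero, zero_add] at l3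
    refine le_of_tendsto l3 (hev.mono fun s hs => ?_)
    have hb : ∀ x, ‖dx j U (s, x) * cutoff n x‖ ≤ W := fun x => by
      rw [norm_mul]
      exact (mul_le_of_le_one_right (norm_nonneg _) (bχ n x)).trans ((hW _ (mem0 x hs)).2.1 j)
    have i1 : Integrable fun x => dx j U (s, x) * cutoff n x * (ζ (s, x) - φ x) :=
      ((hζ.mass_le hφ.integrable h0 hφ.nonneg hs).1.sub hφ.integrable).bdd_mul
      ((cw s hs).mul cχ).aestronglyMeasurable (ae_of_all _ hb)
    have i2 := hφ.integrable.bdd_mul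
      ((cw s hs).mul cχ).aestronglyMeasurable (ae_of_all _ hb)
    have i2' : Integrable fun x => dx j U (s, x) * φ x * cutoff n x :=
      i2.congr (ae_of_all _ fun x => by simp only [Pi.mul_apply]; ring)
    rw [← integral_add i1 i2']
    have key := S.abs_integral_slice_le hK hB hτ0 hζ hφ h0 j (fun z hz => ⟨(hW z hz).2.1 j,
      (hW z hz).2.2⟩) ihζ ifζ ifish ifD (hC n) (cutoff_le_one n) hs
    have e1 : ∀ x, dx j U (s, x) * cutoff n x * (ζ (s, x) - φ x)
        + dx j U (s, x) * φ x * cutoff n x = dx j U (s, x) * ζ (s, x) * cutoff n x :=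
      fun x => by ring
    have e2 : C * Q / ((n : ℝ) + 1) = C / (n + 1) * Q := by ring
    simp only [e1]
    rw [e2]
    exact key
  have l4 : Tendsto (fun n : ℕ => |∫ x, w₀ x * φ x * cutoff n x|) atTop
      (𝓝 |∫ x, w₀ x * φ x|) := by
    refine Tendsto.abs (tendsto_integral_of_dominated_convergence (fun x => W * φ x)
      (fun n => (hw₀.aestronglyMeasurable.mul hφ.integrable.aestronglyMeasurable).mul
        (contDiff_cutoff n).continuous.aestronglyMeasurable) (hφ.integrable.const_mul W)
      (fun n => ae_of_all _ fun x => ?_) (ae_of_all _ fun x => ?_))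
    · rw [norm_mul, norm_mul, Real.norm_of_nonneg (hφ.nonneg x)]
      exact (mul_le_of_le_one_right (mul_nonneg (norm_nonneg _) (hφ.nonneg x)) (bχ n x)).trans
        (mul_le_mul_of_nonneg_right (hw₀W x) (hφ.nonneg x))
    · simpa using (tendsto_cutoff x).const_mul (w₀ x * φ x)
  have l5 : Tendsto (fun n : ℕ => P + C * Q / ((n : ℝ) + 1)) atTop (𝓝 P) := by
    simpa using (tendsto_const_div_succ (C * Q)).const_add P
  exact le_of_tendsto_of_tendsto' l4 l5 step

end adjoint

theorem mixedNorm_mono_left {c a s s' t : ℝ} (hc : 0 < c) (hs : s' ≤ s) (f : ℝ → Space d → ℝ) :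
    mixedNorm c a s t f ≤ mixedNorm c a s' t f :=
  ENNReal.rpow_le_rpow (lintegral_mono_set (Ioo_subset_Ioo_left hs)) (by positivity)

/-- The gradient estimate for solutions of Hamilton-Jacobi equations: the derivatives of `U`,
averaged against an initial density, are controlled by a mixed norm of the source. -/
theorem exists_gradient_bound (hd : 2 < d) {a c T k K B M : ℝ} (hc : 2 < c)
    (ha : c * d / (c - 2) ≤ a) (hT : 0 < T) (hk : 0 < k) (hK : 0 ≤ K) (hB : 0 ≤ B)
    (hM : 0 ≤ M) :
    ∃ C : ℝ, 0 ≤ C ∧ ∀ {U f h : ℝ × Space d → ℝ} {b e : Fin d → ℝ × Space d → ℝ} {τ : ℝ}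
      {ζ : ℝ × Space d → ℝ} {φ : Space d → ℝ},
      HamiltonJacobiSystem U f h b e T k K B → 0 ≤ τ → τ < T → DriftDiffusion b ζ τ T →
      DensityBound φ M → HasInitialValue ζ τ φ →
      mixedNorm c a 0 T (fun t x => f (t, x)) ≠ ⊤ → ∀ (j : Fin d) {w₀ : Space d → ℝ},
      Continuous w₀ → (∀ x, Tendsto (fun s => dx j U (s, x)) (𝓝[>] τ) (𝓝 (w₀ x))) →
      |∫ x, w₀ x * φ x| ≤ C * (1 + (mixedNorm c a 0 T (fun t x => f (t, x))).toReal
        + (mixedNorm c a 0 T (fun t x => f (t, x))).toReal ^ (2 - 1 / c)) := by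
  obtain ⟨C₁, hC₁0, hC₁⟩ := exists_upper_bound (T := T) hd hc ha
  obtain ⟨C₂, hC₂0, hC₂⟩ := exists_fisher_bound d
  obtain ⟨K₃, hK₃⟩ := exists_lintegral_mul_gradient_le hd hc ha M.toNNReal
  set A : ℝ := 2 * B * M + C₁ * M + K * (T * M) with hA
  set A₁ : ℝ := (d + K) * (T * M) + K * (A / k) with hA₁
  set A₂ : ℝ := C₂ * (1 + 2 * M + A₁) with hA₂
  set A₃ : ℝ := 1 + T + A₂ with hA₃
  have hA0 : 0 ≤ A := by positivity
  have hA₁0 : 0 ≤ A₁ := by positivity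
  have hA₂0 : 0 ≤ A₂ := by positivity
  have hA₃1 : 1 ≤ A₃ := by linarith
  have hK₃0 : 0 ≤ (K₃ : ℝ) := K₃.2
  refine ⟨B * M + K * (T * M) + K * (A / k) + K₃ * A₃, by positivity,
    fun {U f h b e τ ζ φ} S hτ0 hτ hζ hφ h0 hfin j {w₀} hw₀ hw => ?_⟩
  set G : ℝ := (mixedNorm c a 0 T (fun t x => f (t, x))).toReal with hG
  have hG0 : 0 ≤ G := ENNReal.toReal_nonneg
  have hc0 : 0 < c := by linarith
  have hm := measurableSet_slab (d := d) τ T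
  have hsub : (slab τ T : Set (ℝ × Space d)) ⊆ slab 0 T := slab_subset hτ0 le_rfl
  have hpos := hζ.nonneg hφ.integrable h0 hφ.nonneg
  have hf0 := fun z hz => S.source_nonneg z (hsub hz)
  have hh0 := fun z hz => S.energy_nonneg z (hsub hz)
  have cf := S.smooth_source.continuousOn.mono hsub
  have ch := S.continuous_energy.mono hsub
  have cζ := hζ.smooth.continuousOn
  have iζ := hζ.integrable
  have hZ : ∫ z in slab τ T, ζ z ≤ T * M := (hζ.integral_slab_le hφ h0 hτ).trans
    (mul_le_mul_of_nonneg_right (by linarith) hM)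
  -- the upper bound for `U` and the energy estimate
  obtain ⟨W, hW⟩ := S.bounded
  have hY : ∀ z ∈ slab 0 T, U z ≤ B + C₁ * G := by
    refine hC₁ (W := W) S.smooth S.smooth_source.continuousOn hB (fun z hz => (hW z hz).1)
      (fun z hz => (hW z hz).2.1) (fun z hz => ?_) (fun Q hQ η hη => ?_) hfin
    · rw [S.equation z hz, abs_of_nonneg (S.source_nonneg z hz)]
      linarith [S.energy_nonneg z hz]
    · exact (S.terminal Q hQ η hη).mono fun t ht x hx => (le_abs_self _).trans (ht x hx).1
  obtain ⟨iE, hE⟩ := S.integral_energy_le hk hK hB hτ0 hτ hζ hφ h0 (by positivity) hY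
  have hE' : ∫ z in slab τ T, (k * h z + f z) * ζ z ≤ A * (1 + G) := by
    refine hE.trans ?_
    have : 0 ≤ (2 * B * M + K * (T * M)) * G + C₁ * M := by positivity
    rw [hA]; linarith
  have ihζ : IntegrableOn (fun z => h z * ζ z) (slab τ T) := by
    refine (iE.const_mul (1 / k)).mono' ((ch.mul cζ).aestronglyMeasurable hm) ?_
    filter_upwards [ae_restrict_mem hm] with z hz
    have h1 := hpos z hz
    have h2 := hh0 z hz
    have h3 := hf0 z hz
    rw [Real.norm_of_nonneg (by positivity)]
    have : 1 / k * ((k * h z + f z) * ζ z) = h z * ζ z + 1 / k * (f z * ζ z) := by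
      field_simp
    rw [this]
    linarith [show 0 ≤ 1 / k * (f z * ζ z) by positivity]
  have ifζ : IntegrableOn (fun z => f z * ζ z) (slab τ T) := by
    refine iE.mono' ((cf.mul cζ).aestronglyMeasurable hm) ?_
    filter_upwards [ae_restrict_mem hm] with z hz
    have h1 := hpos z hz
    have h2 := hh0 z hz
    have h3 := hf0 z hz
    rw [Real.norm_of_nonneg (by positivity), add_mul]
    linarith [show 0 ≤ k * h z * ζ z by positivity]
  have hhζ : ∫ z in slab τ T, h z * ζ z ≤ A / k * (1 + G) := by
    have : k * ∫ z in slab τ T, h z * ζ z ≤ ∫ z in slab τ T, (k * h z + f z) * ζ z := by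
      rw [← integral_const_mul]
      refine setIntegral_mono_on (ihζ.const_mul k) iE hm fun z hz => ?_
      linarith [mul_nonneg (hf0 z hz) (hpos z hz)]
    rw [div_mul_eq_mul_div, le_div_iff₀ hk]
    linarith
  -- the Fisher information
  have hdrift : ∫ z in slab τ T, ζ z * ∑ i, (1 + b i z ^ 2) ≤ A₁ * (1 + G) := by
    have h1 : ∫ z in slab τ T, ζ z * ∑ i, (1 + b i z ^ 2) ≤
        ∫ z in slab τ T, ((d + K) * ζ z + K * (h z * ζ z)) := by
      refine integral_mono_of_nonneg ?_ ((iζ.const_mul _).add (ihζ.const_mul K)) ?_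
      · filter_upwards [ae_restrict_mem hm] with z hz
        exact mul_nonneg (hpos z hz) (Finset.sum_nonneg fun i _ => by positivity)
      · filter_upwards [ae_restrict_mem hm] with z hz
        have h2 : ∑ i, (1 + b i z ^ 2) ≤ d + (K + K * h z) := by
          rw [Finset.sum_add_distrib]
          simpa using S.drift_le z (hsub hz)
        have h3 := mul_le_mul_of_nonneg_left h2 (hpos z hz)
        linarith
    rw [integral_add (iζ.const_mul _) (ihζ.const_mul K), integral_const_mul,
      integral_const_mul] at h1
    have h2 := mul_le_mul_of_nonneg_left hZ (by positivity : 0 ≤ (d : ℝ) + K)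
    have h3 := mul_le_mul_of_nonneg_left hhζ hK
    have h4 : 0 ≤ (d + K) * (T * M) * G := by positivity
    rw [hA₁]; linarith
  obtain ⟨ifish, hfish⟩ := hC₂ hτ hζ hφ.integrable h0 hφ.nonneg hφ.integrable_weight
    hφ.integrable_entropy
  have hfish' : ∫ z in slab τ T, fisher ζ z ≤ A₂ * (1 + G) := by
    refine hfish.trans ?_
    rw [hA₂, mul_assoc]
    refine mul_le_mul_of_nonneg_left ?_ hC₂0
    have h4 : 0 ≤ (1 + 2 * M) * G := by positivity
    linarith [hφ.entropy_le, hφ.weight_le]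
  -- the interpolation inequality
  have hθ0 : 0 ≤ 1 - 1 / c := by
    rw [sub_nonneg, div_le_one hc0]; linarith
  have hθ1 : 1 - 1 / c ≤ 1 := by linarith [show 0 ≤ 1 / c by positivity]
  have hfD : ∫⁻ z in slab τ T, ENNReal.ofReal (f z * |dx j ζ z|) ≤
      ENNReal.ofReal (K₃ * A₃ * (G + G ^ (2 - 1 / c))) := by
    have h1 : ∫⁻ z in slab τ T, ENNReal.ofReal (f z * |dx j ζ z|) ≤
        ∫⁻ z in slab τ T, ‖f z‖ₑ * ENNReal.ofReal √(∑ i, dx i ζ z ^ 2) := by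
      refine setLIntegral_mono' hm fun z hz => ?_
      rw [ENNReal.ofReal_mul (hf0 z hz), Real.enorm_of_nonneg (hf0 z hz)]
      gcongr
      rw [← Real.sqrt_sq_eq_abs]
      exact Real.sqrt_le_sqrt (Finset.single_le_sum (f := fun i => dx i ζ z ^ 2)
        (fun i _ => sq_nonneg _) (Finset.mem_univ j))
    have h2 := hK₃ hζ.smooth hpos (fun t ht => by
      have := hζ.mass_le hφ.integrable h0 hφ.nonneg ht
      exact ⟨this.1, this.2.trans (hφ.mass_le.trans (Real.le_coe_toNNReal M))⟩) cf
    have h3 : ENNReal.ofReal (T - τ) + ∫⁻ z in slab τ T, ENNReal.ofReal (fisher ζ z) ≤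
        ENNReal.ofReal (A₃ * (1 + G)) := by
      rw [← ofReal_integral_eq_lintegral_ofReal ifish ((ae_restrict_mem hm).mono fun z hz =>
        fisher_nonneg hpos hz), ← ENNReal.ofReal_add (by linarith)
        (setIntegral_nonneg hm fun z hz => fisher_nonneg hpos hz)]
      refine ENNReal.ofReal_le_ofReal ?_
      have : 0 ≤ (1 + T) * G := by positivity
      rw [hA₃]; linarith
    have h4 : mixedNorm c a τ T (fun t x => f (t, x)) ≤ ENNReal.ofReal G :=
      (mixedNorm_mono_left hc0 hτ0 _).trans_eq (ENNReal.ofReal_toReal hfin).symm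
    have h5 : (A₃ * (1 + G)) ^ (1 - 1 / c) ≤ A₃ * (1 + G ^ (1 - 1 / c)) := by
      rw [Real.mul_rpow (by positivity) (by positivity)]
      refine mul_le_mul (Real.rpow_le_self_of_one_le hA₃1 hθ1) ?_ (by positivity) (by positivity)
      simpa using Real.rpow_add_le_add_rpow zero_le_one hG0 hθ0 hθ1
    have h6 : G * G ^ (1 - 1 / c) = G ^ (2 - 1 / c) := by
      rw [← Real.rpow_one_add' hG0 (by linarith)]
      ring_nf
    calc _ ≤ _ := h1
      _ ≤ _ := h2
      _ ≤ K₃ * ENNReal.ofReal G * ENNReal.ofReal (A₃ * (1 + G)) ^ (1 - 1 / c) := by gcongr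
      _ = ENNReal.ofReal (K₃ * G * (A₃ * (1 + G)) ^ (1 - 1 / c)) := by
        rw [ENNReal.ofReal_rpow_of_nonneg (by positivity) hθ0,
          ENNReal.ofReal_mul (by positivity), ENNReal.ofReal_mul hK₃0, ENNReal.ofReal_coe_nnreal]
      _ ≤ _ := by
        refine ENNReal.ofReal_le_ofReal ?_
        rw [← h6]
        calc _ ≤ K₃ * G * (A₃ * (1 + G ^ (1 - 1 / c))) :=
              mul_le_mul_of_nonneg_left h5 (by positivity)
          _ = _ := by ring
  have pD : ∀ z ∈ slab τ T, 0 ≤ f z * |dx j ζ z| := fun z hz =>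
    mul_nonneg (hf0 z hz) (abs_nonneg _)
  have mD : AEStronglyMeasurable (fun z => f z * |dx j ζ z|) (volume.restrict (slab τ T)) :=
    (cf.mul (contDiffOn_dx (isOpen_slab τ T) hζ.smooth j).continuousOn.abs).aestronglyMeasurable hm
  have ifD : IntegrableOn (fun z => f z * |dx j ζ z|) (slab τ T) := by
    refine ⟨mD, ?_⟩
    rw [hasFiniteIntegral_iff_ofReal ((ae_restrict_mem hm).mono fun z hz => pD z hz)]
    exact hfD.trans_lt ENNReal.ofReal_lt_top
  have hfD' : ∫ z in slab τ T, f z * |dx j ζ z| ≤ K₃ * A₃ * (G + G ^ (2 - 1 / c)) := by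
    rw [integral_eq_lintegral_of_nonneg_ae ((ae_restrict_mem hm).mono fun z hz => pD z hz) mD]
    exact ENNReal.toReal_le_of_le_ofReal (by positivity) hfD
  have key := S.abs_integral_le hK hB hτ0 hτ hζ hφ h0 j ihζ ifζ ifish ifD hw₀ hw
  have e1 : ∫ z in slab τ T, ((K + K * h z) * ζ z + f z * |dx j ζ z|) =
      K * (∫ z in slab τ T, ζ z) + K * (∫ z in slab τ T, h z * ζ z)
        + ∫ z in slab τ T, f z * |dx j ζ z| := by
    have i1 : IntegrableOn (fun z => K * ζ z + K * (h z * ζ z)) (slab τ T) :=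
      (iζ.const_mul K).add (ihζ.const_mul K)
    rw [← integral_const_mul, ← integral_const_mul, ← integral_add (iζ.const_mul K)
      (ihζ.const_mul K), ← integral_add i1 ifD]
    refine integral_congr_ae (ae_of_all _ fun z => ?_)
    ring
  rw [e1] at key
  have h2 := mul_le_mul_of_nonneg_left hZ hK
  have h3 := mul_le_mul_of_nonneg_left hhζ hK
  have h4 : 0 ≤ (B * M + K * (T * M)) * (G + G ^ (2 - 1 / c))
      + K * (A / k) * G ^ (2 - 1 / c) + K₃ * A₃ := by positivity
  linarith

end MFG

end

noncomputable section

namespace MFG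

variable {d : ℕ}

/-! ### The Hamiltonian -/

section hamiltonian

variable {H : Space d → Space d → ℝ}

theorem pd_eq_fderiv_uncurry (hH : ContDiff ℝ ∞ fun z : Space d × Space d => H z.1 z.2)
    (x p : Space d) (i : Fin d) : pd i (H x) p =
      fderiv ℝ (fun z : Space d × Space d => H z.1 z.2) (x, p) (0, EuclideanSpace.single i 1) := by
  have h : HasFDerivAt (H x) ((fderiv ℝ (fun z : Space d × Space d => H z.1 z.2) (x, p)).comp
      (ContinuousLinearMap.inr ℝ (Space d) (Space d))) p :=
    ((hH.differentiable (by simp) (x, p)).hasFDerivAt).comp p (hasFDerivAt_prodMk_right x p)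
  rw [pd, h.fderiv]
  simp

theorem pd_fst_eq_fderiv_uncurry (hH : ContDiff ℝ ∞ fun z : Space d × Space d => H z.1 z.2)
    (x p : Space d) (i : Fin d) : pd i (fun y => H y p) x =
      fderiv ℝ (fun z : Space d × Space d => H z.1 z.2) (x, p) (EuclideanSpace.single i 1, 0) := by
  have h : HasFDerivAt (fun y => H y p)
      ((fderiv ℝ (fun z : Space d × Space d => H z.1 z.2) (x, p)).comp
      (ContinuousLinearMap.inl ℝ (Space d) (Space d))) x :=
    HasFDerivAt.comp (f := fun y => (y, p)) x ((hH.differentiable (by simp) (x, p)).hasFDerivAt)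
      (hasFDerivAt_prodMk_left x p)
  rw [pd, h.fderiv]
  simp

theorem sum_smul_single (v : Space d) : ∑ i, v i • EuclideanSpace.single i (1 : ℝ) = v := by
  have := (EuclideanSpace.basisFun (Fin d) ℝ).sum_repr v
  simpa using this

/-- The square root of `1 + H(x,·)` is Lipschitz continuous, so `H` is bounded for bounded
momenta. -/
theorem hamiltonian_le (hH : ContDiff ℝ ∞ fun z : Space d × Space d => H z.1 z.2)
    (h0 : ∀ x p, 0 ≤ H x p) {k K : ℝ} (hk : 0 < k) (hK : 0 < K)
    (hlow : ∀ x p, k * H x p - K ≤ inner ℝ (gradP H x p) p - H x p)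
    (hgrad : ∀ x p, ‖gradP H x p‖ ^ 2 ≤ K + K * H x p) (x p : Space d) :
    H x p ≤ (√(1 + K) + √K * ‖p‖) ^ 2 := by
  have hdiff : Differentiable ℝ (H x) :=
    (hH.comp (contDiff_prodMk_right x)).differentiable (by simp)
  have hder : ∀ q ∈ (univ : Set (Space d)), HasFDerivWithinAt (fun q => √(1 + H x q))
      ((1 / (2 * √(1 + H x q))) • fderiv ℝ (H x) q) univ q := fun q _ =>
    (((hdiff q).hasFDerivAt.const_add 1).sqrt (by linarith [h0 x q])).hasFDerivWithinAt
  have hbd : ∀ q ∈ (univ : Set (Space d)),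
      ‖(1 / (2 * √(1 + H x q))) • fderiv ℝ (H x) q‖ ≤ √K := by
    intro q _
    have h1 : 0 < 1 + H x q := by linarith [h0 x q]
    have h2 : ‖fderiv ℝ (H x) q‖ ≤ √K * √(1 + H x q) := by
      rw [← toDual_gradient, LinearIsometryEquiv.norm_map, ← Real.sqrt_mul hK.le]
      exact Real.le_sqrt_of_sq_le ((hgrad x q).trans_eq (by ring))
    rw [norm_smul, Real.norm_of_nonneg (by positivity), div_mul_eq_mul_div, one_mul,
      div_le_iff₀ (by positivity)]
    have h3 : 0 ≤ √K * √(1 + H x q) := by positivity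
    linarith
  have hlip := convex_univ.norm_image_sub_le_of_norm_hasFDerivWithin_le hder hbd
    (mem_univ 0) (mem_univ p)
  -- at `p = 0` the lower bound for `D_pH · p - H` becomes an upper bound for `H`
  have hH0 : H x 0 ≤ K := by
    have := hlow x 0
    rw [inner_zero_right] at this
    nlinarith [h0 x 0, mul_nonneg hk.le (h0 x 0)]
  have h4 : √(1 + H x 0) ≤ √(1 + K) := Real.sqrt_le_sqrt (by linarith)
  have h5 : √(1 + H x p) ≤ √(1 + K) + √K * ‖p‖ := by
    rw [sub_zero] at hlip
    have := (le_abs_self _).trans hlip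
    linarith
  have h6 := Real.sq_sqrt (by linarith [h0 x p] : 0 ≤ 1 + H x p)
  have := pow_le_pow_left₀ (Real.sqrt_nonneg _) h5 2
  linarith

end hamiltonian

/-! ### Classical solutions of the mean-field game -/

/-- The spatial gradient of a function on space-time. -/
def grad (U : ℝ × Space d → ℝ) (z : ℝ × Space d) : Space d := WithLp.toLp 2 fun i => dx i U z

theorem grad_apply (U : ℝ × Space d → ℝ) (z : ℝ × Space d) (i : Fin d) :
    grad U z i = dx i U z := rfl

theorem contDiffOn_grad {U : ℝ × Space d → ℝ} {O : Set (ℝ × Space d)} (hO : IsOpen O)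
    (hU : ContDiffOn ℝ ∞ U O) : ContDiffOn ℝ ∞ (grad U) O :=
  contDiffOn_euclidean.2 fun i => contDiffOn_dx hO hU i

section slices

variable {U : ℝ × Space d → ℝ} {s t : ℝ} {r : ℝ}

theorem gradient_slice (hU : ContDiffOn ℝ ∞ U (slab s t)) (hr : r ∈ Ioo s t) (x : Space d) :
    ∇ (fun y => U (r, y)) x = grad U (r, x) := by
  ext i
  rw [gradient_apply, grad_apply, pd, fderiv_slice
    (differentiableAt_of_contDiffOn (isOpen_slab s t) hU (mem_slab.2 hr))]

theorem contDiff_slice (hU : ContDiffOn ℝ ∞ U (slab s t)) (hr : r ∈ Ioo s t) :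
    ContDiff ℝ ∞ fun y => U (r, y) := by
  rw [← contDiffOn_univ]
  exact hU.comp (contDiff_prodMk_right r).contDiffOn fun x _ => mem_slab.2 hr

theorem laplacian_slice (hU : ContDiffOn ℝ ∞ U (slab s t)) (hr : r ∈ Ioo s t) (x : Space d) :
    Δ (fun y => U (r, y)) x = ∑ i, dx i (dx i U) (r, x) := by
  have hO := isOpen_slab (d := d) s t
  rw [InnerProductSpace.laplacian_eq_iteratedFDeriv_orthonormalBasis _
    (EuclideanSpace.basisFun (Fin d) ℝ)]
  refine Finset.sum_congr rfl fun i _ => ?_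
  rw [← fderiv_slice (differentiableAt_of_contDiffOn hO (contDiffOn_dx hO hU i) (mem_slab.2 hr)),
    iteratedFDeriv_two_apply]
  have h1 : (fun y => dx i U (r, y)) = fun y =>
      fderiv ℝ (fun y => U (r, y)) y (EuclideanSpace.single i 1) := funext fun y =>
    (fderiv_slice (differentiableAt_of_contDiffOn hO hU (mem_slab.2 hr)) i).symm
  have h2 : DifferentiableAt ℝ (fderiv ℝ fun y => U (r, y)) x :=
    ((contDiff_slice hU hr).fderiv_right (m := ∞) (by simp)).differentiable (by simp) x
  rw [h1, fderiv_clm_apply h2 (by simp)]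
  simp

/-- A function which is continuous up to the end times is uniformly close to its value at a given
time on compact sets. -/
theorem eventually_forall_abs_sub_lt {F : ℝ × Space d → ℝ} {T : ℝ}
    (hF : ContinuousOn F (Icc 0 T ×ˢ univ)) (hr : r ∈ Icc 0 T) {S : Set (Space d)}
    (hS : IsCompact S) {η : ℝ} (hη : 0 < η) :
    ∀ᶠ q in 𝓝[Icc 0 T] r, ∀ x ∈ S, |F (q, x) - F (r, x)| < η := by
  have hc := (isCompact_Icc.prod hS).uniformContinuousOn_of_continuous
    (hF.mono (prod_mono_right (subset_univ S)))
  obtain ⟨δ, hδ, h⟩ := Metric.uniformContinuousOn_iff.1 hc η hη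
  filter_upwards [self_mem_nhdsWithin, mem_nhdsWithin_of_mem_nhds (Metric.ball_mem_nhds r hδ)]
    with q hq1 hq2 x hx
  refine h (q, x) ⟨hq1, hx⟩ (r, x) ⟨hr, hx⟩ ?_
  rw [Prod.dist_eq, dist_self, max_eq_left dist_nonneg]
  exact hq2

/-- The spatial derivatives of a function which is smooth up to the end times are continuous up to
the end times. -/
theorem continuousOn_pd {u : ℝ → Space d → ℝ} {T : ℝ} (hT : 0 < T)
    (hu : ContDiffOn ℝ ∞ (fun z : ℝ × Space d => u z.1 z.2) (Icc 0 T ×ˢ univ)) (j : Fin d) :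
    ContinuousOn (fun z : ℝ × Space d => pd j (u z.1) z.2) (Icc 0 T ×ˢ univ) := by
  have hs : UniqueDiffOn ℝ (Icc 0 T ×ˢ univ : Set (ℝ × Space d)) :=
    (uniqueDiffOn_Icc hT).prod uniqueDiffOn_univ
  refine ((hu.continuousOn_fderivWithin hs (by simp)).clm_apply
    (continuousOn_const (c := ((0 : ℝ), (EuclideanSpace.single j 1 : Space d))))).congr ?_
  rintro ⟨t, x⟩ hz
  have h1 := (hu.differentiableOn (by simp) (t, x) hz).hasFDerivWithinAt
  have h2 : HasFDerivWithinAt (u t) ((fderivWithin ℝ (fun z : ℝ × Space d => u z.1 z.2)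
      (Icc 0 T ×ˢ univ) (t, x)).comp (ContinuousLinearMap.inr ℝ ℝ (Space d))) univ x :=
    h1.comp x (hasFDerivAt_prodMk_right t x).hasFDerivWithinAt fun y _ => ⟨hz.1, mem_univ y⟩
  simp only [pd, (hasFDerivWithinAt_univ.1 h2).fderiv]
  simp

end slices

theorem dx_sum {ι : Type*} {s : Finset ι} {F : ι → ℝ × Space d → ℝ} {z : ℝ × Space d}
    (hF : ∀ i ∈ s, DifferentiableAt ℝ (F i) z) (j : Fin d) :
    dx j (fun w => ∑ i ∈ s, F i w) z = ∑ i ∈ s, dx j (F i) z := by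
  simp [dx, fderiv_fun_sum hF]

/-- The chain rule for `H(x,DU)`. -/
theorem dx_hamiltonian_grad {A : Space d × Space d → ℝ} {U : ℝ × Space d → ℝ}
    {O : Set (ℝ × Space d)} (hA : ContDiff ℝ ∞ A) (hO : IsOpen O) (hU : ContDiffOn ℝ ∞ U O)
    {z : ℝ × Space d} (hz : z ∈ O) (j : Fin d) :
    dx j (fun w => A (w.2, grad U w)) z =
      fderiv ℝ A (z.2, grad U z) (EuclideanSpace.single j 1, 0)
      + ∑ i, fderiv ℝ A (z.2, grad U z) (0, EuclideanSpace.single i 1) * dx i (dx j U) z := by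
  have hg : DifferentiableAt ℝ (grad U) z :=
    ((contDiffOn_grad hO hU).contDiffAt (hO.mem_nhds hz)).differentiableAt (by simp)
  have h1 : HasFDerivAt (fun w : ℝ × Space d => (w.2, grad U w))
      ((ContinuousLinearMap.snd ℝ ℝ (Space d)).prod (fderiv ℝ (grad U) z)) z :=
    hasFDerivAt_snd.prodMk hg.hasFDerivAt
  have h2 : HasFDerivAt (fun w : ℝ × Space d => A (w.2, grad U w)) _ z :=
    ((hA.differentiable (by simp) (z.2, grad U z)).hasFDerivAt).comp z h1
  have h3 : fderiv ℝ (grad U) z (0, EuclideanSpace.single j 1)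
      = ∑ i, dx i (dx j U) z • EuclideanSpace.single i (1 : ℝ) := by
    rw [← sum_smul_single (fderiv ℝ (grad U) z (0, EuclideanSpace.single j 1))]
    refine Finset.sum_congr rfl fun i _ => ?_
    congr 1
    rw [dx_dx_comm hO hU hz]
    have h4 : HasFDerivAt (fun w => grad U w i)
        ((EuclideanSpace.proj i : Space d →L[ℝ] ℝ).comp (fderiv ℝ (grad U) z)) z :=
      (EuclideanSpace.proj i : Space d →L[ℝ] ℝ).hasFDerivAt.comp z hg.hasFDerivAt
    rw [dx, show dx i U = fun w => grad U w i from rfl, h4.fderiv]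
    simp
  rw [dx, h2.fderiv]
  have h5 : ((EuclideanSpace.single j (1 : ℝ), fderiv ℝ (grad U) z (0, EuclideanSpace.single j 1))
      : Space d × Space d) = (EuclideanSpace.single j 1, 0)
        + ∑ i, dx i (dx j U) z • ((0 : Space d), (EuclideanSpace.single i (1 : ℝ) : Space d)) := by
    rw [h3]
    ext1 <;> simp [Prod.fst_sum, Prod.snd_sum]
  simp only [ContinuousLinearMap.comp_apply, ContinuousLinearMap.prod_apply,
    ContinuousLinearMap.coe_snd']
  rw [h5, map_add, map_sum]
  simp only [map_smul, smul_eq_mul, mul_comm]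

end MFG

end

noncomputable section

namespace MFG

variable {d : ℕ}

/-- The drift `D_pH(x,DU)`. -/
def drift (H : Space d → Space d → ℝ) (U : ℝ × Space d → ℝ) (i : Fin d) (z : ℝ × Space d) : ℝ :=
  gradP H z.2 (grad U z) i

/-- The field `D_xH(x,DU)`. -/
def force (H : Space d → Space d → ℝ) (U : ℝ × Space d → ℝ) (i : Fin d) (z : ℝ × Space d) : ℝ :=
  gradX H z.2 (grad U z) i

section conversion

variable {H : Space d → Space d → ℝ} {U : ℝ × Space d → ℝ} {T : ℝ}

theorem contDiffOn_comp_grad {A : Space d × Space d → ℝ} (hA : ContDiff ℝ ∞ A)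
    {O : Set (ℝ × Space d)} (hO : IsOpen O) (hU : ContDiffOn ℝ ∞ U O) :
    ContDiffOn ℝ ∞ (fun z => A (z.2, grad U z)) O :=
  hA.comp_contDiffOn (contDiff_snd.contDiffOn.prodMk (contDiffOn_grad hO hU))

theorem drift_eq (hH : ContDiff ℝ ∞ fun z : Space d × Space d => H z.1 z.2) (i : Fin d) :
    drift H U i = fun z => fderiv ℝ (fun z : Space d × Space d => H z.1 z.2) (z.2, grad U z)
      (0, EuclideanSpace.single i 1) :=
  funext fun z => by rw [drift, gradP, gradient_apply, pd_eq_fderiv_uncurry hH]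

theorem force_eq (hH : ContDiff ℝ ∞ fun z : Space d × Space d => H z.1 z.2) (i : Fin d) :
    force H U i = fun z => fderiv ℝ (fun z : Space d × Space d => H z.1 z.2) (z.2, grad U z)
      (EuclideanSpace.single i 1, 0) :=
  funext fun z => by rw [force, gradX, gradient_apply, pd_fst_eq_fderiv_uncurry hH]

theorem contDiffOn_drift (hH : ContDiff ℝ ∞ fun z : Space d × Space d => H z.1 z.2)
    {O : Set (ℝ × Space d)} (hO : IsOpen O) (hU : ContDiffOn ℝ ∞ U O) (i : Fin d) :
    ContDiffOn ℝ ∞ (drift H U i) O := by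
  rw [drift_eq hH]
  exact contDiffOn_comp_grad (A := fun y => fderiv ℝ (fun z : Space d × Space d => H z.1 z.2) y
    (0, EuclideanSpace.single i 1)) ((hH.fderiv_right (m := ∞) (by simp)).clm_apply contDiff_const)
    hO hU

/-- A solution of the Fokker-Planck equation solves the drift-diffusion equation with the drift
`D_pH(x,Du)`. -/
theorem IsFokkerPlanckSolution.driftDiffusion {u μ : ℝ → Space d → ℝ} {φ : Space d → ℝ} {τ : ℝ}
    (hμ : IsFokkerPlanckSolution H u τ T φ μ)
    (hH : ContDiff ℝ ∞ fun z : Space d × Space d => H z.1 z.2)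
    (hu : ContDiffOn ℝ ∞ (fun z : ℝ × Space d => u z.1 z.2) (slab 0 T)) (hτ : 0 ≤ τ)
    (hb : ∃ B : ℝ, ∀ z ∈ slab 0 T, ∀ i, |drift H (fun z => u z.1 z.2) i z| ≤ B) :
    DriftDiffusion (drift H fun z => u z.1 z.2) (fun z => μ z.1 z.2) τ T := by
  have hsub : (slab τ T : Set (ℝ × Space d)) ⊆ slab 0 T := slab_subset hτ le_rfl
  have hsub' : (slab τ T : Set (ℝ × Space d)) ⊆ Ioc τ T ×ˢ univ :=
    prod_mono Ioo_subset_Ioc_self le_rfl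
  have hO := isOpen_slab (d := d) τ T
  have hB := fun i => (contDiffOn_drift hH (isOpen_slab 0 T) hu i).mono hsub
  have hμs := hμ.smooth.mono hsub'
  obtain ⟨B, hbB⟩ := hb
  refine ⟨hB, hμs, ?_, hμ.integrable.mono_set hsub', B, fun z hz => hbB z (hsub hz)⟩
  rintro ⟨t, x⟩ hz
  have ht : t ∈ Ioo τ T := mem_slab.1 hz
  have ht0 : t ∈ Ioo 0 T := ⟨hτ.trans_lt ht.1, ht.2⟩
  have dμ := differentiableAt_of_contDiffOn hO hμs hz
  have e1 : deriv (fun r => μ r x) t = dt (fun z : ℝ × Space d => μ z.1 z.2) (t, x) :=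
    (hasDerivAt_time dμ).deriv
  have hV := fun i => (hB i).mul hμs
  have hlap := contDiffOn_dx hO hμs
  have e2 : divergence (fun y => μ t y • gradP H y (∇ (u t) y)) x =
      ∑ i, dx i (fun w => drift H (fun z => u z.1 z.2) i w * μ w.1 w.2) (t, x) := by
    have h1 : (fun y => μ t y • gradP H y (∇ (u t) y)) = fun y => WithLp.toLp 2 fun i =>
        drift H (fun z => u z.1 z.2) i (t, y) * μ t y := by
      funext y
      have : ∇ (u t) y = grad (fun z => u z.1 z.2) (t, y) := gradient_slice hu ht0 y
      ext i
      simp [drift, this, mul_comm]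
    have h2 : ∀ y, DifferentiableAt ℝ (fun y => (WithLp.toLp 2 fun i =>
        drift H (fun z => u z.1 z.2) i (t, y) * μ t y : Space d)) y := fun y => by
      refine differentiableAt_euclidean.2 fun i => ?_
      exact (hasFDerivAt_slice (differentiableAt_of_contDiffOn hO (hV i)
        (mem_slab.2 ht))).differentiableAt
    rw [divergence, h1]
    refine Finset.sum_congr rfl fun i _ => ?_
    have h3 := (EuclideanSpace.proj i : Space d →L[ℝ] ℝ).hasFDerivAt.comp x (h2 x).hasFDerivAt
    have h4 := fderiv_slice (differentiableAt_of_contDiffOn hO (hV i) hz) i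
    rw [← h4]
    have h5 := congrArg (fun L : Space d →L[ℝ] ℝ => L (EuclideanSpace.single i 1)) h3.fderiv
    exact h5.symm
  have e3 : Δ (μ t) x = ∑ i, dx i (dx i fun z : ℝ × Space d => μ z.1 z.2) (t, x) :=
    laplacian_slice hμs ht x
  have key := hμ.equation t ht x
  rw [e1, e2, e3, sub_eq_iff_eq_add, add_comm, ← Finset.sum_add_distrib] at key
  rw [key]
  refine Finset.sum_congr rfl fun i _ => ?_
  rw [dx_add (differentiableAt_of_contDiffOn hO (hV i) hz)
    (differentiableAt_of_contDiffOn hO (hlap i) hz)]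

theorem abs_apply_le_norm (v : Space d) (i : Fin d) : |v i| ≤ ‖v‖ := by
  simpa using PiLp.norm_apply_le v i

variable {g : ℝ → ℝ} {uT m0 : Space d → ℝ} {u m : ℝ → Space d → ℝ}

theorem IsMFGSolution.smooth_slab (S : IsMFGSolution H g T uT m0 u m) :
    ContDiffOn ℝ ∞ (fun z : ℝ × Space d => u z.1 z.2) (slab 0 T) :=
  S.smooth_u.mono (prod_mono Ioo_subset_Icc_self le_rfl)

/-- The qualitative bounds for `u`, its gradient and the drift. -/
theorem IsMFGSolution.exists_bound (S : IsMFGSolution H g T uT m0 u m)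
    (hH : HamiltonianAssumptions H) : ∃ W : ℝ, ∀ z ∈ slab 0 T, |u z.1 z.2| ≤ W ∧
      (∀ j, |dx j (fun z : ℝ × Space d => u z.1 z.2) z| ≤ W) ∧
      ∀ j, |drift H (fun z => u z.1 z.2) j z| ≤ W := by
  obtain ⟨k, hk, K₁, hK₁, hlow⟩ := hH.gradP_lower
  obtain ⟨K₂, hK₂, hgrad⟩ := hH.gradP_bound
  set K := max K₁ K₂ with hK
  have hK0 : 0 < K := lt_max_of_lt_left hK₁
  obtain ⟨W, hW⟩ := S.bounded
  have hlow' : ∀ x p, k * H x p - K ≤ inner ℝ (gradP H x p) p - H x p := fun x p => by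
    linarith [hlow x p, le_max_left K₁ K₂]
  have hgrad' : ∀ x p, ‖gradP H x p‖ ^ 2 ≤ K + K * H x p := fun x p => by
    have := mul_le_mul_of_nonneg_right (le_max_right K₁ K₂) (hH.nonneg x p)
    linarith [hgrad x p, le_max_right K₁ K₂]
  set N : ℝ := √(K + K * (√(1 + K) + √K * W) ^ 2) with hN
  refine ⟨max W N, fun z hz => ?_⟩
  obtain ⟨t, x⟩ := z
  have ht : t ∈ Ioo 0 T := mem_slab.1 hz
  obtain ⟨h1, h2⟩ := hW t (Ioo_subset_Icc_self ht) x
  have h3 : ∇ (u t) x = grad (fun z => u z.1 z.2) (t, x) := gradient_slice S.smooth_slab ht x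
  rw [h3] at h2
  refine ⟨h1.trans (le_max_left _ _), fun j => ?_, fun j => ?_⟩
  · exact ((abs_apply_le_norm _ j).trans h2).trans (le_max_left _ _)
  · refine ((abs_apply_le_norm _ j).trans (Real.le_sqrt_of_sq_le ?_)).trans (le_max_right W N)
    refine (hgrad' _ _).trans ?_
    have h4 := hamiltonian_le hH.smooth hH.nonneg hk hK0 hlow' hgrad' x
      (grad (fun z => u z.1 z.2) (t, x))
    have h5 : (√(1 + K) + √K * ‖grad (fun z => u z.1 z.2) (t, x)‖) ^ 2 ≤
        (√(1 + K) + √K * W) ^ 2 := by gcongr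
    have := mul_le_mul_of_nonneg_left (h4.trans h5) hK0.le
    linarith

/-- A solution of the mean-field game is a solution of a Hamilton-Jacobi equation with nonnegative
source `g(m)`. -/
theorem IsMFGSolution.hamiltonJacobiSystem (S : IsMFGSolution H g T uT m0 u m) (hT : 0 < T)
    (hH : HamiltonianAssumptions H) {α : ℝ} (hg : CouplingAssumptions α g) (hm : InitialDatum m0)
    {k K B : ℝ} (hlow : ∀ x p, k * H x p - K ≤ inner ℝ (gradP H x p) p - H x p)
    (hgrad : ∀ x p, ‖gradP H x p‖ ^ 2 ≤ K + K * H x p)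
    (hforce : ∀ x p, ‖gradX H x p‖ ≤ K + K * H x p)
    (hB : ∀ x, |uT x| ≤ B ∧ ∀ j, |pd j uT x| ≤ B) :
    HamiltonJacobiSystem (fun z => u z.1 z.2) (fun z => g (m z.1 z.2))
      (fun z => H z.2 (grad (fun z => u z.1 z.2) z)) (drift H fun z => u z.1 z.2)
      (force H fun z => u z.1 z.2) T k K B := by
  set U : ℝ × Space d → ℝ := fun z => u z.1 z.2 with hUdef
  have hO := isOpen_slab (d := d) 0 T
  have hU : ContDiffOn ℝ ∞ U (slab 0 T) := S.smooth_slab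
  have hh : ContDiffOn ℝ ∞ (fun z => H z.2 (grad U z)) (slab 0 T) :=
    contDiffOn_comp_grad (A := fun y => H y.1 y.2) hH.smooth hO hU
  have hdd := fun i => contDiffOn_dx hO (contDiffOn_dx hO hU i) i
  have hdd' : ContDiffOn ℝ ∞ (fun z => ∑ i, dx i (dx i U) z) (slab 0 T) :=
    ContDiffOn.sum fun i _ => hdd i
  have hdt := contDiffOn_dt hO hU
  obtain ⟨W, hW⟩ := S.exists_bound hH
  have heq : ∀ z ∈ slab 0 T, dt U z + ∑ i, dx i (dx i U) z =
      H z.2 (grad U z) - g (m z.1 z.2) := by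
    rintro ⟨t, x⟩ hz
    have ht : t ∈ Ioo 0 T := mem_slab.1 hz
    have key := S.hamiltonJacobi t ht x
    have e1 : deriv (fun r => u r x) t = dt U (t, x) :=
      (hasDerivAt_time (differentiableAt_of_contDiffOn hO hU hz)).deriv
    have e2 : ∇ (u t) x = grad U (t, x) := gradient_slice hU ht x
    have e3 : Δ (u t) x = ∑ i, dx i (dx i U) (t, x) := laplacian_slice hU ht x
    rw [e1, e2, e3] at key
    simp only
    linarith
  -- the source is smooth by the equation, although `g` need not be
  have hf : ContDiffOn ℝ ∞ (fun z : ℝ × Space d => g (m z.1 z.2)) (slab 0 T) := by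
    refine ((hh.sub hdt).sub hdd').congr fun z hz => ?_
    linarith [heq z hz]
  have hm0 := (S.fokkerPlanck.driftDiffusion hH.smooth hU le_rfl
    ⟨W, fun z hz => (hW z hz).2.2⟩).nonneg hm.integrable S.fokkerPlanck.initial hm.nonneg
  refine ⟨hU, hf, hh.continuousOn, fun z hz => ?_, fun z _ => hH.nonneg _ _, heq,
    fun j z hz => ?_, fun z hz => ?_, fun z _ => ?_, fun j z _ => ?_, ⟨W, hW⟩, ?_⟩
  · rw [← hg.zero]
    exact hg.mono (hm0 z hz)
  · have D := fun {F : ℝ × Space d → ℝ} (hF : ContDiffOn ℝ ∞ F (slab 0 T)) =>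
      differentiableAt_of_contDiffOn hO hF hz
    have e1 := dx_congr hO heq hz j
    rw [dx_add (D hdt) (D hdd'), dx_sum (fun i _ => D (hdd i)), dx_sub (D hh) (D hf),
      dx_dt_comm hO hU hz,
      dx_hamiltonian_grad (A := fun y => H y.1 y.2) hH.smooth hO hU hz] at e1
    have e2 : ∀ i, dx j (dx i (dx i U)) z = dx i (dx i (dx j U)) z := fun i => by
      rw [dx_dx_comm hO (contDiffOn_dx hO hU i) hz]
      exact dx_congr hO (fun w hw => dx_dx_comm hO hU hw j i) hz i
    rw [Finset.sum_congr rfl fun i _ => e2 i] at e1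
    rw [Finset.sum_sub_distrib]
    simp only [force_eq hH.smooth, drift_eq hH.smooth]
    linarith
  · have := hlow z.2 (grad U z)
    rwa [PiLp.inner_apply, Finset.sum_congr rfl fun i _ => real_inner_comm _ _] at this
  · have := hgrad z.2 (grad U z)
    rwa [EuclideanSpace.real_norm_sq_eq] at this
  · exact (abs_apply_le_norm _ j).trans (hforce _ _)
  · intro Q hQ η hη
    have hTT : T ∈ Icc 0 T := ⟨hT.le, le_rfl⟩
    have hle : 𝓝[<] T ≤ 𝓝[Icc 0 T] T := by
      rw [← nhdsWithin_Ioo_eq_nhdsLT hT]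
      exact nhdsWithin_mono _ Ioo_subset_Icc_self
    have h1 := (eventually_forall_abs_sub_lt S.smooth_u.continuousOn hTT hQ hη).filter_mono hle
    have h2 := fun j => (eventually_forall_abs_sub_lt (continuousOn_pd hT S.smooth_u j) hTT hQ
      hη).filter_mono hle
    filter_upwards [h1, eventually_all.2 h2, Ioo_mem_nhdsLT hT] with t a1 a2 ht x hx
    have b1 := a1 x hx
    have b2 := fun j => a2 j x hx
    simp only [S.terminal] at b1 b2
    refine ⟨?_, fun j => ?_⟩
    · have := abs_sub_abs_le_abs_sub (u t x) (uT x)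
      simp only [hUdef]
      linarith [(hB x).1]
    · have h3 : pd j (u t) x = dx j U (t, x) :=
        fderiv_slice (differentiableAt_of_contDiffOn (z := (t, x)) hO hU (mem_slab.2 ht)) j
      have := abs_sub_abs_le_abs_sub (pd j (u t) x) (pd j uT x)
      rw [← h3]
      linarith [(hB x).2 j, b2 j]

end conversion

/-! ### Densities in a Lebesgue space -/

theorem mul_log_one_add_le {y p : ℝ} (hy : 0 ≤ y) (hp : 1 < p) :
    y * Real.log (1 + y) ≤ 2 ^ p / (p - 1) * (1 + y ^ p) := by
  have hp0 : 0 < p - 1 := by linarith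
  have h1 : Real.log (1 + y) ≤ (1 + y) ^ (p - 1) / (p - 1) :=
    Real.log_le_rpow_div (by linarith) hp0
  have h2 : (1 + y) ^ p ≤ 2 ^ p * (1 + y ^ p) := by
    have h3 : (1 + y) ≤ 2 * max 1 y := by linarith [le_max_left 1 y, le_max_right 1 y]
    have h4 : (max 1 y) ^ p ≤ 1 + y ^ p := by
      rcases le_total 1 y with h | h
      · rw [max_eq_right h]; linarith
      · rw [max_eq_left h, Real.one_rpow]; linarith [Real.rpow_nonneg hy p]
    calc (1 + y) ^ p ≤ (2 * max 1 y) ^ p :=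
          Real.rpow_le_rpow (by linarith) h3 (by linarith)
      _ = 2 ^ p * (max 1 y) ^ p := Real.mul_rpow (by norm_num) (by positivity)
      _ ≤ _ := by gcongr
  calc y * Real.log (1 + y) ≤ (1 + y) * ((1 + y) ^ (p - 1) / (p - 1)) :=
        mul_le_mul (by linarith) h1 (Real.log_nonneg (by linarith)) (by linarith)
    _ = (1 + y) ^ p / (p - 1) := by
        rw [← mul_div_assoc, ← Real.rpow_one_add' (by linarith) (by linarith)]
        congr 2; ring
    _ ≤ 2 ^ p * (1 + y ^ p) / (p - 1) := by gcongr
    _ = _ := by ring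

/-- Nonnegative functions of unit norm in `Lᵖ`, `p > 1`, which vanish outside a fixed ball have
bounded mass, weight and entropy. -/
theorem exists_densityBound (d : ℕ) {p R : ℝ} (hp : 1 < p) (hR : 0 < R) : ∃ M : ℝ, 0 ≤ M ∧
    ∀ φ : Space d → ℝ, (∀ x, 0 ≤ φ x) → Function.support φ ⊆ Metric.closedBall 0 R →
      MemLp φ (ENNReal.ofReal p) volume → eLpNorm φ (ENNReal.ofReal p) volume = 1 →
      DensityBound φ M := by
  set V : ℝ := volume.real (Metric.closedBall (0 : Space d) R) with hV
  have hV0 : 0 ≤ V := measureReal_nonneg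
  have hp0 : 0 < p := by linarith
  have hp1 : 0 < p - 1 := by linarith
  set A : ℝ := 2 ^ p / (p - 1) with hA
  have hA0 : 0 ≤ A := by positivity
  refine ⟨(1 + 2 * R + A) * (V + 1), by positivity, fun φ h0 hs hφ hn => ?_⟩
  -- `D` dominates all the densities; its integral is `V + 1`
  set D : Space d → ℝ := fun x => (Metric.closedBall (0 : Space d) R).indicator 1 x + φ x ^ p
    with hD
  have i1 : Integrable ((Metric.closedBall (0 : Space d) R).indicator (1 : Space d → ℝ)) := by
    rw [integrable_indicator_iff measurableSet_closedBall]
    exact integrableOn_const measure_closedBall_lt_top.ne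
  have i2 : Integrable fun x => φ x ^ p := by
    have := hφ.integrable_norm_rpow (by simpa using hp0) ENNReal.ofReal_ne_top
    simpa [ENNReal.toReal_ofReal hp0.le, abs_of_nonneg (h0 _)] using this
  have iD : Integrable D := i1.add i2
  have hD1 : ∫ x, D x = V + 1 := by
    rw [integral_add i1 i2, integral_indicator_one measurableSet_closedBall]
    congr 1
    rw [eLpNorm_eq_lintegral_rpow_enorm_toReal (by simpa using hp0) ENNReal.ofReal_ne_top,
      ENNReal.toReal_ofReal hp0.le] at hn
    have h1 : ∫⁻ x, ‖φ x‖ₑ ^ p = 1 := by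
      have := congrArg (fun y : ℝ≥0∞ => y ^ p) hn
      simpa [← ENNReal.rpow_mul, hp0.ne'] using this
    rw [integral_eq_lintegral_of_nonneg_ae (ae_of_all _ fun x => Real.rpow_nonneg (h0 x) p)
      i2.aestronglyMeasurable]
    have h2 : ∀ x, ENNReal.ofReal (φ x ^ p) = ‖φ x‖ₑ ^ p := fun x => by
      rw [Real.enorm_of_nonneg (h0 x), ENNReal.ofReal_rpow_of_nonneg (h0 x) hp0.le]
    simp [h2, h1]
  have hD0 : ∀ x, 0 ≤ D x := fun x =>
    add_nonneg (indicator_nonneg (fun _ _ => zero_le_one) x) (Real.rpow_nonneg (h0 x) p)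
  have ball : ∀ x, φ x ≠ 0 → D x = 1 + φ x ^ p := fun x hx => by
    simp only [hD, indicator_of_mem (hs hx), Pi.one_apply]
  have b1 : ∀ x, φ x ≤ D x := fun x => by
    by_cases hx : φ x = 0
    · rw [hx]; exact hD0 x
    · rw [ball x hx]
      rcases le_total (φ x) 1 with h | h
      · linarith [Real.rpow_nonneg (h0 x) p]
      · linarith [Real.self_le_rpow_of_one_le h hp.le]
  have b2 : ∀ x, φ x * weight x ≤ 2 * R * D x := fun x => by
    by_cases hx : φ x = 0
    · rw [hx, zero_mul]; have := hD0 x; positivity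
    · have h1 : ‖x‖ ≤ R := by simpa using hs hx
      calc φ x * weight x ≤ D x * (2 * R) :=
            mul_le_mul (b1 x) ((weight_le x).trans (by linarith)) (weight_nonneg x) (hD0 x)
        _ = _ := mul_comm _ _
  have b3 : ∀ x, φ x * Real.log (1 + φ x) ≤ A * D x := fun x => by
    by_cases hx : φ x = 0
    · rw [hx, zero_mul]; have := hD0 x; positivity
    · rw [ball x hx]; exact mul_log_one_add_le (h0 x) hp
  have p3 : ∀ x, 0 ≤ φ x * Real.log (1 + φ x) := fun x =>
    mul_nonneg (h0 x) (Real.log_nonneg (by linarith [h0 x]))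
  have mφ := hφ.aestronglyMeasurable
  have mw : Continuous (weight : Space d → ℝ) := contDiff_weight.continuous
  have i3 : Integrable φ := iD.mono' mφ (ae_of_all _ fun x => by
    rw [Real.norm_of_nonneg (h0 x)]; exact b1 x)
  have i4 : Integrable fun x => φ x * weight x :=
    (iD.const_mul (2 * R)).mono' (mφ.mul mw.aestronglyMeasurable) (ae_of_all _ fun x => by
      rw [Real.norm_of_nonneg (mul_nonneg (h0 x) (weight_nonneg x))]; exact b2 x)
  have i5 : Integrable fun x => φ x * Real.log (1 + φ x) :=
    (iD.const_mul A).mono' (mφ.mul (Real.measurable_log.comp_aemeasurable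
      (mφ.aemeasurable.const_add 1)).aestronglyMeasurable) (ae_of_all _ fun x => by
      rw [Real.norm_of_nonneg (p3 x)]; exact b3 x)
  have c1 : ∫ x, φ x ≤ V + 1 := hD1 ▸ integral_mono i3 iD b1
  have c2 : ∫ x, φ x * weight x ≤ 2 * R * (V + 1) := by
    rw [← hD1, ← integral_const_mul]
    exact integral_mono i4 (iD.const_mul _) b2
  have c3 : ∫ x, φ x * Real.log (1 + φ x) ≤ A * (V + 1) := by
    rw [← hD1, ← integral_const_mul]
    exact integral_mono i5 (iD.const_mul _) b3
  have q1 : 0 ≤ 2 * R * (V + 1) := by positivity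
  have q2 : 0 ≤ A * (V + 1) := by positivity
  exact ⟨h0, i3, i4, i5, by linarith, by linarith, by rw [integral_add i3 i5]; linarith⟩

end MFG

end

theorem mainTheorem6 {d : ℕ} (hd : 2 < d) {T : ℝ} (hT : 0 < T)
    {H : MFG.Space d → MFG.Space d → ℝ} (hH : MFG.HamiltonianAssumptions H)
    {uT : MFG.Space d → ℝ} (huT : MFG.TerminalDatum uT)
    {a c a' c' s p' R : ℝ} (hc : 2 < c) (ha : c * d / (c - 2) ≤ a)
    (haa' : 1 / a + 1 / a' = 1) (hcc' : 1 / c + 1 / c' = 1) (hs : 1 / c + 1 / s = 1 / 2)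
    (hp' : 1 < p') (hR : 0 < R) :
    ∃ C : ℝ≥0, ∀ (α : ℝ) (g : ℝ → ℝ), MFG.CouplingAssumptions α g →
      ∀ m0 : MFG.Space d → ℝ, MFG.InitialDatum m0 →
      ∀ u m : ℝ → MFG.Space d → ℝ, MFG.IsMFGSolution H g T uT m0 u m →
      ∀ τ : ℝ, 0 ≤ τ → τ < T →
      ∀ φ : MFG.Space d → ℝ, (∀ x, 0 ≤ φ x) →
        Function.support φ ⊆ Metric.closedBall 0 R →
        MemLp φ (ENNReal.ofReal p') volume → eLpNorm φ (ENNReal.ofReal p') volume = 1 →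
      ∀ ζ : ℝ → MFG.Space d → ℝ, MFG.IsFokkerPlanckSolution H u τ T φ ζ →
      ∀ ξ : MFG.Space d, ‖ξ‖ = 1 →
        ENNReal.ofReal |∫ x, fderiv ℝ (u τ) x ξ * φ x| ≤
          C + C * MFG.mixedNorm c a 0 T (fun t x => g (m t x)) *
              (1 + MFG.mixedNorm c' a' τ T ζ)
            + C * MFG.mixedNorm c a 0 T (fun t x => g (m t x)) ^ ((3 * s + 2) / (2 * s)) *
              (1 + MFG.mixedNorm c' a' τ T ζ ^ ((2 + s) / (2 * s))) := by
  obtain ⟨k, hk, K₁, hK₁, hlow⟩ := hH.gradP_lower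
  obtain ⟨K₂, hK₂, hgrad⟩ := hH.gradP_bound
  obtain ⟨K₃, hK₃, hforce⟩ := hH.gradX_bound
  obtain ⟨M, hM, hdens⟩ := MFG.exists_densityBound d hp' hR
  -- unless `uT` and its gradient are bounded there are no solutions
  by_cases hB : ∃ B : ℝ, ∀ x, |uT x| ≤ B ∧ ∀ j, |MFG.pd j uT x| ≤ B
  swap
  · refine ⟨0, fun α g hg m0 hm0 u m S => absurd ?_ hB⟩
    obtain ⟨B, hB'⟩ := S.bounded
    refine ⟨B, fun x => ?_⟩
    obtain ⟨h1, h2⟩ := hB' T ⟨hT.le, le_rfl⟩ x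
    rw [S.terminal] at h1 h2
    refine ⟨h1, fun j => ?_⟩
    rw [← MFG.gradient_apply]
    exact (MFG.abs_apply_le_norm _ j).trans h2
  obtain ⟨B, hB⟩ := hB
  have hB0 : 0 ≤ B := (abs_nonneg _).trans (hB 0).1
  set K : ℝ := K₁ + K₂ + K₃ with hK
  have hK0 : 0 ≤ K := by positivity
  obtain ⟨C, hC0, hC⟩ := MFG.exists_gradient_bound (B := B) hd hc ha hT hk hK0 hB0 hM
  refine ⟨(d * C + 1).toNNReal, fun α g hg m0 hm0 u m S τ hτ0 hτ φ hφ0 hφs hφL hφn ζ hζ ξ hξ => ?_⟩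
  have hc0 : 0 < c := by linarith
  have hs0 : s ≠ 0 := by
    rintro rfl
    rw [div_zero, add_zero, div_eq_div_iff hc0.ne' two_ne_zero] at hs
    linarith
  have hexp : (3 * s + 2) / (2 * s) = 2 - 1 / c := by
    have h1 : 1 / s = 1 / 2 - 1 / c := by linarith
    have h2 : (3 * s + 2) / (2 * s) = 3 / 2 + 1 / s := by field_simp
    rw [h2, h1]; ring
  have hγ : 0 < 2 - 1 / c := by
    have : 1 / c < 1 := by rw [div_lt_one hc0]; linarith
    linarith
  have hC1 : (1 : ℝ≥0) ≤ (d * C + 1).toNNReal := by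
    rw [← NNReal.coe_le_coe, Real.coe_toNNReal _ (by positivity)]
    simpa using mul_nonneg (Nat.cast_nonneg d) hC0
  rw [hexp]
  set N := MFG.mixedNorm c a 0 T (fun t x => g (m t x)) with hN
  by_cases hfin : N = ⊤
  · have h1 : ((d * C + 1).toNNReal : ℝ≥0∞) * N * (1 + MFG.mixedNorm c' a' τ T ζ) = ⊤ := by
      rw [hfin, ENNReal.mul_top (by exact_mod_cast (zero_lt_one.trans_le hC1).ne'),
        ENNReal.top_mul (by simp)]
    rw [h1]
    simp
  -- the gradient estimate for each of the partial derivatives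
  have key : ∀ j, |∫ x, MFG.pd j (u τ) x * φ x| ≤ C * (1 + N.toReal + N.toReal ^ (2 - 1 / c)) := by
    intro j
    have hK' : ∀ x p, 0 ≤ H x p := hH.nonneg
    obtain ⟨W, hW⟩ := S.exists_bound hH
    have S' := S.hamiltonJacobiSystem hT hH hg hm0 (k := k) (K := K) (B := B)
      (fun x p => by linarith [hlow x p])
      (fun x p => by
        have := mul_nonneg (by positivity : 0 ≤ K₁ + K₃) (hK' x p)
        rw [hK]; linarith [hgrad x p])
      (fun x p => by
        have := mul_nonneg (by positivity : 0 ≤ K₁ + K₂) (hK' x p)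
        rw [hK]; linarith [hforce x p]) hB
    have hτT : τ ∈ Icc 0 T := ⟨hτ0, hτ.le⟩
    have cpd := MFG.continuousOn_pd hT S.smooth_u j
    refine hC S' hτ0 hτ (hζ.driftDiffusion hH.smooth S.smooth_slab hτ0
      ⟨W, fun z hz => (hW z hz).2.2⟩) (hdens φ hφ0 hφs hφL hφn) hζ.initial hfin j
      (cpd.comp_continuous (Continuous.prodMk_right τ) fun x => ⟨hτT, mem_univ x⟩) fun x => ?_
    have h1 : Tendsto (fun r : ℝ => ((r, x) : ℝ × MFG.Space d)) (𝓝[>] τ)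
        (𝓝[Icc 0 T ×ˢ univ] (τ, x)) := by
      refine tendsto_nhdsWithin_iff.2 ⟨(Continuous.prodMk_left x).continuousAt.tendsto.mono_left
        nhdsWithin_le_nhds, ?_⟩
      filter_upwards [Ioo_mem_nhdsGT hτ] with r hr
      exact ⟨⟨hτ0.trans hr.1.le, hr.2.le⟩, mem_univ x⟩
    refine ((cpd (τ, x) ⟨hτT, mem_univ x⟩).tendsto.comp h1).congr' ?_
    filter_upwards [Ioo_mem_nhdsGT hτ] with r hr
    exact MFG.fderiv_slice (MFG.differentiableAt_of_contDiffOn (z := (r, x))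
      (MFG.isOpen_slab 0 T) S.smooth_slab (MFG.mem_slab.2 ⟨hτ0.trans_lt hr.1, hr.2⟩)) j
  have hint : ∀ j, Integrable fun x => MFG.pd j (u τ) x * φ x := by
    intro j
    obtain ⟨W, hW⟩ := S.bounded
    have hτT : τ ∈ Icc 0 T := ⟨hτ0, hτ.le⟩
    have cpd : Continuous (MFG.pd j (u τ)) :=
      (MFG.continuousOn_pd hT S.smooth_u j).comp_continuous (Continuous.prodMk_right τ)
        fun x => ⟨hτT, mem_univ x⟩
    refine (hdens φ hφ0 hφs hφL hφn).integrable.bdd_mul (c := W) cpd.aestronglyMeasurable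
      (ae_of_all _ fun x => ?_)
    rw [← MFG.gradient_apply]
    exact (MFG.abs_apply_le_norm _ j).trans (hW τ hτT x).2
  have hsum : |∫ x, fderiv ℝ (u τ) x ξ * φ x| ≤
      d * C * (1 + N.toReal + N.toReal ^ (2 - 1 / c)) := by
    have e1 : ∀ x, fderiv ℝ (u τ) x ξ * φ x = ∑ j, ξ j * (MFG.pd j (u τ) x * φ x) := fun x => by
      conv_lhs => rw [← MFG.sum_smul_single ξ, map_sum, Finset.sum_mul]
      refine Finset.sum_congr rfl fun j _ => ?_
      rw [map_smul, smul_eq_mul, mul_assoc]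
      rfl
    simp_rw [e1]
    rw [integral_finsetSum _ fun j _ => (hint j).const_mul (ξ j)]
    calc _ ≤ ∑ j, |∫ x, ξ j * (MFG.pd j (u τ) x * φ x)| := Finset.abs_sum_le_sum_abs _ _
      _ ≤ ∑ _j : Fin d, C * (1 + N.toReal + N.toReal ^ (2 - 1 / c)) := by
        refine Finset.sum_le_sum fun j _ => ?_
        rw [integral_const_mul, abs_mul]
        have : |ξ j| ≤ 1 := (MFG.abs_apply_le_norm ξ j).trans hξ.le
        exact (mul_le_of_le_one_left (abs_nonneg _) this).trans (key j)
      _ = _ := by simp [mul_assoc]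
  have hNr : ENNReal.ofReal N.toReal = N := ENNReal.ofReal_toReal hfin
  have hN0 : 0 ≤ N.toReal := ENNReal.toReal_nonneg
  have hdC : ENNReal.ofReal (d * C) ≤ (d * C + 1).toNNReal :=
    ENNReal.ofReal_le_ofReal (by linarith)
  calc ENNReal.ofReal |∫ x, fderiv ℝ (u τ) x ξ * φ x|
      ≤ ENNReal.ofReal (d * C * (1 + N.toReal + N.toReal ^ (2 - 1 / c))) :=
        ENNReal.ofReal_le_ofReal hsum
    _ = ENNReal.ofReal (d * C) * (1 + N + N ^ (2 - 1 / c)) := by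
        rw [ENNReal.ofReal_mul (by positivity), ENNReal.ofReal_add (by positivity) (by positivity),
          ENNReal.ofReal_add zero_le_one hN0, ENNReal.ofReal_one,
          ← ENNReal.ofReal_rpow_of_nonneg hN0 hγ.le, hNr]
    _ ≤ (d * C + 1).toNNReal * (1 + N + N ^ (2 - 1 / c)) := by gcongr
    _ = (d * C + 1).toNNReal + (d * C + 1).toNNReal * N * 1
        + (d * C + 1).toNNReal * N ^ (2 - 1 / c) * 1 := by ring
    _ ≤ _ := by
        gcongr
        · exact le_self_add
        · exact le_self_add
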